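/- **Theorem 2.1.** Let $E,B\in C^2(\mathbb R^3;\mathbb R^3)$ with $B(0)\neq 0$, let $x_0,v_0\in\mathbb R^3$, $T>0$, $1\le q\le 2$. For $b\in\mathbb R^3$ let $\hat b$ be the skew-symmetric matrix with $\hat b\,v=v\times b$, write $\widehat B(y)=\widehat{B(y)}$, and let $T_0>0$ be the (smallest positive) period of the flow $t\mapsto e^{t\widehat B(0)}$. For $0<\varepsilon\le 1$ consider the charged-particle dynamics under maximal-ordering scaling $$\dot x=v,\qquad \dot v=v\times \tfrac1\varepsilon B(\varepsilon^q x)+E(x),\qquad x(0)=x_0,\ v(0)=v_0,\qquad 0\le t\le T .$$ With $\varphi_1(s)=(e^s-1)/s=\sum_{k\ge 0}s^k/(k+1)!$ and $\widehat B_0=\widehat B(\varepsilon^q x_0)$, put $$\varphi^{S}_t(x,v)=\Bigl(x+t\,\varphi_1\bigl(\tfrac t\varepsilon\widehat B_0\bigr)v,\ e^{\frac t\varepsilon\widehat B_0}v\Bigr),$$ $$\varphi^{\mathcal T}_t(x,v)=\Bigl(x,\ e^{\frac t\varepsilon(\widehat B(\varepsilon^q x)-\widehat B_0)}v+t\,\varphi_1\bigl(\tfrac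 t\varepsilon(\widehat B(\varepsilon^q x)-\widehat B_0)\bigr)E(x)\Bigr).$$ The S2-new scheme with step $h$ is $(x^{n+1},v^{n+1})=\varphi^S_{h/2}\circ\varphi^{\mathcal T}_h\circ\varphi^S_{h/2}(x^n,v^n)$, $(x^0,v^0)=(x_0,v_0)$. Let $t_n=nh$ and $$v_\parallel(t)=\frac{B(\varepsilon^q x(t))}{|B(\varepsilon^q x(t))|}\Bigl(\frac{B(\varepsilon^q x(t))}{|B(\varepsilon^q x(t))|}\cdot v(t)\Bigr),\qquad v^n_\parallel=\frac{B(\varepsilon^q x^n)}{|B(\varepsilon^q x^n)|}\Bigl(\frac{B(\varepsilon^q x^n)}{|B(\varepsilon^q x^n)|}\cdot v^n\Bigr).$$ For every $R$ there are an integer $N_0\ge 1$ and constants $C,\varepsilon_0>0$, independent of $\varepsilon$, $h$ and $n$ (they may depend on $E,B,x_0,v_0,T,q,R$), such that the following holds for every $0<\varepsilon\le 1$ for which the solution exists on $[0,T]$ with $|x(t)|\le R$, $|v(t)|\le R$ there. For every integer $N\ge N_0$, with $h=\varepsilon T_0/N$, and every integer $n\ge 0$ with $nh\le T$: 1. $|x^n-x(t_n)|\le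 C\,\varepsilon^{q-2}h^2$; 2. if $\varepsilon\le\varepsilon_0$, then $|v^n_\parallel-v_\parallel(t_n)|\le C\,\varepsilon^{q-2}h^2$; 3. if $B\equiv B_0$ is a uniform field, then $|x^n-x(t_n)|\le C\,h^2$ and $|v^n_\parallel-v_\parallel(t_n)|\le C\,h^2$ (for all $0<\varepsilon\le 1$). -/

import Mathlib

/-- Three-dimensional Euclidean space. -/
abbrev E3 : Type := EuclideanSpace ℝ (Fin 3)

/-- The vector product `a × b` on Euclidean space. -/
def cross3 (a b : E3) : E3 :=
  WithLp.toLp 2 (crossProduct (WithLp.ofLp a) (WithLp.ofLp b))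

/-- The skew-symmetric matrix attached to `b = (b₁, b₂, b₃)`; it satisfies
`hatMatrix b *ᵥ v = v × b`. -/
def hatMatrix (b : E3) : Matrix (Fin 3) (Fin 3) ℝ :=
  !![0, b 2, -b 1;
     -b 2, 0, b 0;
     b 1, -b 0, 0]

/-- The operator on Euclidean space given by the matrix `hatMatrix b`. -/
noncomputable def hat (b : E3) : E3 →L[ℝ] E3 :=
  Matrix.toEuclideanCLM (n := Fin 3) (𝕜 := ℝ) (hatMatrix b)

/-- The entire function `φ₁(s) = (e^s - 1) / s = ∑ s^k / (k+1)!` of an operator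
(which need not be invertible). -/
noncomputable def phi1 (A : E3 →L[ℝ] E3) : E3 →L[ℝ] E3 :=
  ∑' k : ℕ, (((k + 1).factorial : ℝ)⁻¹) • A ^ k

/-- `(x, v)` solves, on the time interval `[0, T]`, the charged-particle dynamics
`x' = v`, `v' = v × (B(ε^q x) / ε) + E(x)`, `x(0) = x₀`, `v(0) = v₀`
(one-sided derivatives at the end points). -/
structure IsCPDSolution (E B : E3 → E3) (ε q T : ℝ) (x₀ v₀ : E3) (x v : ℝ → E3) : Prop where
  init_x : x 0 = x₀
  init_v : v 0 = v₀
  deriv_x : ∀ t ∈ Set.Icc 0 T, HasDerivWithinAt x (v t) (Set.Icc 0 T) t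
  deriv_v : ∀ t ∈ Set.Icc 0 T,
    HasDerivWithinAt v (cross3 (v t) (ε⁻¹ • B (ε ^ q • x t)) + E (x t)) (Set.Icc 0 T) t

/-- Exact propagator over time `t` of the subsystem
`x' = v`, `v' = ε⁻¹ B̂(ε^q x₀) v`. -/
noncomputable def flowS (B : E3 → E3) (ε q : ℝ) (x₀ : E3) (t : ℝ) (p : E3 × E3) : E3 × E3 :=
  (p.1 + t • phi1 ((t / ε) • hat (B (ε ^ q • x₀))) p.2,
   NormedSpace.exp ((t / ε) • hat (B (ε ^ q • x₀))) p.2)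

/-- Exact propagator over time `t` of the subsystem
`x' = 0`, `v' = ε⁻¹ (B̂(ε^q x) - B̂(ε^q x₀)) v + E(x)`. -/
noncomputable def flowT (E B : E3 → E3) (ε q : ℝ) (x₀ : E3) (t : ℝ) (p : E3 × E3) : E3 × E3 :=
  (p.1,
   NormedSpace.exp ((t / ε) • (hat (B (ε ^ q • p.1)) - hat (B (ε ^ q • x₀)))) p.2
    + t • phi1 ((t / ε) • (hat (B (ε ^ q • p.1)) - hat (B (ε ^ q • x₀)))) (E p.1))

/-- The numerical solution `(xⁿ, vⁿ)` of the S2-new Strang splitting scheme with step size `h`: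
each step is `flowS` over `h/2`, then `flowT` over `h`, then `flowS` over `h/2`. -/
noncomputable def s2new (E B : E3 → E3) (ε q : ℝ) (x₀ v₀ : E3) (h : ℝ) : ℕ → E3 × E3
  | 0 => (x₀, v₀)
  | n + 1 => flowS B ε q x₀ (h / 2) (flowT E B ε q x₀ h
      (flowS B ε q x₀ (h / 2) (s2new E B ε q x₀ v₀ h n)))

/-- The component `(b/|b|) ((b/|b|) · v)` of `v` parallel to `b` (meaningful for `b ≠ 0`). -/
noncomputable def parallelPart (b v : E3) : E3 :=
  (inner ℝ (‖b‖⁻¹ • b) v) • (‖b‖⁻¹ • b)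

/-- `P` is the (smallest positive) period of the flow `t ↦ e^{t b̂}`. -/
def IsRotationPeriod (b : E3) (P : ℝ) : Prop :=
  IsLeast {p : ℝ | 0 < p ∧ Function.Periodic (fun t : ℝ => NormedSpace.exp (t • hat b)) p} P

/-! ### The cross-product operator -/

/-! In the fast time `s = t / ε` the dynamics reads `x' = ε u`, `u' = A u + F`. Here `A` is the
rotation generator frozen at `ε^q x₀`, and `F = D(x) u + ε E(x)` is a small force with `D` of size
`κ = ε^q`. The step becomes `η = h / ε = T₀ / N` and the time interval has length `T / ε`. One step
of the scheme is a free rotation interrupted by one kick at its centre, and the kick equals `η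
F(midpoint)` up to a small residual (`exists_kick_error`). Hence the velocity error, rotated back,
is a sum of residuals minus the error of the composite midpoint rule for `e^{-sA} F(s)`
(`velocity_error_eq`).

A crude bound on that quadrature error loses a factor `1/ε`, since there are about `T / (ε η)`
cells. The loss is recovered by averaging. Since `N η` is exactly one period of `e^{s B̂(0)}`, the
midpoint rule with `N ≥ 3` cells integrates trigonometric polynomials of degree two without error.
Over one period the leading part of the integrand is of this type, and only the remainder, smaller
by one power of `ε`, contributes. Summed over the periods this gives `O(ε η²)` for `e^{-sA} F`
(`exists_midErr_exp_force`) and `O(δ η²)`, with `δ = ε² + κ`, for `F` itself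
(`exists_midErr_force`).

A discrete Grönwall argument then gives `O(ε η²)` for all errors (`exists_weak_bound`). To reach
`O(δ η²)` for the position and the parallel velocity, two structures are used. Along the axis `b` of
`A` the rotation disappears, so that only the quadrature of `F` enters (`inner_velocity_error_eq`).
Across the axis, the quantity `A x - ε u` is slow both for the flow and for the scheme, so `A`
applied to the position error is `ε` times a velocity error plus a quadrature term
(`apply_position_error_eq`). As `b` and `A` together control every vector, Grönwall closes in
`exists_strong_bound`.

Since `δ ≤ 2 ε^q` and `ε^q η² = ε^(q-2) h²`, this is the claim for small `ε`. For larger `ε`, where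
the frozen field might vanish, the weak bound suffices for the position. For a uniform field `κ =
0`, so `δ η² = h²`. -/

theorem hat_apply_coord (b v : E3) :
    hat b v 0 = v 1 * b 2 - v 2 * b 1 ∧ hat b v 1 = v 2 * b 0 - v 0 * b 2 ∧
      hat b v 2 = v 0 * b 1 - v 1 * b 0 := by
  have h : ∀ i, hat b v i = (hatMatrix b).mulVec v i := fun i => by
    rw [hat, Matrix.ofLp_toEuclideanCLM]
  refine ⟨?_, ?_, ?_⟩ <;>
    simp [h, hatMatrix, Matrix.mulVec, dotProduct, Fin.sum_univ_three] <;> ring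

theorem hat_apply (b v : E3) : hat b v = cross3 v b := by
  obtain ⟨h0, h1, h2⟩ := hat_apply_coord b v
  ext i
  fin_cases i <;> simp [cross3, crossProduct, h0, h1, h2]

theorem inner_E3 (a b : E3) : inner ℝ a b = a 0 * b 0 + a 1 * b 1 + a 2 * b 2 := by
  simp [PiLp.inner_apply, Fin.sum_univ_three]; ring

theorem norm_sq_E3 (a : E3) : ‖a‖ ^ 2 = a 0 ^ 2 + a 1 ^ 2 + a 2 ^ 2 := by
  rw [← real_inner_self_eq_norm_sq, inner_E3]; ring

theorem inner_hat_self (b v : E3) : inner ℝ (hat b v) v = 0 := by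
  obtain ⟨h0, h1, h2⟩ := hat_apply_coord b v
  rw [inner_E3, h0, h1, h2]; ring

theorem inner_axis_hat (b v : E3) : inner ℝ b (hat b v) = 0 := by
  obtain ⟨h0, h1, h2⟩ := hat_apply_coord b v
  rw [inner_E3, h0, h1, h2]; ring

/-- Lagrange's identity for the cross product. -/
theorem norm_hat_sq_add (b v : E3) :
    ‖hat b v‖ ^ 2 + (inner ℝ b v) ^ 2 = ‖b‖ ^ 2 * ‖v‖ ^ 2 := by
  obtain ⟨h0, h1, h2⟩ := hat_apply_coord b v
  rw [norm_sq_E3, norm_sq_E3, norm_sq_E3, inner_E3, h0, h1, h2]; ring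

theorem norm_hat_apply_le (b v : E3) : ‖hat b v‖ ≤ ‖b‖ * ‖v‖ := by
  refine abs_le_of_sq_le_sq' ?_ (by positivity) |>.2
  have := norm_hat_sq_add b v
  nlinarith [sq_nonneg (inner ℝ b v)]

theorem norm_hat_le (b : E3) : ‖hat b‖ ≤ ‖b‖ :=
  ContinuousLinearMap.opNorm_le_bound _ (norm_nonneg _) (norm_hat_apply_le b)

/-- Together the operator and its axis see every direction. This recovers the full position error
from its image under `A` and its axial component. -/
theorem norm_mul_norm_le_hat_add_inner (b v : E3) :
    ‖b‖ * ‖v‖ ≤ ‖hat b v‖ + |inner ℝ b v| := by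
  refine abs_le_of_sq_le_sq' ?_ (by positivity) |>.2
  have := norm_hat_sq_add b v
  have h2 := sq_abs (inner ℝ b v)
  nlinarith [mul_nonneg (norm_nonneg (hat b v)) (abs_nonneg (inner ℝ b v))]

theorem hat_add (a b : E3) : hat (a + b) = hat a + hat b := by
  ext v i
  obtain ⟨h0, h1, h2⟩ := hat_apply_coord (a + b) v
  obtain ⟨g0, g1, g2⟩ := hat_apply_coord a v
  obtain ⟨k0, k1, k2⟩ := hat_apply_coord b v
  fin_cases i <;> simp [h0, h1, h2, g0, g1, g2, k0, k1, k2] <;> ring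

theorem hat_smul (c : ℝ) (b : E3) : hat (c • b) = c • hat b := by
  ext v i
  obtain ⟨h0, h1, h2⟩ := hat_apply_coord (c • b) v
  obtain ⟨k0, k1, k2⟩ := hat_apply_coord b v
  fin_cases i <;> simp [h0, h1, h2, k0, k1, k2] <;> ring

/-- `hat` as a continuous linear map. -/
noncomputable def hatL : E3 →L[ℝ] (E3 →L[ℝ] E3) :=
  LinearMap.mkContinuous ⟨⟨hat, hat_add⟩, hat_smul⟩ 1 (by simpa using norm_hat_le)

theorem norm_hatL_le : ‖hatL‖ ≤ 1 := LinearMap.mkContinuous_norm_le _ zero_le_one _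

theorem hat_sub (a b : E3) : hat (a - b) = hat a - hat b := map_sub hatL a b

/-- Cayley–Hamilton for a skew operator in dimension three. The abstract part uses only this
relation, skewness and the axis. -/
theorem hat_pow_three (b : E3) : hat b * (hat b * hat b) = -(‖b‖ ^ 2) • hat b := by
  ext v i
  obtain ⟨h0, h1, h2⟩ := hat_apply_coord b v
  obtain ⟨g0, g1, g2⟩ := hat_apply_coord b (hat b v)
  obtain ⟨k0, k1, k2⟩ := hat_apply_coord b (hat b (hat b v))
  rw [norm_sq_E3]
  fin_cases i <;> simp [h0, h1, h2, g0, g1, g2, k0, k1, k2] <;> ring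

/-! ### Exponentials of operators and `phiOne` -/

section Exponential

set_option linter.unusedSectionVars false

variable {V : Type*} [NormedAddCommGroup V] [InnerProductSpace ℝ V] [CompleteSpace V]
  [Nontrivial V]

/-- The entire function `(e^s - 1) / s` of an operator on a Hilbert space. -/
noncomputable def phiOne (A : V →L[ℝ] V) : V →L[ℝ] V :=
  ∑' k : ℕ, (((k + 1).factorial : ℝ)⁻¹) • A ^ k

theorem hasDerivAt_exp_smul (A : V →L[ℝ] V) (t : ℝ) :
    HasDerivAt (fun s : ℝ => NormedSpace.exp (s • A)) (A * NormedSpace.exp (t • A)) t :=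
  hasDerivAt_exp_smul_const' A t

theorem exp_add_smul (A : V →L[ℝ] V) (s t : ℝ) :
    NormedSpace.exp ((s + t) • A) = NormedSpace.exp (s • A) * NormedSpace.exp (t • A) := by
  let _ := NormedAlgebra.restrictScalars ℚ ℝ (V →L[ℝ] V)
  rw [add_smul]
  exact NormedSpace.exp_add_of_commute (((Commute.refl A).smul_left s).smul_right t)

theorem commute_exp_smul (A : V →L[ℝ] V) (t : ℝ) :
    A * NormedSpace.exp (t • A) = NormedSpace.exp (t • A) * A :=
  (((Commute.refl A).smul_right t).exp_right).eq

theorem exp_mul_exp_neg (A : V →L[ℝ] V) (t : ℝ) :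
    NormedSpace.exp (t • A) * NormedSpace.exp ((-t) • A) = 1 := by
  rw [← exp_add_smul]; simp

/-- The squared norm along the flow has derivative `2 ⟪A w, w⟫ = 0`. -/
theorem norm_exp_smul_apply {A : V →L[ℝ] V}
    (hA : ∀ v, inner ℝ (A v) v = 0) (t : ℝ) (v : V) :
    ‖NormedSpace.exp (t • A) v‖ = ‖v‖ := by
  have hd : ∀ s : ℝ, HasDerivAt
      (fun s : ℝ => inner ℝ (NormedSpace.exp (s • A) v) (NormedSpace.exp (s • A) v))
      (0 : ℝ) s := by
    intro s
    have h1 : HasDerivAt (fun s : ℝ => NormedSpace.exp (s • A) v)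
        (A (NormedSpace.exp (s • A) v)) s :=
      (hasDerivAt_exp_smul A s).clm_apply (hasDerivAt_const s v) |>.congr_deriv (by simp)
    have h2 := h1.inner ℝ h1
    refine h2.congr_deriv ?_
    rw [real_inner_comm, hA, add_zero]
  have hc := is_const_of_deriv_eq_zero (fun s => (hd s).differentiableAt)
    (fun s => (hd s).deriv) t 0
  simp only [real_inner_self_eq_norm_sq, zero_smul, NormedSpace.exp_zero,
    one_apply_eq_self] at hc
  exact (sq_eq_sq₀ (norm_nonneg _) (norm_nonneg _)).1 hc

theorem norm_exp_smul_le_one {A : V →L[ℝ] V}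
    (hA : ∀ v, inner ℝ (A v) v = 0) (t : ℝ) : ‖NormedSpace.exp (t • A)‖ ≤ 1 :=
  ContinuousLinearMap.opNorm_le_bound _ zero_le_one fun v => by
    rw [norm_exp_smul_apply hA, one_mul]

theorem inner_axis_exp {A : V →L[ℝ] V} {b : V}
    (hb : ∀ v, inner ℝ b (A v) = 0) (t : ℝ) (v : V) :
    inner ℝ b (NormedSpace.exp (t • A) v) = inner ℝ b v := by
  have hd : ∀ s : ℝ, HasDerivAt (fun s : ℝ => inner ℝ b (NormedSpace.exp (s • A) v))
      (0 : ℝ) s := by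
    intro s
    have h1 : HasDerivAt (fun s : ℝ => NormedSpace.exp (s • A) v)
        (A (NormedSpace.exp (s • A) v)) s :=
      (hasDerivAt_exp_smul A s).clm_apply (hasDerivAt_const s v) |>.congr_deriv (by simp)
    refine ((hasDerivAt_const s b).inner ℝ h1).congr_deriv ?_
    simp [hb]
  have hc := is_const_of_deriv_eq_zero (fun s => (hd s).differentiableAt)
    (fun s => (hd s).deriv) t 0
  simpa using hc

theorem summable_phiOne_bound (r : ℝ) :
    Summable fun k : ℕ => ((k + 1).factorial : ℝ)⁻¹ * r ^ k := by
  have h := NormedSpace.expSeries_div_summable (𝔸 := ℝ) |r|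
  refine Summable.of_norm_bounded h fun k => ?_
  rw [norm_mul, norm_pow, Real.norm_eq_abs r, div_eq_inv_mul]
  gcongr
  rw [norm_inv, RCLike.norm_natCast]
  gcongr
  omega

theorem summable_phiOne (A : V →L[ℝ] V) :
    Summable fun k : ℕ => (((k + 1).factorial : ℝ)⁻¹) • A ^ k := by
  refine Summable.of_norm_bounded (summable_phiOne_bound ‖A‖) fun k => ?_
  rw [norm_smul, norm_inv, RCLike.norm_natCast]
  gcongr
  exact norm_pow_le A k

/-- Termwise differentiation of the series. On the ball of radius `|t| + 1`, which contains both `0`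
and `t`, the derivatives are dominated by an exponential series. -/
theorem hasDerivAt_smul_phiOne (A : V →L[ℝ] V) (t : ℝ) :
    HasDerivAt (fun s : ℝ => s • phiOne (s • A)) (NormedSpace.exp (t • A)) t := by
  have hs : ∀ s : ℝ, s • phiOne (s • A) =
      ∑' k : ℕ, ((((k + 1).factorial : ℝ)⁻¹ * s ^ (k + 1)) • A ^ k) := by
    intro s
    rw [phiOne, ← (summable_phiOne (s • A)).tsum_const_smul]
    refine tsum_congr fun k => ?_
    rw [smul_pow, smul_smul, smul_smul]
    congr 1; ring
  have he : NormedSpace.exp (t • A) = ∑' k : ℕ, ((k.factorial : ℝ)⁻¹ * t ^ k) • A ^ k := by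
    rw [NormedSpace.exp_eq_tsum ℝ]
    refine tsum_congr fun k => ?_
    rw [smul_pow, smul_smul]
  rw [he, funext hs]
  have hu := NormedSpace.expSeries_div_summable (𝔸 := ℝ) ((|t| + 1) * ‖A‖)
  refine hasDerivAt_tsum_of_isPreconnected (𝕜 := ℝ) (F := V →L[ℝ] V)
    (g := fun (k : ℕ) (s : ℝ) => (((k + 1).factorial : ℝ)⁻¹ * s ^ (k + 1)) • A ^ k)
    (g' := fun (k : ℕ) (s : ℝ) => ((k.factorial : ℝ)⁻¹ * s ^ k) • A ^ k) hu (t := Metric.ball (0 : ℝ) (|t| + 1)) Metric.isOpen_ball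
    (convex_ball _ _).isPreconnected (y₀ := 0) (y := t) ?_ ?_ (by simp; positivity) ?_ (by simp)
  · intro k s _
    have := ((hasDerivAt_pow (k + 1) s).const_mul (((k + 1).factorial : ℝ)⁻¹)).smul_const (A ^ k)
    refine this.congr_deriv ?_
    congr 1
    rw [Nat.factorial_succ]
    push_cast
    have : ((k : ℝ) + 1) ≠ 0 := by positivity
    have : (k.factorial : ℝ) ≠ 0 := by positivity
    field_simp
  · intro k s hs
    have hs' : |s| ≤ |t| + 1 := by
      have := Metric.mem_ball.1 hs
      rw [dist_zero_right, Real.norm_eq_abs] at this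
      exact this.le
    rw [norm_smul, norm_mul, norm_inv, RCLike.norm_natCast, norm_pow, Real.norm_eq_abs,
      mul_pow, div_eq_inv_mul, mul_assoc]
    gcongr
    exact norm_pow_le A k
  · refine summable_of_ne_finset_zero (s := ∅) fun k _ => by simp

/-- The tail coefficients `1/(k+3)!` are compared with `1/k!`, and the surplus powers of `‖A‖` are
at most one. -/
theorem norm_phiOne_sub_le (A : V →L[ℝ] V) (hA : ‖A‖ ≤ 1) :
    ‖phiOne A - (1 + (2 : ℝ)⁻¹ • A)‖ ≤ Real.exp 1 * ‖A‖ ^ 2 := by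
  have h := (summable_phiOne A).sum_add_tsum_nat_add 2
  have h2 : phiOne A - (1 + (2 : ℝ)⁻¹ • A) =
      ∑' k : ℕ, (((k + 2 + 1).factorial : ℝ)⁻¹) • A ^ (k + 2) := by
    rw [phiOne, ← h, Finset.sum_range_succ, Finset.sum_range_one]
    norm_num
  rw [h2]
  have he : HasSum (fun k : ℕ => ((k.factorial : ℝ)⁻¹) * ‖A‖ ^ 2) (Real.exp 1 * ‖A‖ ^ 2) := by
    have := (NormedSpace.expSeries_div_hasSum_exp (𝔸 := ℝ) 1).mul_right (‖A‖ ^ 2)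
    simpa [Real.exp_eq_exp_ℝ, div_eq_inv_mul] using this
  refine tsum_of_norm_bounded he fun k => ?_
  rw [norm_smul, norm_inv, RCLike.norm_natCast]
  gcongr
  · omega
  · calc ‖A ^ (k + 2)‖ ≤ ‖A‖ ^ (k + 2) := norm_pow_le A _
      _ = ‖A‖ ^ k * ‖A‖ ^ 2 := pow_add _ _ _
      _ ≤ 1 * ‖A‖ ^ 2 := by gcongr; exact pow_le_one₀ (norm_nonneg _) hA
      _ = ‖A‖ ^ 2 := one_mul _

theorem mul_phiOne (A : V →L[ℝ] V) : A * phiOne A = NormedSpace.exp A - 1 := by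
  have hd : ∀ s : ℝ, HasDerivAt (fun s : ℝ => A * (s • phiOne (s • A)) - NormedSpace.exp (s • A))
      0 s := fun s =>
    (((hasDerivAt_smul_phiOne A s).const_mul A).sub (hasDerivAt_exp_smul A s)).congr_deriv
      (sub_self _)
  have hc := is_const_of_deriv_eq_zero (fun s => (hd s).differentiableAt)
    (fun s => (hd s).deriv) 1 0
  simp only [one_smul, zero_smul, mul_zero, NormedSpace.exp_zero, zero_sub] at hc
  rw [← sub_eq_zero] at hc ⊢
  rw [← hc]; abel

theorem commute_phiOne (A : V →L[ℝ] V) : A * phiOne A = phiOne A * A := by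
  rw [phiOne, ← (summable_phiOne A).tsum_mul_left, ← (summable_phiOne A).tsum_mul_right]
  refine tsum_congr fun k => ?_
  rw [mul_smul_comm, smul_mul_assoc, ← pow_succ, ← pow_succ']

/-- Additivity of `∫₀ᵗ e^{sA} ds` over adjacent intervals: as functions of `b` both sides have the
same derivative and agree at `b = 0`. It merges the two half steps of the scheme. -/
theorem phiOne_half_add (A : V →L[ℝ] V) (a b : ℝ) :
    a • phiOne (a • A) + (b • phiOne (b • A)) * NormedSpace.exp (a • A) =
      (a + b) • phiOne ((a + b) • A) := by
  have hd : ∀ s : ℝ, HasDerivAt (fun s : ℝ => (s • phiOne (s • A)) * NormedSpace.exp (a • A) -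
      (a + s) • phiOne ((a + s) • A)) 0 s := by
    intro s
    have h1 := (hasDerivAt_smul_phiOne A s).mul_const (NormedSpace.exp (a • A))
    have h2 := (hasDerivAt_smul_phiOne A (a + s)).comp_const_add a s
    refine (h1.sub h2).congr_deriv ?_
    rw [add_comm a s, exp_add_smul, sub_self]
  have hc := is_const_of_deriv_eq_zero (fun s => (hd s).differentiableAt)
    (fun s => (hd s).deriv) b 0
  simp only [zero_smul, add_zero, zero_mul, zero_sub] at hc
  rw [sub_eq_iff_eq_add] at hc
  rw [hc]; abel

end Exponential

/-! ### Functions with Lipschitz derivative -/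

section LipschitzDerivative

variable {F G : Type*} [NormedAddCommGroup F] [NormedSpace ℝ F]
  [NormedAddCommGroup G] [NormedSpace ℝ G]

/-- `g` has a derivative on `s`, and `c` bounds `g`, its derivative, and the Lipschitz constant of
its derivative on `s`. -/
def C11On (g : ℝ → F) (s : Set ℝ) (c : ℝ) : Prop :=
  ∃ g' : ℝ → F, (∀ t ∈ s, HasDerivWithinAt g (g' t) s t) ∧ (∀ t ∈ s, ‖g t‖ ≤ c) ∧
    (∀ t ∈ s, ‖g' t‖ ≤ c) ∧ ∀ t ∈ s, ∀ r ∈ s, ‖g' t - g' r‖ ≤ c * |t - r|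

theorem C11On.norm_le {g : ℝ → F} {s : Set ℝ} {c : ℝ} (h : C11On g s c) {t : ℝ} (ht : t ∈ s) :
    ‖g t‖ ≤ c := by
  obtain ⟨g', _, h1, _⟩ := h
  exact h1 t ht

theorem C11On.continuousOn {g : ℝ → F} {s : Set ℝ} {c : ℝ} (h : C11On g s c) :
    ContinuousOn g s := by
  obtain ⟨g', h0, _⟩ := h
  exact fun t ht => (h0 t ht).continuousWithinAt

theorem C11On.lipschitz {g : ℝ → F} {s : Set ℝ} {c : ℝ} (h : C11On g s c) (hs : Convex ℝ s)
    {t r : ℝ} (ht : t ∈ s) (hr : r ∈ s) : ‖g t - g r‖ ≤ c * |t - r| := by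
  obtain ⟨g', h0, _, h2, _⟩ := h
  exact hs.norm_image_sub_le_of_norm_hasDerivWithin_le h0 h2 hr ht

theorem C11On.mono {g : ℝ → F} {s s' : Set ℝ} {c c' : ℝ} (h : C11On g s c) (hs : s' ⊆ s)
    (hc : c ≤ c') : C11On g s' c' := by
  obtain ⟨g', h0, h1, h2, h3⟩ := h
  exact ⟨g', fun t ht => (h0 t (hs ht)).mono hs, fun t ht => (h1 t (hs ht)).trans hc,
    fun t ht => (h2 t (hs ht)).trans hc, fun t ht r hr =>
      (h3 t (hs ht) r (hs hr)).trans (by gcongr)⟩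

theorem C11On.congr {g f : ℝ → F} {s : Set ℝ} {c : ℝ} (h : C11On g s c)
    (hfg : ∀ t ∈ s, f t = g t) : C11On f s c := by
  obtain ⟨g', h0, h1, h2, h3⟩ := h
  exact ⟨g', fun t ht => (h0 t ht).congr hfg (hfg t ht),
    fun t ht => by rw [hfg t ht]; exact h1 t ht, h2, h3⟩

theorem C11On.const (v : F) (s : Set ℝ) : C11On (fun _ => v) s ‖v‖ :=
  ⟨fun _ => 0, fun _ _ => hasDerivWithinAt_const _ _ _, fun _ _ => le_rfl,
    fun _ _ => by simp, fun _ _ _ _ => by simp; positivity⟩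

theorem C11On.add {f g : ℝ → F} {s : Set ℝ} {a b : ℝ} (hf : C11On f s a) (hg : C11On g s b) :
    C11On (fun t => f t + g t) s (a + b) := by
  obtain ⟨f', f0, f1, f2, f3⟩ := hf
  obtain ⟨g', g0, g1, g2, g3⟩ := hg
  refine ⟨fun t => f' t + g' t, fun t ht => (f0 t ht).add (g0 t ht),
    fun t ht => norm_add_le_of_le (f1 t ht) (g1 t ht),
    fun t ht => norm_add_le_of_le (f2 t ht) (g2 t ht), fun t ht r hr => ?_⟩
  rw [add_mul, add_sub_add_comm]
  exact norm_add_le_of_le (f3 t ht r hr) (g3 t ht r hr)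

theorem C11On.clm (L : F →L[ℝ] G) {f : ℝ → F} {s : Set ℝ} {a k : ℝ} (hf : C11On f s a)
    (hL : ‖L‖ ≤ k) : C11On (fun t => L (f t)) s (k * a) := by
  obtain ⟨f', f0, f1, f2, f3⟩ := hf
  have hk : 0 ≤ k := (norm_nonneg _).trans hL
  refine ⟨fun t => L (f' t), fun t ht => L.hasFDerivAt.comp_hasDerivWithinAt t (f0 t ht),
    fun t ht => L.le_of_opNorm_le_of_le hL (f1 t ht),
    fun t ht => L.le_of_opNorm_le_of_le hL (f2 t ht), fun t ht r hr => ?_⟩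
  rw [← map_sub, mul_assoc]
  exact L.le_of_opNorm_le_of_le hL (f3 t ht r hr)

theorem C11On.smul_const {f : ℝ → F} {s : Set ℝ} {a c : ℝ} (hc : 0 ≤ c) (hf : C11On f s a) :
    C11On (fun t => c • f t) s (c * a) := by
  obtain ⟨f', f0, f1, f2, f3⟩ := hf
  have key : ∀ (x : F) (d : ℝ), ‖x‖ ≤ d → ‖c • x‖ ≤ c * d := fun x d h => by
    rw [norm_smul, Real.norm_of_nonneg hc]; gcongr
  refine ⟨fun t => c • f' t, fun t ht => (f0 t ht).const_smul c, fun t ht => key _ _ (f1 t ht),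
    fun t ht => key _ _ (f2 t ht), fun t ht r hr => ?_⟩
  rw [← smul_sub, mul_assoc]
  exact key _ _ (f3 t ht r hr)

/-- The increment of the product-rule derivative splits into four products, each at most `a * b * |t
- r|`; hence the factor four. -/
theorem C11On.clm_apply {M : ℝ → F →L[ℝ] G} {f : ℝ → F} {s : Set ℝ} {a b : ℝ}
    (hs : Convex ℝ s) (hM : C11On M s a) (hf : C11On f s b) :
    C11On (fun t => M t (f t)) s (4 * (a * b)) := by
  have hM' := fun t ht r hr => hM.lipschitz hs (t := t) (r := r) ht hr
  have hf' := fun t ht r hr => hf.lipschitz hs (t := t) (r := r) ht hr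
  obtain ⟨M', m0, m1, m2, m3⟩ := hM
  obtain ⟨f', f0, f1, f2, f3⟩ := hf
  refine ⟨fun t => M' t (f t) + M t (f' t), fun t ht => (m0 t ht).clm_apply (f0 t ht),
    fun t ht => ?_, fun t ht => ?_, fun t ht r hr => ?_⟩
  all_goals
    have ha : 0 ≤ a := (norm_nonneg _).trans (m1 t ht)
    have hb : 0 ≤ b := (norm_nonneg _).trans (f1 t ht)
    have hab := mul_nonneg ha hb
  · have := (M t).le_of_opNorm_le_of_le (m1 t ht) (f1 t ht)
    linarith
  · have h1 := (M t).le_of_opNorm_le_of_le (m1 t ht) (f2 t ht)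
    have h2 := (M' t).le_of_opNorm_le_of_le (m2 t ht) (f1 t ht)
    have := norm_add_le (M' t (f t)) (M t (f' t))
    linarith
  · have e : M' t (f t) + M t (f' t) - (M' r (f r) + M r (f' r)) =
        ((M' t - M' r) (f t) + M' r (f t - f r)) + ((M t - M r) (f' t) + M r (f' t - f' r)) := by
      simp only [sub_apply, map_sub]; abel
    rw [e]
    have h1 := (M' t - M' r).le_of_opNorm_le_of_le (m3 t ht r hr) (f1 t ht)
    have h2 := (M' r).le_of_opNorm_le_of_le (m2 r hr) (hf' t ht r hr)
    have h3 := (M t - M r).le_of_opNorm_le_of_le (hM' t ht r hr) (f2 t ht)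
    have h4 := (M r).le_of_opNorm_le_of_le (m1 r hr) (f3 t ht r hr)
    refine (norm_add_le_of_le (norm_add_le_of_le h1 h2) (norm_add_le_of_le h3 h4)).trans ?_
    apply le_of_eq; ring

/-- Solutions of a linear equation `g' = M g + k` with bounded and Lipschitz `k`. -/
theorem C11On.of_linear (M : F →L[ℝ] F) {g k : ℝ → F} {s : Set ℝ} {c K : ℝ} (hs : Convex ℝ s)
    (hK : ‖M‖ ≤ K) (hg : ∀ t ∈ s, HasDerivWithinAt g (M (g t) + k t) s t)
    (hgc : ∀ t ∈ s, ‖g t‖ ≤ c) (hkc : ∀ t ∈ s, ‖k t‖ ≤ c)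
    (hk : ∀ t ∈ s, ∀ r ∈ s, ‖k t - k r‖ ≤ c * |t - r|) :
    C11On g s ((K + 1) ^ 2 * c) := by
  have hK0 : 0 ≤ K := (norm_nonneg _).trans hK
  have h2 : ∀ t ∈ s, ‖M (g t) + k t‖ ≤ (K + 1) * c := fun t ht => by
    have := norm_add_le_of_le (M.le_of_opNorm_le_of_le hK (hgc t ht)) (hkc t ht)
    linarith
  refine ⟨fun t => M (g t) + k t, hg, fun t ht => ?_, fun t ht => (h2 t ht).trans ?_,
    fun t ht r hr => ?_⟩
  · have hc : 0 ≤ c := (norm_nonneg _).trans (hgc t ht)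
    nlinarith [hgc t ht, mul_nonneg hK0 hc, mul_nonneg hK0 (mul_nonneg hK0 hc)]
  · have hc : 0 ≤ c := (norm_nonneg _).trans (hgc t ht)
    nlinarith [hgc t ht, mul_nonneg hK0 hc, mul_nonneg hK0 (mul_nonneg hK0 hc)]
  · have hc : 0 ≤ c := (norm_nonneg _).trans (hgc t ht)
    have hl := hs.norm_image_sub_le_of_norm_hasDerivWithin_le hg h2 hr ht
    have e : M (g t) + k t - (M (g r) + k r) = M (g t - g r) + (k t - k r) := by
      rw [map_sub]; abel
    rw [e]
    refine (norm_add_le_of_le (M.le_of_opNorm_le_of_le hK hl) (hk t ht r hr)).trans ?_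
    rw [Real.norm_eq_abs]
    have := mul_nonneg (mul_nonneg hK0 hc) (abs_nonneg (t - r))
    nlinarith

/-- A Grönwall bound for functions vanishing at the left end point. -/
theorem norm_le_of_deriv_le_of_zero {g g' : ℝ → F} {L K c : ℝ} (hK : 1 ≤ K) (hc : 0 ≤ c)
    (hg : ∀ t ∈ Set.Icc 0 L, HasDerivWithinAt g (g' t) (Set.Icc 0 L) t) (h0 : g 0 = 0)
    (hb : ∀ t ∈ Set.Icc 0 L, ‖g' t‖ ≤ K * ‖g t‖ + c) :
    ∀ t ∈ Set.Icc 0 L, ‖g t‖ ≤ c * Real.exp (K * L) := by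
  intro t ht
  have h := norm_le_gronwallBound_of_norm_deriv_right_le (f := g) (f' := g') (δ := 0) (K := K)
    (ε := c) (a := 0) (b := L) (fun t ht => (hg t ht).continuousWithinAt)
    (fun t ht => ((hg t ⟨ht.1, ht.2.le⟩).mono_of_mem_nhdsWithin
      (Icc_mem_nhdsGE_of_mem ht))) (by simp [h0])
    (fun t ht => hb t ⟨ht.1, ht.2.le⟩) t ht
  refine h.trans ?_
  have hK0 : K ≠ 0 := by positivity
  rw [gronwallBound_of_K_ne_0 hK0]
  simp only [zero_mul, zero_add, sub_zero]
  have h1 : c / K ≤ c := div_le_self hc hK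
  have h2 : Real.exp (K * t) ≤ Real.exp (K * L) := by
    have := ht.2; gcongr
  have h3 := Real.exp_pos (K * L)
  have h4 : 0 ≤ Real.exp (K * t) - 1 := by
    have : 0 ≤ K * t := mul_nonneg (by linarith) ht.1
    linarith [Real.add_one_le_exp (K * t)]
  calc c / K * (Real.exp (K * t) - 1) ≤ c * (Real.exp (K * t) - 1) := by gcongr
    _ ≤ _ := by gcongr; linarith

/-- The Grönwall bound on `g`, fed back into the bound on `g'`, yields growth linear in `t` from the
zero initial value. -/
theorem norm_le_mul_of_deriv_le_of_zero {g g' : ℝ → F} {L K c : ℝ} (hK : 1 ≤ K) (hc : 0 ≤ c)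
    (hg : ∀ t ∈ Set.Icc 0 L, HasDerivWithinAt g (g' t) (Set.Icc 0 L) t) (h0 : g 0 = 0)
    (hb : ∀ t ∈ Set.Icc 0 L, ‖g' t‖ ≤ K * ‖g t‖ + c) :
    ∀ t ∈ Set.Icc 0 L, ‖g t‖ ≤ (K * Real.exp (K * L) + 1) * c * t := by
  intro t ht
  have hL : (0 : ℝ) ∈ Set.Icc 0 L := ⟨le_rfl, ht.1.trans ht.2⟩
  have h1 : ∀ s ∈ Set.Icc 0 L, ‖g' s‖ ≤ (K * Real.exp (K * L) + 1) * c := fun s hs => by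
    have h2 := norm_le_of_deriv_le_of_zero hK hc hg h0 hb s hs
    calc _ ≤ K * ‖g s‖ + c := hb s hs
      _ ≤ K * (c * Real.exp (K * L)) + c := by gcongr
      _ = _ := by ring
  have := (convex_Icc 0 L).norm_image_sub_le_of_norm_hasDerivWithin_le hg h1 hL ht
  simpa [h0, abs_of_nonneg ht.1] using this

theorem norm_le_pow_of_deriv_le {g g' : ℝ → F} {L c : ℝ} (n : ℕ)
    (hg : ∀ t ∈ Set.Icc 0 L, HasDerivWithinAt g (g' t) (Set.Icc 0 L) t) (h0 : g 0 = 0)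
    (hb : ∀ t ∈ Set.Icc 0 L, ‖g' t‖ ≤ c * t ^ n) :
    ∀ t ∈ Set.Icc 0 L, ‖g t‖ ≤ c * t ^ (n + 1) := by
  intro t ht
  -- The sign of `c` is not assumed: it follows from the bound at `t` as soon as `t > 0`.
  have hc : 0 ≤ c ∨ t = 0 := by
    by_cases h : t = 0
    · exact Or.inr h
    · have htp : 0 < t := lt_of_le_of_ne ht.1 (Ne.symm h)
      exact Or.inl (nonneg_of_mul_nonneg_left ((norm_nonneg _).trans (hb t ht)) (by positivity))
  rcases hc with hc | rfl
  · have hsub : Set.Icc 0 t ⊆ Set.Icc 0 L := Set.Icc_subset_Icc_right ht.2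
    have := (convex_Icc 0 t).norm_image_sub_le_of_norm_hasDerivWithin_le
      (fun s hs => (hg s (hsub hs)).mono hsub) (C := c * t ^ n)
      (fun s hs => (hb s (hsub hs)).trans (by have := hs.1; have := hs.2; gcongr))
      (Set.left_mem_Icc.2 ht.1) (Set.right_mem_Icc.2 ht.1)
    rw [h0, sub_zero, sub_zero, Real.norm_of_nonneg ht.1] at this
    rwa [pow_succ, ← mul_assoc]
  · simp [h0]

end LipschitzDerivative

/-! ### The composite midpoint rule -/

section Midpoint

set_option linter.unusedSectionVars false

open intervalIntegral

variable {F G : Type*} [NormedAddCommGroup F] [NormedSpace ℝ F]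
  [NormedAddCommGroup G] [NormedSpace ℝ G]

/-- The error of the midpoint rule on `n` consecutive cells of length `η` starting at `a`. -/
noncomputable def midErr (g : ℝ → F) (η a : ℝ) (n : ℕ) : F :=
  ∑ j ∈ Finset.range n,
    ((∫ s in (a + j * η)..(a + (j + 1) * η), g s) - η • g (a + j * η + η / 2))

theorem midErr_succ (g : ℝ → F) (η a : ℝ) (n : ℕ) :
    midErr g η a (n + 1) = midErr g η a n +
      ((∫ s in (a + n * η)..(a + (n + 1) * η), g s) - η • g (a + n * η + η / 2)) :=
  Finset.sum_range_succ _ _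

theorem midErr_add_nat (g : ℝ → F) (η a : ℝ) (m n : ℕ) :
    midErr g η a (m + n) = midErr g η a m + midErr g η (a + m * η) n := by
  induction n with
  | zero => simp [midErr]
  | succ n ih =>
    rw [← add_assoc, midErr_succ, ih, midErr_succ, add_assoc]
    congr 3 <;> push_cast <;> ring_nf

theorem midErr_shift (g : ℝ → F) (η a : ℝ) (n : ℕ) :
    midErr g η a n = midErr (fun s => g (a + s)) η 0 n := by
  unfold midErr
  refine Finset.sum_congr rfl fun j _ => ?_
  rw [integral_comp_add_left (fun s => g s)]
  simp only [zero_add, add_assoc]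

theorem cell_subset {η a : ℝ} (hη : 0 ≤ η) {n j : ℕ} (hj : j < n) :
    Set.Icc (a + j * η) (a + (j + 1) * η) ⊆ Set.Icc a (a + n * η) := by
  have h : (j : ℝ) + 1 ≤ n := by exact_mod_cast hj
  apply Set.Icc_subset_Icc
  · have : 0 ≤ (j : ℝ) * η := by positivity
    linarith
  · gcongr

theorem intervalIntegrable_cell {g : ℝ → F} {η a : ℝ} (hη : 0 ≤ η) {n : ℕ}
    (hg : ContinuousOn g (Set.Icc a (a + n * η))) {j : ℕ} (hj : j < n) :
    IntervalIntegrable g MeasureTheory.volume (a + j * η) (a + (j + 1) * η) := by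
  apply ContinuousOn.intervalIntegrable
  rw [Set.uIcc_of_le (by nlinarith)]
  exact hg.mono (cell_subset hη hj)

theorem midErr_add {f g : ℝ → F} {η a : ℝ} (hη : 0 ≤ η) {n : ℕ}
    (hf : ContinuousOn f (Set.Icc a (a + n * η))) (hg : ContinuousOn g (Set.Icc a (a + n * η))) :
    midErr (fun t => f t + g t) η a n = midErr f η a n + midErr g η a n := by
  unfold midErr
  rw [← Finset.sum_add_distrib]
  refine Finset.sum_congr rfl fun j hj => ?_
  have hj := Finset.mem_range.1 hj
  rw [integral_add (intervalIntegrable_cell hη hf hj) (intervalIntegrable_cell hη hg hj), smul_add]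
  abel

theorem midErr_clm [CompleteSpace F] [CompleteSpace G] (L : F →L[ℝ] G) {g : ℝ → F} {η a : ℝ}
    (hη : 0 ≤ η) {n : ℕ} (hg : ContinuousOn g (Set.Icc a (a + n * η))) :
    midErr (fun t => L (g t)) η a n = L (midErr g η a n) := by
  unfold midErr
  rw [map_sum]
  refine Finset.sum_congr rfl fun j hj => ?_
  rw [L.intervalIntegral_comp_comm (intervalIntegrable_cell hη hg (Finset.mem_range.1 hj)),
    map_sub, map_smul]

/-- The tangent line at the midpoint is integrated exactly, and with a Lipschitz derivative `g`
deviates from it by at most `c * η ^ 2` on the cell. No second derivative is needed. -/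
theorem norm_midErr_le [CompleteSpace F] {g : ℝ → F} {η a c : ℝ} (hη : 0 ≤ η) {n : ℕ}
    (hg : C11On g (Set.Icc a (a + n * η)) c) : ‖midErr g η a n‖ ≤ n * (c * η ^ 3) := by
  have hcont := hg.continuousOn
  obtain ⟨g', h0, h1, h2, h3⟩ := hg
  have key : ∀ j ∈ Finset.range n,
      ‖(∫ s in (a + j * η)..(a + (j + 1) * η), g s) - η • g (a + j * η + η / 2)‖ ≤
        c * η ^ 3 := by
    intro j hj
    have hj := Finset.mem_range.1 hj
    have hsub := cell_subset (a := a) hη hj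
    set m := a + j * η + η / 2 with hm
    have hmc : m ∈ Set.Icc (a + j * η) (a + (j + 1) * η) := ⟨by linarith, by linarith⟩
    have hc : 0 ≤ c := (norm_nonneg _).trans (h1 m (hsub hmc))
    have hle : a + j * η ≤ a + (j + 1) * η := by nlinarith
    have hlin : (∫ s in (a + j * η)..(a + (j + 1) * η), (g m + (s - m) • g' m)) = η • g m := by
      rw [integral_add (by simp) (by apply Continuous.intervalIntegrable; fun_prop),
        intervalIntegral.integral_smul_const, integral_sub (by simp) (by simp)]
      simp only [integral_const, integral_id, smul_eq_mul]
      have e1 : (a + (j + 1) * η - (a + j * η)) = η := by ring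
      have e2 : ((a + (j + 1) * η) ^ 2 - (a + j * η) ^ 2) / 2 -
          (a + (j + 1) * η - (a + j * η)) * m = 0 := by rw [hm]; ring
      rw [e1] at *
      rw [e2, zero_smul, add_zero]
    rw [← hlin, ← integral_sub (intervalIntegrable_cell hη hcont hj)
      (by apply Continuous.intervalIntegrable; fun_prop)]
    have hbd : ∀ s ∈ Set.uIoc (a + j * η) (a + (j + 1) * η),
        ‖g s - (g m + (s - m) • g' m)‖ ≤ c * η ^ 2 := by
      intro s hs
      rw [Set.uIoc_of_le hle] at hs
      have hs' : s ∈ Set.Icc (a + j * η) (a + (j + 1) * η) := ⟨hs.1.le, hs.2⟩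
      have hd : ∀ r ∈ Set.Icc (a + j * η) (a + (j + 1) * η), HasDerivWithinAt
          (fun r => g r - (r - m) • g' m) (g' r - g' m)
          (Set.Icc (a + j * η) (a + (j + 1) * η)) r := by
        intro r hr
        have := ((h0 r (hsub hr)).mono hsub).sub
          ((((hasDerivWithinAt_id r _).sub_const m).smul_const (g' m)))
        exact this.congr_deriv (by simp)
      have hd' : ∀ r ∈ Set.Icc (a + j * η) (a + (j + 1) * η), ‖g' r - g' m‖ ≤ c * η := by
        intro r hr
        refine (h3 r (hsub hr) m (hsub hmc)).trans ?_
        gcongr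
        rw [abs_le]
        exact ⟨by linarith [hr.1, hmc.2], by linarith [hr.2, hmc.1]⟩
      have := (convex_Icc _ _).norm_image_sub_le_of_norm_hasDerivWithin_le hd hd' hmc hs'
      have e : g s - (s - m) • g' m - (g m - (m - m) • g' m) = g s - (g m + (s - m) • g' m) := by
        rw [sub_self, zero_smul]; abel
      rw [e] at this
      refine this.trans ?_
      rw [pow_two, ← mul_assoc]
      gcongr
      rw [Real.norm_eq_abs, abs_le]
      exact ⟨by linarith [hs'.1, hmc.2], by linarith [hs'.2, hmc.1]⟩
    refine (norm_integral_le_of_norm_le_const hbd).trans ?_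
    have e1 : (a + (j + 1) * η - (a + j * η)) = η := by ring
    rw [e1, abs_of_nonneg hη]
    apply le_of_eq; ring
  refine (norm_sum_le_of_le _ key).trans ?_
  simp

/-- Summation of midpoint errors over blocks of `N` cells, plus an incomplete block. -/
theorem norm_midErr_le_of_blocks {g : ℝ → F} {η c d : ℝ} {N n : ℕ} (hN : 0 < N)
    (hc : 0 ≤ c) (hblock : ∀ p : ℕ, (p + 1) * N ≤ n → ‖midErr g η (p * (N * η)) N‖ ≤ c)
    (hrest : ∀ p r : ℕ, r < N → p * N + r ≤ n → ‖midErr g η (p * (N * η)) r‖ ≤ d) :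
    ‖midErr g η 0 n‖ ≤ n / N * c + d := by
  -- Complete blocks are summed first; the last `n % N` cells form the incomplete block.
  have h1 : ∀ p : ℕ, p * N ≤ n → ‖midErr g η 0 (p * N)‖ ≤ p * c := by
    intro p
    induction p with
    | zero => intro _; simp [midErr]
    | succ p ih =>
      intro hp
      rw [add_mul, one_mul] at hp ⊢
      rw [midErr_add_nat]
      have e : (0 : ℝ) + ((p * N : ℕ) : ℝ) * η = p * (N * η) := by push_cast; ring
      rw [e]
      refine (norm_add_le_of_le (ih (by omega)) (hblock p (by rw [add_mul, one_mul]; exact hp))).trans ?_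
      push_cast
      apply le_of_eq; ring
  have hdm := Nat.div_add_mod n N
  have hr := Nat.mod_lt n hN
  have e : (0 : ℝ) + ((n / N * N : ℕ) : ℝ) * η = (n / N : ℕ) * (N * η) := by push_cast; ring
  have hle : n / N * N ≤ n := Nat.div_mul_le_self n N
  have hsplit : midErr g η 0 n = midErr g η 0 (n / N * N) +
      midErr g η ((n / N : ℕ) * (N * η)) (n % N) := by
    rw [← e, ← midErr_add_nat, mul_comm, hdm]
  rw [hsplit]
  refine norm_add_le_of_le ((h1 _ hle).trans ?_) (hrest _ _ hr (by rw [mul_comm]; exact hdm.le))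
  have h2 : ((n / N : ℕ) : ℝ) ≤ (n : ℝ) / N := Nat.cast_div_le
  gcongr

end Midpoint

/-! ### Exactness of the midpoint rule on trigonometric polynomials -/

section Trigonometric

set_option linter.unusedSectionVars false

open intervalIntegral

variable {F G : Type*} [NormedAddCommGroup F] [NormedSpace ℝ F] [CompleteSpace F]
  [NormedAddCommGroup G] [NormedSpace ℝ G] [CompleteSpace G]

/-- The midpoint rule with `N` cells of length `η` starting at `0` is exact for `g`. -/
def MidExact (g : ℝ → F) (η : ℝ) (N : ℕ) : Prop :=
  Continuous g ∧ midErr g η 0 N = 0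

theorem MidExact.add {f g : ℝ → F} {η : ℝ} {N : ℕ} (hη : 0 ≤ η) (hf : MidExact f η N)
    (hg : MidExact g η N) : MidExact (fun t => f t + g t) η N :=
  ⟨hf.1.add hg.1, by
    rw [midErr_add hη hf.1.continuousOn hg.1.continuousOn, hf.2, hg.2, add_zero]⟩

theorem MidExact.clm (L : F →L[ℝ] G) {f : ℝ → F} {η : ℝ} {N : ℕ} (hη : 0 ≤ η)
    (hf : MidExact f η N) : MidExact (fun t => L (f t)) η N :=
  ⟨L.continuous.comp hf.1, by rw [midErr_clm L hη hf.1.continuousOn, hf.2, map_zero]⟩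

theorem MidExact.smul {f : ℝ → ℝ} {η : ℝ} {N : ℕ} (hη : 0 ≤ η)
    (hf : MidExact f η N) (v : F) : MidExact (fun t => f t • v) η N := by
  simpa using hf.clm (ContinuousLinearMap.toSpanSingleton ℝ v) hη

theorem MidExact.congr {f g : ℝ → F} {η : ℝ} {N : ℕ} (hf : MidExact f η N)
    (h : ∀ t, g t = f t) : MidExact g η N := by
  rwa [funext h]

theorem midExact_one (η : ℝ) (N : ℕ) : MidExact (fun _ => (1 : ℝ)) η N := by
  refine ⟨continuous_const, Finset.sum_eq_zero fun j _ => ?_⟩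
  rw [integral_const]
  simp only [smul_eq_mul]; ring

theorem midExact_id (η : ℝ) (N : ℕ) : MidExact (fun t : ℝ => t) η N := by
  refine ⟨continuous_id, Finset.sum_eq_zero fun j _ => ?_⟩
  rw [integral_id]
  simp only [smul_eq_mul]; ring

/-- On each cell both the integral and the midpoint value are multiples of the increment of `sin (ν
s)`, with factors that do not depend on the cell. The errors therefore telescope, and over whole
periods the telescoped sum is zero. -/
theorem midExact_cos {ν η : ℝ} {N : ℕ} (hν : ν ≠ 0) (hs : Real.sin (ν * η / 2) ≠ 0)
    {k : ℕ} (hper : ν * (N * η) = k * (2 * Real.pi)) :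
    MidExact (fun t : ℝ => Real.cos (ν * t)) η N := by
  refine ⟨by fun_prop, ?_⟩
  have hcell : ∀ j ∈ Finset.range N,
      (∫ s in (0 + j * η)..(0 + (j + 1) * η), Real.cos (ν * s)) -
        η • Real.cos (ν * (0 + j * η + η / 2)) =
      (ν⁻¹ - η / (2 * Real.sin (ν * η / 2))) *
        (Real.sin (ν * ((j + 1 : ℕ) * η)) - Real.sin (ν * (j * η))) := by
    intro j _
    rw [integral_comp_mul_left (fun s => Real.cos s) hν, integral_cos]
    have e1 : (ν * ((j + 1 : ℕ) * η) - ν * (j * η)) / 2 = ν * η / 2 := by push_cast; ring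
    have e2 : (ν * ((j + 1 : ℕ) * η) + ν * (j * η)) / 2 = ν * (0 + j * η + η / 2) := by
      push_cast; ring
    have e3 : Real.sin (ν * (0 + (j + 1) * η)) - Real.sin (ν * (0 + j * η)) =
        Real.sin (ν * ((j + 1 : ℕ) * η)) - Real.sin (ν * (j * η)) := by
      push_cast; simp only [zero_add]
    rw [e3, Real.sin_sub_sin, e1, e2]
    simp only [smul_eq_mul]
    field_simp
  unfold midErr
  rw [Finset.sum_congr rfl hcell, ← Finset.mul_sum,
    Finset.sum_range_sub (fun j : ℕ => Real.sin (ν * (j * η)))]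
  have : Real.sin (ν * (N * η)) = 0 := by
    rw [hper, ← Real.sin_nat_mul_pi (2 * k)]; push_cast; ring_nf
  simp [this]

theorem midExact_sin {ν η : ℝ} {N : ℕ} (hν : ν ≠ 0) (hs : Real.sin (ν * η / 2) ≠ 0)
    {k : ℕ} (hper : ν * (N * η) = k * (2 * Real.pi)) :
    MidExact (fun t : ℝ => Real.sin (ν * t)) η N := by
  refine ⟨by fun_prop, ?_⟩
  have hcell : ∀ j ∈ Finset.range N,
      (∫ s in (0 + j * η)..(0 + (j + 1) * η), Real.sin (ν * s)) -
        η • Real.sin (ν * (0 + j * η + η / 2)) =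
      (-ν⁻¹ + η / (2 * Real.sin (ν * η / 2))) *
        (Real.cos (ν * ((j + 1 : ℕ) * η)) - Real.cos (ν * (j * η))) := by
    intro j _
    rw [integral_comp_mul_left (fun s => Real.sin s) hν, integral_sin]
    have e1 : (ν * ((j + 1 : ℕ) * η) - ν * (j * η)) / 2 = ν * η / 2 := by push_cast; ring
    have e2 : (ν * ((j + 1 : ℕ) * η) + ν * (j * η)) / 2 = ν * (0 + j * η + η / 2) := by
      push_cast; ring
    have e3 : Real.cos (ν * (0 + j * η)) - Real.cos (ν * (0 + (j + 1) * η)) =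
        -(Real.cos (ν * ((j + 1 : ℕ) * η)) - Real.cos (ν * (j * η))) := by
      push_cast; simp only [zero_add]; ring
    rw [e3, Real.cos_sub_cos, e1, e2]
    simp only [smul_eq_mul]
    field_simp
    ring
  unfold midErr
  rw [Finset.sum_congr rfl hcell, ← Finset.mul_sum,
    Finset.sum_range_sub (fun j : ℕ => Real.cos (ν * (j * η)))]
  have : Real.cos (ν * (N * η)) = 1 := by
    rw [hper, Real.cos_nat_mul_two_pi]
  simp [this]

end Trigonometric

/-! ### Rotation groups: Rodrigues' formula and exact quadrature along them -/

section Rotation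

set_option linter.unusedSectionVars false

variable {V : Type*} [NormedAddCommGroup V] [InnerProductSpace ℝ V] [CompleteSpace V]
  [Nontrivial V]

/-- Rodrigues' formula. -/
theorem exp_smul_eq_of_cube {A : V →L[ℝ] V} {ω : ℝ} (hω : ω ≠ 0)
    (hA : A * (A * A) = -(ω ^ 2) • A) (t : ℝ) :
    NormedSpace.exp (t • A) =
      1 + (Real.sin (ω * t) / ω) • A + ((1 - Real.cos (ω * t)) / ω ^ 2) • (A * A) := by
  set U : ℝ → (V →L[ℝ] V) := fun t =>
    1 + (Real.sin (ω * t) / ω) • A + ((1 - Real.cos (ω * t)) / ω ^ 2) • (A * A) with hU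
  have hUd : ∀ s, HasDerivAt U (A * U s) s := by
    intro s
    have hl : HasDerivAt (fun s : ℝ => ω * s) ω s := by
      simpa using (hasDerivAt_id s).const_mul ω
    have h1 := ((hl.sin.div_const ω).smul_const A)
    have h2 := (((hl.cos.const_sub 1).div_const (ω ^ 2)).smul_const (A * A))
    refine ((h1.const_add 1).add h2).congr_deriv ?_
    simp only [hU, mul_add, mul_one, mul_smul_comm, hA]
    match_scalars <;> field_simp
    ring
  -- Uniqueness for `U' = A U`: the product `e^{-sA} U(s)` is constant.
  have hd : ∀ s : ℝ, HasDerivAt (fun s : ℝ => NormedSpace.exp ((-s) • A) * U s) 0 s := by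
    intro s
    have h1 := (hasDerivAt_exp_smul A (-s)).scomp s (hasDerivAt_neg s)
    refine (h1.mul (hUd s)).congr_deriv ?_
    simp only [Function.comp_apply, neg_smul, one_smul]
    rw [← neg_smul, commute_exp_smul, neg_mul, mul_assoc, neg_add_cancel]
  have hc := is_const_of_deriv_eq_zero (fun s => (hd s).differentiableAt)
    (fun s => (hd s).deriv) t 0
  have h0 : NormedSpace.exp ((-t) • A) * U t = 1 := by
    rw [hc]; simp [hU]
  calc NormedSpace.exp (t • A) = NormedSpace.exp (t • A) * (NormedSpace.exp ((-t) • A) * U t) := by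
        rw [h0, mul_one]
    _ = U t := by rw [← mul_assoc, exp_mul_exp_neg, one_mul]

/-- The integral `∫₀ᵗ e^{sA} ds` of a rotation group. -/
noncomputable def rotInt (A : V →L[ℝ] V) (ω t : ℝ) : V →L[ℝ] V :=
  t • 1 + ((1 - Real.cos (ω * t)) / ω ^ 2) • A + ((t - Real.sin (ω * t) / ω) / ω ^ 2) • (A * A)

theorem rotInt_zero (A : V →L[ℝ] V) (ω : ℝ) : rotInt A ω 0 = 0 := by
  simp [rotInt]

theorem hasDerivAt_rotInt {A : V →L[ℝ] V} {ω : ℝ} (hω : ω ≠ 0)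
    (hA : A * (A * A) = -(ω ^ 2) • A) (t : ℝ) :
    HasDerivAt (rotInt A ω) (NormedSpace.exp (t • A)) t := by
  have hl : HasDerivAt (fun s : ℝ => ω * s) ω t := by
    simpa using (hasDerivAt_id t).const_mul ω
  have h0 := (hasDerivAt_id t).smul_const (1 : V →L[ℝ] V)
  have h1 := (((hl.cos.const_sub 1).div_const (ω ^ 2)).smul_const A)
  have h2 := ((((hasDerivAt_id t).sub (hl.sin.div_const ω)).div_const (ω ^ 2)).smul_const (A * A))
  refine ((h0.add h1).add h2).congr_deriv ?_
  rw [exp_smul_eq_of_cube hω hA]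
  match_scalars <;> field_simp

variable {A : V →L[ℝ] V} {ω η : ℝ} {N : ℕ}

/-- The two angles are `π / N` and `2π / N`. The second lies strictly below `π` only from `N = 3`
on; with two cells the double frequency would be aliased. -/
theorem sin_angle_ne_zero (hN : 3 ≤ N) (hη : ω * (N * η) = 2 * Real.pi) :
    Real.sin (ω * η / 2) ≠ 0 ∧ Real.sin (2 * ω * η / 2) ≠ 0 := by
  have hN' : (3 : ℝ) ≤ N := by exact_mod_cast hN
  have hN0 : (0 : ℝ) < N := by linarith
  have e : ω * η = 2 * Real.pi / N := by
    field_simp; linarith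
  have hpi := Real.pi_pos
  constructor <;> apply ne_of_gt <;> apply Real.sin_pos_of_pos_of_lt_pi
  · rw [e]; positivity
  · rw [e, div_div, div_lt_iff₀ (by positivity)]; nlinarith
  · rw [mul_assoc, e]; positivity
  · rw [mul_assoc, e, mul_div_cancel_left₀ _ two_ne_zero, div_lt_iff₀ hN0]; nlinarith

theorem midExact_trig (hω : ω ≠ 0) (hN : 3 ≤ N) (hη : ω * (N * η) = 2 * Real.pi) :
    MidExact (fun t => Real.cos (ω * t)) η N ∧ MidExact (fun t => Real.sin (ω * t)) η N ∧
      MidExact (fun t => Real.cos (2 * ω * t)) η N ∧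
      MidExact (fun t => Real.sin (2 * ω * t)) η N := by
  obtain ⟨h1, h2⟩ := sin_angle_ne_zero hN hη
  have hω2 : 2 * ω ≠ 0 := mul_ne_zero two_ne_zero hω
  have p1 : ω * (N * η) = (1 : ℕ) * (2 * Real.pi) := by rw [hη]; simp
  have p2 : 2 * ω * (N * η) = (2 : ℕ) * (2 * Real.pi) := by rw [mul_assoc, hη]; simp
  exact ⟨midExact_cos hω h1 p1, midExact_sin hω h1 p1, midExact_cos hω2 h2 p2,
    midExact_sin hω2 h2 p2⟩

/-- By Rodrigues' formula the orbit is a constant plus first harmonics. -/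
theorem midExact_exp (hω : ω ≠ 0) (hA : A * (A * A) = -(ω ^ 2) • A) (hη0 : 0 ≤ η) (hN : 3 ≤ N)
    (hη : ω * (N * η) = 2 * Real.pi) (v : V) :
    MidExact (fun t => NormedSpace.exp (t • A) v) η N := by
  obtain ⟨hc, hs, -, -⟩ := midExact_trig hω hN hη
  refine (((midExact_one η N).smul hη0 (v + (ω ^ 2)⁻¹ • A (A v))).add hη0
    ((hs.smul hη0 (ω⁻¹ • A v)).add hη0 (hc.smul hη0 (-(ω ^ 2)⁻¹ • A (A v))))).congr fun t => ?_
  rw [exp_smul_eq_of_cube hω hA]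
  simp only [add_apply, smul_apply, one_apply_eq_self,
    show ∀ w, (A * A) w = A (A w) from fun _ => rfl]
  match_scalars <;> field_simp
  ring

/-- The closed form of the integral consists of first harmonics and a drift linear in `t`, which the
midpoint rule also integrates exactly. -/
theorem midExact_rotInt (hω : ω ≠ 0) (hη0 : 0 ≤ η) (hN : 3 ≤ N)
    (hη : ω * (N * η) = 2 * Real.pi) (v : V) :
    MidExact (fun t => rotInt A ω t v) η N := by
  obtain ⟨hc, hs, -, -⟩ := midExact_trig hω hN hη
  refine ((((midExact_one η N).smul hη0 ((ω ^ 2)⁻¹ • A v)).add hη0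
    ((midExact_id η N).smul hη0 (v + (ω ^ 2)⁻¹ • A (A v)))).add hη0
    ((hs.smul hη0 (-(ω ^ 3)⁻¹ • A (A v))).add hη0
      (hc.smul hη0 (-(ω ^ 2)⁻¹ • A v)))).congr fun t => ?_
  simp only [rotInt, add_apply, smul_apply,
    one_apply_eq_self, show ∀ w, (A * A) w = A (A w) from fun _ => rfl]
  match_scalars <;> field_simp
  all_goals ring

/-- Two rotations with an arbitrary operator between them produce products of first harmonics, hence
frequencies up to `2ω`. This is the only place where the double frequency occurs. -/
theorem midExact_conj (hω : ω ≠ 0) (hA : A * (A * A) = -(ω ^ 2) • A) (hη0 : 0 ≤ η) (hN : 3 ≤ N)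
    (hη : ω * (N * η) = 2 * Real.pi) (M : V →L[ℝ] V) (v : V) :
    MidExact (fun t => NormedSpace.exp ((-t) • A) (M (NormedSpace.exp (t • A) v))) η N := by
  obtain ⟨hc, hs, hc2, hs2⟩ := midExact_trig hω hN hη
  have h1 := midExact_one η N
  have hcc : MidExact (fun t => Real.cos (ω * t) * Real.cos (ω * t)) η N := by
    refine ((h1.smul hη0 (2⁻¹ : ℝ)).add hη0 (hc2.smul hη0 (2⁻¹ : ℝ))).congr fun t => ?_
    have := Real.cos_sq (ω * t)
    rw [← mul_assoc] at this
    simp only [smul_eq_mul]; nlinarith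
  have hss : MidExact (fun t => Real.sin (ω * t) * Real.sin (ω * t)) η N := by
    refine ((h1.smul hη0 (2⁻¹ : ℝ)).add hη0 (hc2.smul hη0 (-2⁻¹ : ℝ))).congr fun t => ?_
    have := Real.sin_sq_eq_half_sub (ω * t)
    rw [← mul_assoc] at this
    simp only [smul_eq_mul]; nlinarith
  have hcs : MidExact (fun t => Real.cos (ω * t) * Real.sin (ω * t)) η N := by
    refine (hs2.smul hη0 (2⁻¹ : ℝ)).congr fun t => ?_
    have := Real.sin_two_mul (ω * t)
    rw [← mul_assoc] at this
    simp only [smul_eq_mul]; nlinarith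
  set Q : V →L[ℝ] V := (ω ^ 2)⁻¹ • (A * A) with hQ
  set J : V →L[ℝ] V := ω⁻¹ • A with hJ
  -- Rodrigues' formula sorted by harmonics: `1 + Q` carries the mean, `J` the sine and `-Q` the
  -- cosine.
  have hexp : ∀ t : ℝ, NormedSpace.exp (t • A) =
      (1 + Q) + Real.sin (ω * t) • J + Real.cos (ω * t) • (-Q) := by
    intro t
    rw [exp_smul_eq_of_cube hω hA, hQ, hJ]
    match_scalars <;> field_simp
    ring
  set P : V →L[ℝ] V := 1 + Q
  refine ((((h1.smul hη0 (P (M (P v)))).add hη0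
    (hs.smul hη0 (P (M (J v)) - J (M (P v))))).add hη0
    (hc.smul hη0 (P (M (-Q v)) + (-Q) (M (P v))))).add hη0
    ((hss.smul hη0 (-J (M (J v)))).add hη0 ((hcs.smul hη0
      (-J (M (-Q v)) + (-Q) (M (J v)))).add hη0 (hcc.smul hη0 ((-Q) (M (-Q v))))))).congr
    fun t => ?_
  rw [hexp, hexp]
  simp only [mul_neg, Real.sin_neg, Real.cos_neg, add_apply,
    smul_apply, neg_apply, map_add, map_smul, map_neg,
    smul_add, smul_neg, neg_smul, smul_smul, smul_sub, one_smul]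
  module

end Rotation

/-! ### Orbits in fast time -/

section FastOrbits

set_option linter.unusedSectionVars false

variable {V : Type*} [NormedAddCommGroup V] [InnerProductSpace ℝ V] [CompleteSpace V]
  [Nontrivial V]

/-- On the ball of radius `ρ`, the constant `c` bounds `f`, its derivative `f'` and the Lipschitz
constant of `f'`. -/
def C11Ball {G : Type*} [NormedAddCommGroup G] [NormedSpace ℝ G] (f : V → G) (f' : V → V →L[ℝ] G)
    (ρ c : ℝ) : Prop :=
  ∀ y ∈ Metric.closedBall (0 : V) ρ, HasFDerivAt f (f' y) y ∧ ‖f y‖ ≤ c ∧ ‖f' y‖ ≤ c ∧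
    ∀ z ∈ Metric.closedBall (0 : V) ρ, ‖f' y - f' z‖ ≤ c * ‖y - z‖

theorem C11Ball.lipschitz {G : Type*} [NormedAddCommGroup G] [NormedSpace ℝ G] {f : V → G}
    {f' : V → V →L[ℝ] G} {ρ c : ℝ} (hf : C11Ball f f' ρ c) {y z : V} (hy : ‖y‖ ≤ ρ)
    (hz : ‖z‖ ≤ ρ) : ‖f y - f z‖ ≤ c * ‖y - z‖ :=
  (convex_closedBall (0 : V) ρ).norm_image_sub_le_of_norm_hasFDerivWithin_le
    (fun w hw => (hf w hw).1.hasFDerivWithinAt) (fun w hw => (hf w hw).2.2.1)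
    (mem_closedBall_zero_iff.2 hz) (mem_closedBall_zero_iff.2 hy)

/-- A solution, on `[0, L]`, of the system `x' = ε u`, `u' = A u + D(x) u + ε E(x)`, with
uniform bounds on all the data. The operator `A` is skew and `κ`-close to `A₀`, and `D` is of
size `κ`. -/
structure FastOrbit (A₀ : V →L[ℝ] V) (ρ K : ℝ) where
  /-- the small parameter -/
  ε : ℝ
  /-- the size of the perturbation of the rotation -/
  κ : ℝ
  /-- the length of the time interval -/
  L : ℝ
  /-- the fast rotation -/
  A : V →L[ℝ] V
  /-- the force -/
  E : V → V
  /-- the derivative of the force -/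
  E' : V → V →L[ℝ] V
  /-- the space-dependent part of the rotation -/
  D : V → V →L[ℝ] V
  /-- the derivative of the space-dependent part of the rotation -/
  D' : V → V →L[ℝ] V →L[ℝ] V
  /-- the position -/
  x : ℝ → V
  /-- the velocity -/
  u : ℝ → V
  one_le : 1 ≤ K
  ε_pos : 0 < ε
  ε_le : ε ≤ 1
  κ_nonneg : 0 ≤ κ
  κ_le : κ ≤ ε
  εL_le : ε * L ≤ K
  skew : ∀ v, inner ℝ (A v) v = 0
  norm_A : ‖A‖ ≤ K
  norm_A₀ : ‖A₀‖ ≤ K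
  norm_A_sub : ‖A - A₀‖ ≤ K * κ
  hE : C11Ball E E' ρ K
  hD : C11Ball D D' ρ (K * κ)
  norm_x : ∀ t ∈ Set.Icc 0 L, ‖x t‖ ≤ ρ
  norm_u : ∀ t ∈ Set.Icc 0 L, ‖u t‖ ≤ K
  deriv_x : ∀ t ∈ Set.Icc 0 L, HasDerivWithinAt x (ε • u t) (Set.Icc 0 L) t
  deriv_u : ∀ t ∈ Set.Icc 0 L,
    HasDerivWithinAt u (A (u t) + (D (x t) (u t) + ε • E (x t))) (Set.Icc 0 L) t

namespace FastOrbit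

variable {A₀ : V →L[ℝ] V} {ρ K : ℝ} (S : FastOrbit A₀ ρ K)

/-- The slowly varying part of the force along the orbit. -/
noncomputable def F (t : ℝ) : V := S.D (S.x t) (S.u t) + S.ε • S.E (S.x t)

/-- The small quantity `ε² + κ`. -/
noncomputable def δ : ℝ := S.ε ^ 2 + S.κ

/-- The restriction of an orbit to the time window `[τ, τ + ℓ]`, moved to `[0, ℓ]`. -/
noncomputable def window (τ ℓ : ℝ) (hτ : 0 ≤ τ) (hℓ : τ + ℓ ≤ S.L) : FastOrbit A₀ ρ K :=
  { S with
    L := ℓ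
    x := fun t => S.x (τ + t)
    u := fun t => S.u (τ + t)
    εL_le := (mul_le_mul_of_nonneg_left (by linarith) S.ε_pos.le).trans S.εL_le
    norm_x := fun t ht => S.norm_x _ ⟨by linarith [ht.1], by linarith [ht.2]⟩
    norm_u := fun t ht => S.norm_u _ ⟨by linarith [ht.1], by linarith [ht.2]⟩
    deriv_x := fun t ht => by
      have h := S.deriv_x (τ + t) ⟨by linarith [ht.1], by linarith [ht.2]⟩
      have h2 : HasDerivWithinAt (fun s : ℝ => τ + s) 1 (Set.Icc 0 ℓ) t :=
        (hasDerivWithinAt_id t _).const_add τ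
      exact (h.scomp t h2 (fun s hs => ⟨by linarith [hs.1], by linarith [hs.2]⟩)).congr_deriv
        (one_smul _ _)
    deriv_u := fun t ht => by
      have h := S.deriv_u (τ + t) ⟨by linarith [ht.1], by linarith [ht.2]⟩
      have h2 : HasDerivWithinAt (fun s : ℝ => τ + s) 1 (Set.Icc 0 ℓ) t :=
        (hasDerivWithinAt_id t _).const_add τ
      exact (h.scomp t h2 (fun s hs => ⟨by linarith [hs.1], by linarith [hs.2]⟩)).congr_deriv
        (one_smul _ _) }

theorem K_pos (S : FastOrbit A₀ ρ K) : 0 < K := one_pos.trans_le S.one_le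

theorem δ_nonneg : 0 ≤ S.δ := add_nonneg (sq_nonneg _) S.κ_nonneg

theorem sq_le_ε : S.ε ^ 2 ≤ S.ε := by nlinarith [S.ε_pos, S.ε_le]

theorem δ_le : S.δ ≤ 2 * S.ε := by
  have := S.κ_le; have := S.sq_le_ε; unfold δ; linarith

theorem κ_le_δ : S.κ ≤ S.δ := by unfold δ; nlinarith [S.ε_pos]

theorem sq_le_δ : S.ε ^ 2 ≤ S.δ := by have := S.κ_nonneg; unfold δ; linarith

theorem norm_D {y : V} (hy : ‖y‖ ≤ ρ) : ‖S.D y‖ ≤ K * S.κ :=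
  (S.hD y (mem_closedBall_zero_iff.2 hy)).2.1

theorem norm_E {y : V} (hy : ‖y‖ ≤ ρ) : ‖S.E y‖ ≤ K :=
  (S.hE y (mem_closedBall_zero_iff.2 hy)).2.1

theorem norm_F {t : ℝ} (ht : t ∈ Set.Icc 0 S.L) : ‖S.F t‖ ≤ 2 * K ^ 2 * S.ε := by
  have h1 := (S.D (S.x t)).le_of_opNorm_le_of_le (S.norm_D (S.norm_x t ht)) (S.norm_u t ht)
  have h2 : ‖S.ε • S.E (S.x t)‖ ≤ S.ε * K := by
    rw [norm_smul, Real.norm_of_nonneg S.ε_pos.le]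
    exact mul_le_mul_of_nonneg_left (S.norm_E (S.norm_x t ht)) S.ε_pos.le
  refine (norm_add_le_of_le h1 h2).trans ?_
  have hK := S.one_le
  have h3 : K * S.κ * K ≤ K * S.ε * K := by have := S.κ_le; gcongr
  have h4 : S.ε * K * 1 ≤ S.ε * K * K := by have := S.ε_pos; gcongr
  nlinarith

theorem lip_x {t r : ℝ} (ht : t ∈ Set.Icc 0 S.L) (hr : r ∈ Set.Icc 0 S.L) :
    ‖S.x t - S.x r‖ ≤ K * S.ε * |t - r| := by
  refine (convex_Icc 0 S.L).norm_image_sub_le_of_norm_hasDerivWithin_le S.deriv_x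
    (fun s hs => ?_) hr ht
  rw [norm_smul, Real.norm_of_nonneg S.ε_pos.le, mul_comm]
  exact mul_le_mul_of_nonneg_right (S.norm_u s hs) S.ε_pos.le

theorem lip_u {t r : ℝ} (ht : t ∈ Set.Icc 0 S.L) (hr : r ∈ Set.Icc 0 S.L) :
    ‖S.u t - S.u r‖ ≤ 3 * K ^ 2 * |t - r| := by
  refine (convex_Icc 0 S.L).norm_image_sub_le_of_norm_hasDerivWithin_le S.deriv_u
    (fun s hs => ?_) hr ht
  have h1 := S.A.le_of_opNorm_le_of_le S.norm_A (S.norm_u s hs)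
  refine (norm_add_le_of_le h1 (S.norm_F hs)).trans ?_
  have : K ^ 2 * S.ε ≤ K ^ 2 * 1 := by have := S.ε_le; gcongr
  nlinarith

theorem lip_comp {G : Type*} [NormedAddCommGroup G] [NormedSpace ℝ G] {f : V → G}
    {f' : V → V →L[ℝ] G} {c : ℝ} (hf : C11Ball f f' ρ c) {t r : ℝ} (ht : t ∈ Set.Icc 0 S.L)
    (hr : r ∈ Set.Icc 0 S.L) : ‖f (S.x t) - f (S.x r)‖ ≤ c * (K * S.ε * |t - r|) := by
  have hc : 0 ≤ c :=
    (norm_nonneg _).trans (hf _ (mem_closedBall_zero_iff.2 (S.norm_x t ht))).2.1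
  refine (hf.lipschitz (S.norm_x t ht) (S.norm_x r hr)).trans ?_
  gcongr
  exact S.lip_x ht hr

/-- The velocity turns at unit speed, so `D(x) u` varies at rate `κ`. The position moves at speed
`ε`, so `ε E(x)` varies at rate `ε²`. This is the origin of `δ = ε² + κ`. -/
theorem lip_F {t r : ℝ} (ht : t ∈ Set.Icc 0 S.L) (hr : r ∈ Set.Icc 0 S.L) :
    ‖S.F t - S.F r‖ ≤ 4 * K ^ 3 * S.δ * |t - r| := by
  have e : S.F t - S.F r = ((S.D (S.x t) - S.D (S.x r)) (S.u t) +
      S.D (S.x r) (S.u t - S.u r)) + S.ε • (S.E (S.x t) - S.E (S.x r)) := by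
    simp only [F, sub_apply, map_sub, smul_sub]; abel
  rw [e]
  have h1 := (S.D (S.x t) - S.D (S.x r)).le_of_opNorm_le_of_le (S.lip_comp S.hD ht hr)
    (S.norm_u t ht)
  have h2 := (S.D (S.x r)).le_of_opNorm_le_of_le (S.norm_D (S.norm_x r hr)) (S.lip_u ht hr)
  have h3 : ‖S.ε • (S.E (S.x t) - S.E (S.x r))‖ ≤ S.ε * (K * (K * S.ε * |t - r|)) := by
    rw [norm_smul, Real.norm_of_nonneg S.ε_pos.le]
    exact mul_le_mul_of_nonneg_left (S.lip_comp S.hE ht hr) S.ε_pos.le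
  refine (norm_add_le_of_le (norm_add_le_of_le h1 h2) h3).trans ?_
  have hK := S.one_le
  have hκ := S.κ_nonneg
  have a1 : K * S.κ * (K * S.ε * |t - r|) * K ≤ K * S.κ * (K * 1 * |t - r|) * K := by
    have := S.ε_le; gcongr
  have a2 : K ^ 2 * (S.ε ^ 2 * |t - r|) ≤ K ^ 3 * (S.ε ^ 2 * |t - r|) :=
    mul_le_mul_of_nonneg_right (pow_le_pow_right₀ hK (by norm_num)) (by positivity)
  unfold δ
  have a3 : 0 ≤ K ^ 3 * (S.ε ^ 2 * |t - r|) := by positivity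
  nlinarith

/-- Each derivative of a field along the orbit contains the speed `ε` of the position, hence one
factor `ε` beyond the size of the field. -/
theorem c11_comp {G : Type*} [NormedAddCommGroup G] [NormedSpace ℝ G] {f : V → G}
    {f' : V → V →L[ℝ] G} {c : ℝ} (hf : C11Ball f f' ρ c) (hL0 : 0 ≤ S.L) (hL : S.L ≤ K) :
    C11On (fun t => f (S.x t) - f (S.x 0)) (Set.Icc 0 S.L) (4 * c * K ^ 2 * S.ε) := by
  have h0 : (0 : ℝ) ∈ Set.Icc 0 S.L := ⟨le_rfl, hL0⟩
  have hc : 0 ≤ c :=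
    (norm_nonneg _).trans (hf _ (mem_closedBall_zero_iff.2 (S.norm_x 0 h0))).2.1
  have hK := S.one_le
  have hε := S.ε_pos
  have hb : ∀ t ∈ Set.Icc 0 S.L, S.x t ∈ Metric.closedBall 0 ρ :=
    fun t ht => mem_closedBall_zero_iff.2 (S.norm_x t ht)
  have hεu : ∀ t ∈ Set.Icc 0 S.L, ‖S.ε • S.u t‖ ≤ S.ε * K := fun t ht => by
    rw [norm_smul, Real.norm_of_nonneg hε.le]
    exact mul_le_mul_of_nonneg_left (S.norm_u t ht) hε.le
  have hKK : K ≤ K ^ 2 := by nlinarith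
  have hp : 0 ≤ c * K ^ 2 * S.ε := by positivity
  refine ⟨fun t => f' (S.x t) (S.ε • S.u t), fun t ht => ?_, fun t ht => ?_, fun t ht => ?_,
    fun t ht r hr => ?_⟩
  · exact ((hf _ (hb t ht)).1.comp_hasDerivWithinAt t (S.deriv_x t ht)).sub_const _
  · refine (S.lip_comp hf ht h0).trans ?_
    have : |t - 0| ≤ K := by rw [sub_zero, abs_of_nonneg ht.1]; exact ht.2.trans hL
    calc c * (K * S.ε * |t - 0|) ≤ c * (K * S.ε * K) := by gcongr
      _ ≤ _ := by nlinarith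
  · refine ((f' (S.x t)).le_of_opNorm_le_of_le (hf _ (hb t ht)).2.2.1 (hεu t ht)).trans ?_
    calc c * (S.ε * K) ≤ c * (S.ε * K ^ 2) := by gcongr
      _ ≤ _ := by nlinarith
  · have e : f' (S.x t) (S.ε • S.u t) - f' (S.x r) (S.ε • S.u r) =
        (f' (S.x t) - f' (S.x r)) (S.ε • S.u t) + f' (S.x r) (S.ε • (S.u t - S.u r)) := by
      rw [smul_sub, sub_apply, map_sub]; abel
    rw [e]
    have h1 : ‖f' (S.x t) - f' (S.x r)‖ ≤ c * (K * S.ε * |t - r|) :=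
      ((hf _ (hb t ht)).2.2.2 _ (hb r hr)).trans (by gcongr; exact S.lip_x ht hr)
    have h2 : ‖S.ε • (S.u t - S.u r)‖ ≤ S.ε * (3 * K ^ 2 * |t - r|) := by
      rw [norm_smul, Real.norm_of_nonneg hε.le]
      exact mul_le_mul_of_nonneg_left (S.lip_u ht hr) hε.le
    refine (norm_add_le_of_le ((f' (S.x t) - f' (S.x r)).le_of_opNorm_le_of_le h1 (hεu t ht))
      ((f' (S.x r)).le_of_opNorm_le_of_le (hf _ (hb r hr)).2.2.1 h2)).trans ?_
    have : c * (K * S.ε * |t - r|) * (S.ε * K) ≤ c * (K * S.ε * |t - r|) * (1 * K) := by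
      have := S.ε_le; gcongr
    nlinarith

theorem c11_u : C11On S.u (Set.Icc 0 S.L) ((K + 1) ^ 2 * (8 * K ^ 3)) := by
  have hK := S.one_le
  have h1 : K ≤ K ^ 3 := le_self_pow₀ hK (by norm_num)
  have h2 : K ^ 2 ≤ K ^ 3 := pow_le_pow_right₀ hK (by norm_num)
  have hε := S.ε_le
  have hδ := S.δ_le
  refine C11On.of_linear S.A (convex_Icc _ _) S.norm_A S.deriv_u
    (fun t ht => (S.norm_u t ht).trans (by nlinarith)) (fun t ht => (S.norm_F ht).trans ?_)
    (fun t ht r hr => (S.lip_F ht hr).trans ?_)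
  · have : K ^ 2 * S.ε ≤ K ^ 2 * 1 := by gcongr
    nlinarith
  · have : K ^ 3 * S.δ ≤ K ^ 3 * 2 := by gcongr; linarith
    have := mul_le_mul_of_nonneg_right this (abs_nonneg (t - r))
    nlinarith

end FastOrbit

theorem norm_mul_left_le (M : V →L[ℝ] V) : ‖ContinuousLinearMap.mul ℝ (V →L[ℝ] V) M‖ ≤ ‖M‖ :=
  ContinuousLinearMap.opNorm_mul_apply_le ℝ (V →L[ℝ] V) M

theorem hasDerivAt_exp_neg_smul (A : V →L[ℝ] V) (t : ℝ) :
    HasDerivAt (fun s : ℝ => NormedSpace.exp ((-s) • A)) (-(A * NormedSpace.exp ((-t) • A))) t := by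
  simpa [Function.comp_def] using (hasDerivAt_exp_smul A (-t)).scomp t (hasDerivAt_neg t)

theorem c11_exp_neg {A : V →L[ℝ] V} {K : ℝ} (hK : ‖A‖ ≤ K)
    (hA : ∀ v, inner ℝ (A v) v = 0) {s : Set ℝ} (hs : Convex ℝ s) :
    C11On (fun t : ℝ => NormedSpace.exp ((-t) • A)) s ((K + 1) ^ 2 * 1) := by
  refine C11On.of_linear (ContinuousLinearMap.mul ℝ (V →L[ℝ] V) (-A)) (k := fun _ => 0) hs
    ((norm_mul_left_le _).trans (by rwa [norm_neg])) (fun t _ => ?_)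
    (fun t _ => norm_exp_smul_le_one hA _) (by simp) (by simp)
  simpa using (hasDerivAt_exp_neg_smul A t).hasDerivWithinAt

/-- Meant for `A₀`, for which an orbit does not record skewness. The size of the exponential is
therefore controlled by Grönwall on a bounded interval instead of by isometry. -/
theorem c11_exp {A : V →L[ℝ] V} {K L : ℝ} (hK1 : 1 ≤ K) (hK : ‖A‖ ≤ K) (hL : L ≤ K) (v : V) :
    C11On (fun t : ℝ => NormedSpace.exp (t • A) v) (Set.Icc 0 L)
      ((K + 1) ^ 2 * ((1 + K * Real.exp (K * K)) * ‖v‖)) := by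
  have hd : ∀ t : ℝ, HasDerivAt (fun t : ℝ => NormedSpace.exp (t • A) v)
      (A (NormedSpace.exp (t • A) v)) t := fun t =>
    ((hasDerivAt_exp_smul A t).clm_apply (hasDerivAt_const t v)).congr_deriv (by simp)
  have hb : ∀ t ∈ Set.Icc 0 L, ‖NormedSpace.exp (t • A) v - v‖ ≤
      K * ‖v‖ * Real.exp (K * L) := by
    refine norm_le_of_deriv_le_of_zero (g' := fun t => A (NormedSpace.exp (t • A) v)) hK1
      (by positivity) (fun t _ => ((hd t).sub_const v).hasDerivWithinAt) (by simp) fun t _ => ?_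
    rw [← mul_add]
    refine A.le_of_opNorm_le_of_le hK ?_
    simpa using norm_add_le (NormedSpace.exp (t • A) v - v) v
  have hbound : ∀ t ∈ Set.Icc 0 L, ‖NormedSpace.exp (t • A) v‖ ≤
      (1 + K * Real.exp (K * K)) * ‖v‖ := fun t ht => by
    have h1 := norm_add_le (NormedSpace.exp (t • A) v - v) v
    rw [sub_add_cancel] at h1
    have h2 : K * ‖v‖ * Real.exp (K * L) ≤ K * ‖v‖ * Real.exp (K * K) := by gcongr
    have := hb t ht
    nlinarith
  have hp : 0 ≤ (1 + K * Real.exp (K * K)) * ‖v‖ := by positivity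
  refine C11On.of_linear A (k := fun _ => 0) (convex_Icc _ _) hK
    (fun t _ => by simpa using (hd t).hasDerivWithinAt) hbound (by simpa using fun _ _ _ => hp) ?_
  intro t _ r _
  simpa using mul_nonneg hp (abs_nonneg _)

/-- The difference solves `g' = -A₀ g - (A - A₀) e^{-tA}` with zero initial value, and the forcing
is of size `d`. It pays for replacing `A` by `A₀`, whose period is the one resolved by the grid. -/
theorem c11_exp_neg_sub {A A₀ : V →L[ℝ] V} {K L d : ℝ} (hK1 : 1 ≤ K) (hK : ‖A‖ ≤ K)
    (hK₀ : ‖A₀‖ ≤ K) (hd : ‖A - A₀‖ ≤ d) (hA : ∀ v, inner ℝ (A v) v = 0) (hL : L ≤ K) :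
    C11On (fun t : ℝ => NormedSpace.exp ((-t) • A) - NormedSpace.exp ((-t) • A₀)) (Set.Icc 0 L)
      ((K + 1) ^ 2 * (d * (Real.exp (K * K) + (K + 1) ^ 2))) := by
  have hd0 : 0 ≤ d := (norm_nonneg _).trans hd
  have hder : ∀ t : ℝ, HasDerivAt
      (fun t : ℝ => NormedSpace.exp ((-t) • A) - NormedSpace.exp ((-t) • A₀))
      (ContinuousLinearMap.mul ℝ (V →L[ℝ] V) (-A₀)
        (NormedSpace.exp ((-t) • A) - NormedSpace.exp ((-t) • A₀)) +
        (-((A - A₀) * NormedSpace.exp ((-t) • A)))) t := fun t => by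
    refine ((hasDerivAt_exp_neg_smul A t).sub (hasDerivAt_exp_neg_smul A₀ t)).congr_deriv ?_
    simp only [ContinuousLinearMap.mul_apply']
    noncomm_ring
  have hM : ‖ContinuousLinearMap.mul ℝ (V →L[ℝ] V) (-A₀)‖ ≤ K :=
    (norm_mul_left_le _).trans (by rwa [norm_neg])
  have hexp := c11_exp_neg hK hA (convex_Icc 0 L)
  have hk : ∀ t : ℝ, ‖-((A - A₀) * NormedSpace.exp ((-t) • A))‖ ≤ d := fun t => by
    rw [norm_neg]
    refine (norm_mul_le_of_le hd (norm_exp_smul_le_one hA (-t))).trans (by rw [mul_one])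
  have hexpL : Real.exp (K * L) ≤ Real.exp (K * K) := by gcongr
  have hKp : 0 ≤ (K + 1) ^ 2 := by positivity
  have h1 : 1 ≤ Real.exp (K * K) := Real.one_le_exp (by positivity)
  refine C11On.of_linear _ (convex_Icc _ _) hM (fun t _ => (hder t).hasDerivWithinAt)
    (fun t ht => (norm_le_of_deriv_le_of_zero hK1 hd0 (fun t _ => (hder t).hasDerivWithinAt)
      (by simp) (fun t _ => ?_) t ht).trans (mul_le_mul_of_nonneg_left (by linarith) hd0))
    (fun t _ => (hk t).trans ?_) (fun t ht r hr => ?_)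
  · exact norm_add_le_of_le ((ContinuousLinearMap.mul ℝ (V →L[ℝ] V) (-A₀)).le_of_opNorm_le hM _)
      (hk t)
  · nlinarith
  · have e : -((A - A₀) * NormedSpace.exp ((-t) • A)) - -((A - A₀) * NormedSpace.exp ((-r) • A)) =
        -((A - A₀) * (NormedSpace.exp ((-t) • A) - NormedSpace.exp ((-r) • A))) := by
      noncomm_ring
    rw [e, norm_neg]
    refine (norm_mul_le_of_le hd (hexp.lipschitz (convex_Icc _ _) ht hr)).trans ?_
    rw [mul_one, ← mul_assoc]
    gcongr
    linarith

end FastOrbits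

/-! ### Averaging over one period -/

section Averaging

set_option linter.unusedSectionVars false

variable {V : Type*} [NormedAddCommGroup V] [InnerProductSpace ℝ V] [CompleteSpace V]
  [Nontrivial V] {A₀ : V →L[ℝ] V} {ρ K : ℝ}

namespace FastOrbit

/-- On a window of bounded length the deviation from the free rotation `e^{sA₀}` is driven by `(A -
A₀) u + F`, which is of size `ε` because `κ ≤ ε`. -/
theorem exists_c11_velocity (A₀ : V →L[ℝ] V) (ρ : ℝ) {K : ℝ} (hK : 1 ≤ K) :
    ∃ C : ℝ, 0 ≤ C ∧ ∀ S : FastOrbit A₀ ρ K, S.L ≤ K →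
      C11On (fun s => S.u s - NormedSpace.exp (s • A₀) (S.u 0)) (Set.Icc 0 S.L) (C * S.ε) := by
  refine ⟨(K + 1) ^ 2 * (11 * K ^ 3 * Real.exp (K * K)), by positivity, fun S hL => ?_⟩
  have hε := S.ε_pos
  have hκ := S.κ_nonneg
  have hκε := S.κ_le
  have hδ := S.δ_le
  have hder : ∀ t ∈ Set.Icc 0 S.L, HasDerivWithinAt
      (fun s => S.u s - NormedSpace.exp (s • A₀) (S.u 0))
      (A₀ (S.u t - NormedSpace.exp (t • A₀) (S.u 0)) + ((S.A - A₀) (S.u t) + S.F t))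
      (Set.Icc 0 S.L) t := fun t ht => by
    have h2 := ((hasDerivAt_exp_smul A₀ t).clm_apply
      (hasDerivAt_const t (S.u 0))).hasDerivWithinAt (s := Set.Icc 0 S.L)
    refine ((S.deriv_u t ht).sub h2).congr_deriv ?_
    simp only [F, map_sub, sub_apply, map_zero, add_zero]
    rw [show (A₀ * NormedSpace.exp (t • A₀)) (S.u 0) =
      A₀ (NormedSpace.exp (t • A₀) (S.u 0)) from rfl]
    abel
  have hk : ∀ t ∈ Set.Icc 0 S.L, ‖(S.A - A₀) (S.u t) + S.F t‖ ≤ 3 * K ^ 2 * S.ε :=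
    fun t ht => by
    refine (norm_add_le_of_le ((S.A - A₀).le_of_opNorm_le_of_le S.norm_A_sub (S.norm_u t ht))
      (S.norm_F ht)).trans ?_
    have : K * S.κ * K ≤ K * S.ε * K := by gcongr
    nlinarith
  have h1 : 1 ≤ Real.exp (K * K) := Real.one_le_exp (by positivity)
  have h2 : Real.exp (K * S.L) ≤ Real.exp (K * K) := by gcongr
  have h23 : K ^ 2 ≤ K ^ 3 := pow_le_pow_right₀ hK (by norm_num)
  have e1 : 3 * K ^ 2 * S.ε * Real.exp (K * K) ≤ 11 * K ^ 3 * Real.exp (K * K) * S.ε := by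
    calc _ = 3 * K ^ 2 * (Real.exp (K * K) * S.ε) := by ring
      _ ≤ 11 * K ^ 3 * (Real.exp (K * K) * S.ε) := by
        gcongr; norm_num
      _ = _ := by ring
  rw [mul_assoc]
  refine C11On.of_linear A₀ (convex_Icc _ _) S.norm_A₀ hder (fun t ht => ?_) (fun t ht => ?_)
    (fun t ht r hr => ?_)
  · refine (norm_le_of_deriv_le_of_zero (c := 3 * K ^ 2 * S.ε) hK (by positivity) hder (by simp)
      (fun t ht => ?_) t ht).trans ?_
    · exact norm_add_le_of_le (A₀.le_of_opNorm_le S.norm_A₀ _) (hk t ht)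
    · refine le_trans ?_ e1
      gcongr
  · refine (hk t ht).trans (le_trans ?_ e1)
    exact le_mul_of_one_le_right (by positivity) h1
  · have e : (S.A - A₀) (S.u t) + S.F t - ((S.A - A₀) (S.u r) + S.F r) =
        (S.A - A₀) (S.u t - S.u r) + (S.F t - S.F r) := by rw [map_sub]; abel
    rw [e]
    refine (norm_add_le_of_le ((S.A - A₀).le_of_opNorm_le_of_le S.norm_A_sub (S.lip_u ht hr))
      (S.lip_F ht hr)).trans ?_
    have a1 : K * S.κ * (3 * K ^ 2 * |t - r|) ≤ K * S.ε * (3 * K ^ 2 * |t - r|) := by gcongr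
    have a2 : 4 * K ^ 3 * S.δ * |t - r| ≤ 4 * K ^ 3 * (2 * S.ε) * |t - r| := by gcongr
    have a3 : 11 * K ^ 3 * S.ε * |t - r| * 1 ≤ 11 * K ^ 3 * S.ε * |t - r| * Real.exp (K * K) := by
      gcongr
    nlinarith

theorem exists_c11_position (A₀ : V →L[ℝ] V) (ρ : ℝ) {K ω : ℝ} (hK : 1 ≤ K) (hω : ω ≠ 0)
    (hA₀ : A₀ * (A₀ * A₀) = -(ω ^ 2) • A₀) :
    ∃ C : ℝ, 0 ≤ C ∧ ∀ S : FastOrbit A₀ ρ K, 0 ≤ S.L → S.L ≤ K →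
      C11On (fun s => S.x s - S.x 0 - S.ε • rotInt A₀ ω s (S.u 0)) (Set.Icc 0 S.L)
        (C * S.ε ^ 2) := by
  obtain ⟨C, hC, h⟩ := exists_c11_velocity A₀ ρ hK
  refine ⟨K * C, by positivity, fun S hL0 hL => ?_⟩
  have hε := S.ε_pos
  have hw := h S hL
  have h0 : (0 : ℝ) ∈ Set.Icc 0 S.L := ⟨le_rfl, hL0⟩
  have hb : ∀ t ∈ Set.Icc 0 S.L, ‖S.ε • (S.u t - NormedSpace.exp (t • A₀) (S.u 0))‖ ≤
      C * S.ε ^ 2 := fun t ht => by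
    rw [norm_smul, Real.norm_of_nonneg hε.le]
    have := mul_le_mul_of_nonneg_left (hw.norm_le ht) hε.le
    nlinarith
  have hCK : C * S.ε ^ 2 ≤ K * C * S.ε ^ 2 := by
    rw [mul_assoc]; exact le_mul_of_one_le_left (by positivity) hK
  have hder : ∀ t ∈ Set.Icc 0 S.L, HasDerivWithinAt
      (fun s => S.x s - S.x 0 - S.ε • rotInt A₀ ω s (S.u 0))
      (S.ε • (S.u t - NormedSpace.exp (t • A₀) (S.u 0))) (Set.Icc 0 S.L) t := fun t ht => by
    have h2 := (((hasDerivAt_rotInt hω hA₀ t).clm_apply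
      (hasDerivAt_const t (S.u 0))).const_smul S.ε).hasDerivWithinAt (s := Set.Icc 0 S.L)
    refine (((S.deriv_x t ht).sub_const _).sub h2).congr_deriv ?_
    simp [smul_sub]
  refine ⟨_, hder, fun t ht => ?_, fun t ht => (hb t ht).trans hCK, fun t ht r hr => ?_⟩
  · have := (convex_Icc 0 S.L).norm_image_sub_le_of_norm_hasDerivWithin_le hder hb h0 ht
    simp only [rotInt_zero, zero_apply, smul_zero, sub_self, sub_zero] at this
    refine this.trans ?_
    rw [Real.norm_of_nonneg ht.1]
    have := ht.2.trans hL
    calc C * S.ε ^ 2 * t ≤ C * S.ε ^ 2 * K := by gcongr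
      _ = _ := by ring
  · rw [← smul_sub, norm_smul, Real.norm_of_nonneg hε.le]
    have := mul_le_mul_of_nonneg_left (hw.lipschitz (convex_Icc _ _) ht hr) hε.le
    have := mul_le_mul_of_nonneg_right hCK (abs_nonneg (t - r))
    nlinarith

/-- The derivative of the Taylor remainder is `(E'(x(s)) - E'(x(0))) (ε u)`: one factor `ε` comes
from the displacement, the other from the speed. -/
theorem c11_taylor (S : FastOrbit A₀ ρ K) (hL0 : 0 ≤ S.L) (hL : S.L ≤ K) :
    C11On (fun s => S.E (S.x s) - S.E (S.x 0) - S.E' (S.x 0) (S.x s - S.x 0))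
      (Set.Icc 0 S.L) (4 * K ^ 5 * S.ε ^ 2) := by
  have h0 : (0 : ℝ) ∈ Set.Icc 0 S.L := ⟨le_rfl, hL0⟩
  have hK := S.one_le
  have hε := S.ε_pos
  have hb : ∀ t ∈ Set.Icc 0 S.L, S.x t ∈ Metric.closedBall 0 ρ :=
    fun t ht => mem_closedBall_zero_iff.2 (S.norm_x t ht)
  have hεu : ∀ t ∈ Set.Icc 0 S.L, ‖S.ε • S.u t‖ ≤ S.ε * K := fun t ht => by
    rw [norm_smul, Real.norm_of_nonneg hε.le]
    exact mul_le_mul_of_nonneg_left (S.norm_u t ht) hε.le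
  have hE' : ∀ t ∈ Set.Icc 0 S.L, ∀ r ∈ Set.Icc 0 S.L,
      ‖S.E' (S.x t) - S.E' (S.x r)‖ ≤ K * (K * S.ε * |t - r|) := fun t ht r hr =>
    ((S.hE _ (hb t ht)).2.2.2 _ (hb r hr)).trans (by gcongr; exact S.lip_x ht hr)
  have hE0 : ∀ t ∈ Set.Icc 0 S.L, ‖S.E' (S.x t) - S.E' (S.x 0)‖ ≤ K * (K * S.ε * K) :=
    fun t ht => (hE' t ht 0 h0).trans (by
      have : |t - 0| ≤ K := by rw [sub_zero, abs_of_nonneg ht.1]; exact ht.2.trans hL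
      gcongr)
  have hder : ∀ t ∈ Set.Icc 0 S.L, HasDerivWithinAt
      (fun s => S.E (S.x s) - S.E (S.x 0) - S.E' (S.x 0) (S.x s - S.x 0))
      ((S.E' (S.x t) - S.E' (S.x 0)) (S.ε • S.u t)) (Set.Icc 0 S.L) t := fun t ht => by
    have h1 := ((S.hE _ (hb t ht)).1.comp_hasDerivWithinAt t (S.deriv_x t ht)).sub_const
      (S.E (S.x 0))
    have h2 := (S.E' (S.x 0)).hasFDerivAt.comp_hasDerivWithinAt t
      ((S.deriv_x t ht).sub_const (S.x 0))
    exact h1.sub h2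
  have hk : ∀ t ∈ Set.Icc 0 S.L,
      ‖(S.E' (S.x t) - S.E' (S.x 0)) (S.ε • S.u t)‖ ≤ K ^ 4 * S.ε ^ 2 := fun t ht => by
    refine ((S.E' (S.x t) - S.E' (S.x 0)).le_of_opNorm_le_of_le (hE0 t ht) (hεu t ht)).trans ?_
    apply le_of_eq; ring
  have h45 : K ^ 4 ≤ K ^ 5 := pow_le_pow_right₀ hK (by norm_num)
  have h35 : K ^ 3 ≤ K ^ 5 := pow_le_pow_right₀ hK (by norm_num)
  have hKp : 0 ≤ K ^ 5 * S.ε ^ 2 := by positivity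
  refine ⟨_, hder, fun t ht => ?_, fun t ht => (hk t ht).trans ?_, fun t ht r hr => ?_⟩
  · have := (convex_Icc 0 S.L).norm_image_sub_le_of_norm_hasDerivWithin_le hder hk h0 ht
    simp only [map_zero, sub_self, sub_zero] at this
    refine this.trans ?_
    rw [Real.norm_of_nonneg ht.1]
    have := ht.2.trans hL
    calc K ^ 4 * S.ε ^ 2 * t ≤ K ^ 4 * S.ε ^ 2 * K := by gcongr
      _ = K ^ 5 * S.ε ^ 2 := by ring
      _ ≤ _ := by linarith
  · nlinarith [mul_le_mul_of_nonneg_right h45 (sq_nonneg S.ε)]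
  · have e : (S.E' (S.x t) - S.E' (S.x 0)) (S.ε • S.u t) -
        (S.E' (S.x r) - S.E' (S.x 0)) (S.ε • S.u r) =
        (S.E' (S.x t) - S.E' (S.x r)) (S.ε • S.u t) +
          (S.E' (S.x r) - S.E' (S.x 0)) (S.ε • (S.u t - S.u r)) := by
      simp only [smul_sub, sub_apply, map_sub]; abel
    rw [e]
    have h2 : ‖S.ε • (S.u t - S.u r)‖ ≤ S.ε * (3 * K ^ 2 * |t - r|) := by
      rw [norm_smul, Real.norm_of_nonneg hε.le]
      exact mul_le_mul_of_nonneg_left (S.lip_u ht hr) hε.le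
    refine (norm_add_le_of_le ((S.E' (S.x t) - S.E' (S.x r)).le_of_opNorm_le_of_le
      (hE' t ht r hr) (hεu t ht)) ((S.E' (S.x r) - S.E' (S.x 0)).le_of_opNorm_le_of_le
      (hE0 r hr) h2)).trans ?_
    have : K ^ 3 * (S.ε ^ 2 * |t - r|) ≤ K ^ 5 * (S.ε ^ 2 * |t - r|) := by gcongr
    nlinarith

/-- Two errors of size `κ ε`: the variation of `D` along the orbit, and `D(x(0))` applied to the
deviation of the velocity from the free rotation. -/
theorem exists_c11_rotation (A₀ : V →L[ℝ] V) (ρ : ℝ) {K : ℝ} (hK : 1 ≤ K) :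
    ∃ C : ℝ, 0 ≤ C ∧ ∀ S : FastOrbit A₀ ρ K, 0 ≤ S.L → S.L ≤ K →
      C11On (fun s => S.D (S.x s) (S.u s) - S.D (S.x 0) (NormedSpace.exp (s • A₀) (S.u 0)))
        (Set.Icc 0 S.L) (C * (S.κ * S.ε)) := by
  obtain ⟨C, hC, h⟩ := exists_c11_velocity A₀ ρ hK
  refine ⟨128 * K ^ 6 * (K + 1) ^ 2 + K * C, by positivity, fun S hL0 hL => ?_⟩
  have h0 : (0 : ℝ) ∈ Set.Icc 0 S.L := ⟨le_rfl, hL0⟩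
  have h1 := (S.c11_comp S.hD hL0 hL).clm_apply (convex_Icc _ _) S.c11_u
  have h2 := (h S hL).clm (S.D (S.x 0)) (S.norm_D (S.norm_x 0 h0))
  refine ((h1.add h2).congr fun t _ => ?_).mono subset_rfl (le_of_eq ?_)
  · simp only [sub_apply, map_sub]; abel
  · ring

/-- Serves the incomplete last period, where only the constant part of the force can be removed. -/
theorem exists_c11_force (A₀ : V →L[ℝ] V) (ρ : ℝ) {K : ℝ} (hK : 1 ≤ K) :
    ∃ C : ℝ, 0 ≤ C ∧ ∀ S : FastOrbit A₀ ρ K, 0 ≤ S.L → S.L ≤ K →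
      C11On (fun s => S.F s - S.ε • S.E (S.x 0)) (Set.Icc 0 S.L) (C * S.δ) := by
  refine ⟨4 * (4 * K ^ 3 + K) * ((K + 1) ^ 2 * (8 * K ^ 3)) + 4 * K ^ 3, by positivity,
    fun S hL0 hL => ?_⟩
  have h0 : (0 : ℝ) ∈ Set.Icc 0 S.L := ⟨le_rfl, hL0⟩
  have hε := S.ε_pos
  have hκ := S.κ_nonneg
  have hDx : C11On (fun t => S.D (S.x t)) (Set.Icc 0 S.L) ((4 * K ^ 3 + K) * S.κ) := by
    refine (((S.c11_comp S.hD hL0 hL).add (C11On.const (S.D (S.x 0)) _)).congr fun t _ => ?_).mono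
      subset_rfl ?_
    · abel
    · have := S.norm_D (S.norm_x 0 h0)
      have h3 : K ^ 3 * (S.κ * S.ε) ≤ K ^ 3 * (S.κ * 1) := by have := S.ε_le; gcongr
      nlinarith
  have h1 := hDx.clm_apply (convex_Icc _ _) S.c11_u
  have h2 := (S.c11_comp S.hE hL0 hL).smul_const hε.le
  refine ((h1.add h2).congr fun t _ => ?_).mono subset_rfl ?_
  · simp only [F, smul_sub]; abel
  · unfold δ
    have a1 : 0 ≤ K ^ 3 * S.κ := by positivity
    have a2 : 0 ≤ 4 * (4 * K ^ 3 + K) * ((K + 1) ^ 2 * (8 * K ^ 3)) * S.ε ^ 2 := by positivity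
    calc _ = 4 * (4 * K ^ 3 + K) * ((K + 1) ^ 2 * (8 * K ^ 3)) * S.κ + 4 * K ^ 3 * S.ε ^ 2 := by
          ring
      _ ≤ _ := by linarith

end FastOrbit

theorem norm_midErr_le_of_exact {F : Type*} [NormedAddCommGroup F] [NormedSpace ℝ F]
    [CompleteSpace F] {g e : ℝ → F} {η c : ℝ} {N : ℕ} (hη : 0 ≤ η) (he : MidExact e η N)
    (hg : C11On (fun s => g s - e s) (Set.Icc 0 (N * η)) c) :
    ‖midErr g η 0 N‖ ≤ N * (c * η ^ 3) := by
  rw [← zero_add (N * η)] at hg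
  have h1 : midErr g η 0 N = midErr (fun s => e s + (g s - e s)) η 0 N := by
    congr 1; funext s; abel
  rw [h1, midErr_add hη he.1.continuousOn hg.continuousOn, he.2, zero_add]
  exact norm_midErr_le hη hg

namespace FastOrbit

/-- The force is expanded to the order at which one more `ε` is gained over `δ`: the constant `ε E`,
the first-order term `ε² E'` applied to the integrated rotation, and `D` applied to the rotating
velocity. All three are integrated exactly. The remainders are of sizes `ε³` and `κ ε`, together `ε
δ`. -/
theorem exists_midErr_force_period (A₀ : V →L[ℝ] V) (ρ : ℝ) {K ω : ℝ} (hK : 1 ≤ K) (hω : ω ≠ 0)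
    (hA₀ : A₀ * (A₀ * A₀) = -(ω ^ 2) • A₀) :
    ∃ C : ℝ, 0 ≤ C ∧ ∀ (S : FastOrbit A₀ ρ K) (η : ℝ) (N : ℕ), 0 ≤ η → 3 ≤ N →
      ω * (N * η) = 2 * Real.pi → S.L = N * η → S.L ≤ K →
      ‖midErr S.F η 0 N‖ ≤ N * (C * (S.ε * S.δ) * η ^ 3) := by
  obtain ⟨C₁, hC₁, h₁⟩ := exists_c11_position A₀ ρ hK hω hA₀
  obtain ⟨C₂, hC₂, h₂⟩ := exists_c11_rotation A₀ ρ hK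
  refine ⟨K * C₁ + 4 * K ^ 5 + C₂, by positivity, fun S η N hη hN hper hSL hL => ?_⟩
  have hL0 : 0 ≤ S.L := by rw [hSL]; positivity
  have h0 : (0 : ℝ) ∈ Set.Icc 0 S.L := ⟨le_rfl, hL0⟩
  have hε := S.ε_pos
  have hb0 : S.x 0 ∈ Metric.closedBall (0 : V) ρ := mem_closedBall_zero_iff.2 (S.norm_x 0 h0)
  have hex : MidExact (fun s => (1 : ℝ) • (S.ε • S.E (S.x 0)) +
      (S.ε ^ 2 • S.E' (S.x 0)) (rotInt A₀ ω s (S.u 0)) +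
      S.D (S.x 0) (NormedSpace.exp (s • A₀) (S.u 0))) η N :=
    ((((midExact_one η N).smul hη _).add hη ((midExact_rotInt hω hη hN hper _).clm _ hη))).add hη
      ((midExact_exp hω hA₀ hη hN hper _).clm _ hη)
  refine norm_midErr_le_of_exact hη hex ?_
  rw [← hSL]
  have c1 := ((h₁ S hL0 hL).clm (S.E' (S.x 0)) (S.hE _ hb0).2.2.1).smul_const hε.le
  have c2 := (S.c11_taylor hL0 hL).smul_const hε.le
  have c3 := h₂ S hL0 hL
  refine (((c1.add c2).add c3).congr fun t _ => ?_).mono subset_rfl ?_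
  · simp only [F, smul_apply, map_sub, map_smul, smul_sub, one_smul, pow_two, mul_smul]
    abel
  · unfold δ
    have hκ := S.κ_nonneg
    have a1 : 0 ≤ (K * C₁ + 4 * K ^ 5) * (S.κ * S.ε) := by positivity
    have a2 : 0 ≤ C₂ * (S.ε ^ 3) := by positivity
    nlinarith

/-- The exactly integrated part is `e^{-sA₀} (ε E + D e^{sA₀} u(0))`, with fields frozen at the
start of the period; its second term is a conjugation. What remains is of size `ε²`, including the
replacement of `A` by `A₀`, which costs `κ` times the force. -/
theorem exists_midErr_exp_force_period (A₀ : V →L[ℝ] V) (ρ : ℝ) {K ω : ℝ} (hK : 1 ≤ K)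
    (hω : ω ≠ 0) (hA₀ : A₀ * (A₀ * A₀) = -(ω ^ 2) • A₀) :
    ∃ C : ℝ, 0 ≤ C ∧ ∀ (S : FastOrbit A₀ ρ K) (η : ℝ) (N : ℕ), 0 ≤ η → 3 ≤ N →
      ω * (N * η) = 2 * Real.pi → S.L = N * η → S.L ≤ K →
      ‖midErr (fun s => NormedSpace.exp ((-s) • S.A) (S.F s)) η 0 N‖ ≤
        N * (C * S.ε ^ 2 * η ^ 3) := by
  obtain ⟨C₂, hC₂, h₂⟩ := exists_c11_rotation A₀ ρ hK
  refine ⟨4 * ((K + 1) ^ 2 * (4 * K ^ 3 + C₂)) +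
    4 * ((K + 1) ^ 2 * (K * (Real.exp (K * K) + (K + 1) ^ 2)) *
      (K + K * ((K + 1) ^ 2 * ((1 + K * Real.exp (K * K)) * K)))), by positivity,
    fun S η N hη hN hper hSL hL => ?_⟩
  have hL0 : 0 ≤ S.L := by rw [hSL]; positivity
  have h0 : (0 : ℝ) ∈ Set.Icc 0 S.L := ⟨le_rfl, hL0⟩
  have hε := S.ε_pos
  have hκ := S.κ_nonneg
  have hκε := S.κ_le
  have hneg : (-A₀) * ((-A₀) * (-A₀)) = -(ω ^ 2) • (-A₀) := by
    rw [smul_neg, ← hA₀]; noncomm_ring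
  have hflip : ∀ (t : ℝ), t • (-A₀) = (-t) • A₀ := fun t => by rw [smul_neg, neg_smul]
  have hex : MidExact (fun s => NormedSpace.exp ((-s) • A₀) (S.ε • S.E (S.x 0)) +
      NormedSpace.exp ((-s) • A₀) (S.D (S.x 0) (NormedSpace.exp (s • A₀) (S.u 0)))) η N := by
    refine MidExact.add hη ?_ (midExact_conj hω hA₀ hη hN hper _ _)
    simpa only [hflip] using midExact_exp hω hneg hη hN hper (S.ε • S.E (S.x 0))
  refine norm_midErr_le_of_exact hη hex ?_
  rw [← hSL]
  have cR := ((S.c11_comp S.hE hL0 hL).smul_const hε.le).add (h₂ S hL0 hL)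
  have c1 := (c11_exp_neg S.norm_A S.skew (convex_Icc 0 S.L)).clm_apply (convex_Icc _ _) cR
  have cF0 := (C11On.const (S.ε • S.E (S.x 0)) (Set.Icc 0 S.L)).add
    ((c11_exp hK S.norm_A₀ hL (S.u 0)).clm (S.D (S.x 0)) (S.norm_D (S.norm_x 0 h0)))
  have cF0' := cF0.mono (c' := S.ε * (K + K * ((K + 1) ^ 2 * ((1 + K * Real.exp (K * K)) * K))))
    subset_rfl (by
      rw [norm_smul, Real.norm_of_nonneg hε.le]
      have a1 := S.norm_E (S.norm_x 0 h0)
      have a2 := S.norm_u 0 h0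
      calc _ ≤ S.ε * K + K * S.ε * ((K + 1) ^ 2 * ((1 + K * Real.exp (K * K)) * K)) := by gcongr
        _ = _ := by ring)
  have c2 := (c11_exp_neg_sub hK S.norm_A S.norm_A₀ S.norm_A_sub S.skew hL).clm_apply
    (convex_Icc _ _) cF0'
  refine ((c1.add c2).congr fun t _ => ?_).mono subset_rfl ?_
  · simp only [F, sub_apply, map_sub, map_add, smul_sub]
    abel
  · set Q := K + K * ((K + 1) ^ 2 * ((1 + K * Real.exp (K * K)) * K)) with hQ
    have hQ0 : 0 ≤ Q := by positivity
    set Y := Real.exp (K * K) + (K + 1) ^ 2 with hY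
    have hY0 : 0 ≤ Y := by positivity
    calc _ ≤ 4 * ((K + 1) ^ 2 * 1 * (S.ε * (4 * K * K ^ 2 * S.ε) + C₂ * (S.ε * S.ε))) +
          4 * ((K + 1) ^ 2 * (K * S.ε * Y) * (S.ε * Q)) := by gcongr
      _ = _ := by ring

end FastOrbit

end Averaging

/-! ### Long-time quadrature errors -/

section LongTime

set_option linter.unusedSectionVars false

variable {V : Type*} [NormedAddCommGroup V] [InnerProductSpace ℝ V] [CompleteSpace V]
  [Nontrivial V] {A₀ : V →L[ℝ] V} {ρ K : ℝ}

namespace FastOrbit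

theorem window_F (S : FastOrbit A₀ ρ K) {τ ℓ : ℝ} (hτ : 0 ≤ τ) (hℓ : τ + ℓ ≤ S.L) :
    (S.window τ ℓ hτ hℓ).F = fun s => S.F (τ + s) := rfl

theorem exists_midErr_force (A₀ : V →L[ℝ] V) (ρ : ℝ) {K ω : ℝ} (hK : 1 ≤ K)
    (hω : ω ≠ 0) (hA₀ : A₀ * (A₀ * A₀) = -(ω ^ 2) • A₀) :
    ∃ C : ℝ, 0 ≤ C ∧ ∀ (S : FastOrbit A₀ ρ K) (η : ℝ) (N : ℕ), 0 ≤ η → 3 ≤ N →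
      ω * (N * η) = 2 * Real.pi → N * η ≤ K → ∀ n : ℕ, n * η ≤ S.L →
      ‖midErr S.F η 0 n‖ ≤ C * (S.δ * η ^ 2) := by
  obtain ⟨C₁, hC₁, h₁⟩ := exists_midErr_force_period A₀ ρ hK hω hA₀
  obtain ⟨C₂, hC₂, h₂⟩ := exists_c11_force A₀ ρ hK
  refine ⟨K * C₁ + K * C₂, by positivity, fun S η N hη hN hper hNK n hn => ?_⟩
  have hε := S.ε_pos
  have hδ := S.δ_nonneg
  have hN0 : (0 : ℝ) < N := by
    have : (3 : ℝ) ≤ N := by exact_mod_cast hN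
    linarith
  have hτ : ∀ p : ℕ, 0 ≤ (p : ℝ) * (N * η) := fun p => by positivity
  have key : ∀ p r : ℕ, p * N + r ≤ n → (p : ℝ) * (N * η) + r * η ≤ S.L := fun p r h => by
    refine le_trans ?_ hn
    have : (p : ℝ) * N + r ≤ n := by exact_mod_cast h
    nlinarith
  have hblock := norm_midErr_le_of_blocks (g := S.F) (η := η) (N := N) (n := n)
    (c := N * (C₁ * (S.ε * S.δ) * η ^ 3)) (d := K * C₂ * (S.δ * η ^ 2)) (by omega) (by positivity)
    (fun p hp => ?_) (fun p r hr hp => ?_)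
  · refine hblock.trans ?_
    rw [add_mul]
    refine add_le_add ?_ le_rfl
    -- The extra `ε` gained per period and one factor `η` absorb the number of cells, since `ε n η ≤
    -- ε L ≤ K`.
    calc (n : ℝ) / N * (N * (C₁ * (S.ε * S.δ) * η ^ 3)) =
        (S.ε * (n * η)) * (C₁ * (S.δ * η ^ 2)) := by field_simp
      _ ≤ K * (C₁ * (S.δ * η ^ 2)) := by
          gcongr
          exact (mul_le_mul_of_nonneg_left hn hε.le).trans S.εL_le
      _ = _ := by ring
  · rw [midErr_shift]
    exact h₁ (S.window _ (N * η) (hτ p) (key p N (by rwa [add_mul, one_mul] at hp))) η N hη hN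
      hper rfl hNK
  -- The incomplete block is shorter than one period, so the ungained bound is already good enough.
  · have hrK : (r : ℝ) * η ≤ K := le_trans (by gcongr) hNK
    rw [midErr_shift]
    have h := h₂ (S.window _ (r * η) (hτ p) (key p r hp)) (by change 0 ≤ (r : ℝ) * η; positivity)
      hrK
    refine (norm_midErr_le_of_exact hη (((midExact_one η r).smul hη
      (S.ε • S.E (S.x (p * (N * η) + 0)))).congr fun t => (one_smul ℝ _).symm) h).trans ?_
    calc (r : ℝ) * (C₂ * S.δ * η ^ 3) = (r * η) * C₂ * (S.δ * η ^ 2) := by ring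
      _ ≤ _ := by gcongr

theorem exists_midErr_exp_force (A₀ : V →L[ℝ] V) (ρ : ℝ) {K ω : ℝ} (hK : 1 ≤ K)
    (hω : ω ≠ 0) (hA₀ : A₀ * (A₀ * A₀) = -(ω ^ 2) • A₀) :
    ∃ C : ℝ, 0 ≤ C ∧ ∀ (S : FastOrbit A₀ ρ K) (η : ℝ) (N : ℕ), 0 ≤ η → 3 ≤ N →
      ω * (N * η) = 2 * Real.pi → N * η ≤ K → ∀ n : ℕ, n * η ≤ S.L →
      ‖midErr (fun s => NormedSpace.exp ((-s) • S.A) (S.F s)) η 0 n‖ ≤ C * (S.ε * η ^ 2) := by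
  obtain ⟨C₁, hC₁, h₁⟩ := exists_midErr_exp_force_period A₀ ρ hK hω hA₀
  obtain ⟨C₂, hC₂, h₂⟩ := exists_c11_force A₀ ρ hK
  refine ⟨K * C₁ + K * (4 * ((K + 1) ^ 2 * (2 * C₂ + K))), by positivity,
    fun S η N hη hN hper hNK n hn => ?_⟩
  have hε := S.ε_pos
  have hδ := S.δ_nonneg
  have hδε := S.δ_le
  have hN0 : (0 : ℝ) < N := by
    have : (3 : ℝ) ≤ N := by exact_mod_cast hN
    linarith
  have hτ : ∀ p : ℕ, 0 ≤ (p : ℝ) * (N * η) := fun p => by positivity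
  have key : ∀ p r : ℕ, p * N + r ≤ n → (p : ℝ) * (N * η) + r * η ≤ S.L := fun p r h => by
    refine le_trans ?_ hn
    have : (p : ℝ) * N + r ≤ n := by exact_mod_cast h
    nlinarith
  -- Restarting the exponential at `τ` factors out the isometry `e^{-τA}`, so each period reduces to
  -- a window that starts at time zero.
  have hshift : ∀ (τ : ℝ) (m : ℕ), 0 ≤ τ → τ + m * η ≤ S.L →
      ‖midErr (fun s => NormedSpace.exp ((-s) • S.A) (S.F s)) η τ m‖ ≤
        ‖midErr (fun s => NormedSpace.exp ((-s) • S.A) (S.F (τ + s))) η 0 m‖ := by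
    intro τ m hτ hm
    have hcont : ContinuousOn (fun s => NormedSpace.exp ((-s) • S.A) (S.F (τ + s)))
        (Set.Icc 0 (0 + m * η)) := by
      rw [zero_add]
      apply ContinuousOn.clm_apply
      · exact (c11_exp_neg S.norm_A S.skew (convex_Icc _ _)).continuousOn
      · rw [← S.window_F hτ hm]
        exact LipschitzOnWith.continuousOn (K := ⟨4 * K ^ 3 * S.δ, by positivity⟩)
          (LipschitzOnWith.of_dist_le_mul fun t ht r hr => by
            rw [dist_eq_norm, Real.dist_eq]
            exact (S.window _ _ hτ hm).lip_F ht hr)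
    have e : midErr (fun s => NormedSpace.exp ((-s) • S.A) (S.F s)) η τ m =
        NormedSpace.exp ((-τ) • S.A)
          (midErr (fun s => NormedSpace.exp ((-s) • S.A) (S.F (τ + s))) η 0 m) := by
      rw [midErr_shift, ← midErr_clm _ hη hcont]
      congr 1
      funext s
      rw [neg_add, exp_add_smul]; rfl
    rw [e, norm_exp_smul_apply S.skew]
  have hblock := norm_midErr_le_of_blocks
    (g := fun s => NormedSpace.exp ((-s) • S.A) (S.F s)) (η := η) (N := N) (n := n)
    (c := N * (C₁ * S.ε ^ 2 * η ^ 3))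
    (d := K * (4 * ((K + 1) ^ 2 * (2 * C₂ + K))) * (S.ε * η ^ 2)) (by omega) (by positivity)
    (fun p hp => ?_) (fun p r hr hp => ?_)
  · refine hblock.trans ?_
    rw [add_mul]
    refine add_le_add ?_ le_rfl
    calc (n : ℝ) / N * (N * (C₁ * S.ε ^ 2 * η ^ 3)) =
        (S.ε * (n * η)) * (C₁ * (S.ε * η ^ 2)) := by field_simp
      _ ≤ K * (C₁ * (S.ε * η ^ 2)) := by
          gcongr
          exact (mul_le_mul_of_nonneg_left hn hε.le).trans S.εL_le
      _ = _ := by ring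
  · have hk := key p N (by rwa [add_mul, one_mul] at hp)
    exact (hshift _ _ (hτ p) hk).trans (h₁ (S.window _ (N * η) (hτ p) hk) η N hη hN hper rfl hNK)
  · have hrK : (r : ℝ) * η ≤ K := le_trans (by gcongr) hNK
    have hk := key p r hp
    refine (hshift _ _ (hτ p) hk).trans ?_
    set S' := S.window _ (r * η) (hτ p) hk with hS'
    have hS'L : 0 ≤ S'.L := by change 0 ≤ (r : ℝ) * η; positivity
    have h := (h₂ S' hS'L hrK).add (C11On.const (S'.ε • S'.E (S'.x 0)) _)
    have hF : C11On S'.F (Set.Icc 0 (r * η)) ((2 * C₂ + K) * S.ε) := by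
      refine (h.congr fun t _ => by abel).mono subset_rfl ?_
      rw [norm_smul, Real.norm_of_nonneg S'.ε_pos.le]
      have a1 := S'.norm_E (S'.norm_x 0 ⟨le_rfl, hS'L⟩)
      have a2 : C₂ * S.δ ≤ C₂ * (2 * S.ε) := by gcongr
      have a3 : S.ε * ‖S'.E (S'.x 0)‖ ≤ S.ε * K := by gcongr
      change C₂ * S.δ + S.ε * ‖S'.E (S'.x 0)‖ ≤ _
      nlinarith
    have hc := (c11_exp_neg S.norm_A S.skew (convex_Icc 0 ((r : ℝ) * η))).clm_apply
      (convex_Icc _ _) hF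
    have hm := norm_midErr_le (a := 0) (n := r) hη (by rw [zero_add]; exact hc)
    refine hm.trans ?_
    calc (r : ℝ) * (4 * ((K + 1) ^ 2 * 1 * ((2 * C₂ + K) * S.ε)) * η ^ 3) =
        (r * η) * (4 * ((K + 1) ^ 2 * (2 * C₂ + K))) * (S.ε * η ^ 2) := by ring
      _ ≤ _ := by gcongr

end FastOrbit

end LongTime

/-! ### Local errors -/

section LocalErrors

set_option linter.unusedSectionVars false

variable {V : Type*} [NormedAddCommGroup V] [InnerProductSpace ℝ V] [CompleteSpace V]
  [Nontrivial V] {A₀ : V →L[ℝ] V} {ρ K : ℝ}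

/-- The integral `∫₀ᵗ e^{sA} ds`. -/
noncomputable def flowInt (A : V →L[ℝ] V) (t : ℝ) : V →L[ℝ] V := t • phiOne (t • A)

theorem flowInt_zero (A : V →L[ℝ] V) : flowInt A 0 = 0 := zero_smul _ _

theorem hasDerivAt_flowInt_apply (A : V →L[ℝ] V) (t : ℝ) (v : V) :
    HasDerivAt (fun s => flowInt A s v) (NormedSpace.exp (t • A) v) t :=
  ((hasDerivAt_smul_phiOne A t).clm_apply (hasDerivAt_const t v)).congr_deriv (by simp)

theorem hasDerivAt_exp_apply (A : V →L[ℝ] V) (t : ℝ) (v : V) :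
    HasDerivAt (fun s : ℝ => NormedSpace.exp (s • A) v) (A (NormedSpace.exp (t • A) v)) t :=
  ((hasDerivAt_exp_smul A t).clm_apply (hasDerivAt_const t v)).congr_deriv (by simp)

theorem norm_flowInt_apply_le {A : V →L[ℝ] V} (hA : ∀ v, inner ℝ (A v) v = 0) {t : ℝ}
    (ht : 0 ≤ t) (v : V) : ‖flowInt A t v‖ ≤ t * ‖v‖ := by
  have := norm_le_pow_of_deriv_le (L := t) (c := ‖v‖) 0
    (fun s _ => (hasDerivAt_flowInt_apply A s v).hasDerivWithinAt) (by simp [flowInt_zero])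
    (fun s _ => by rw [norm_exp_smul_apply hA]; simp) t ⟨ht, le_rfl⟩
  simpa [mul_comm] using this

theorem norm_flowInt_sub_le {A : V →L[ℝ] V} (hA : ∀ v, inner ℝ (A v) v = 0) (hK : ‖A‖ ≤ K) {t : ℝ}
    (ht : 0 ≤ t) (v : V) : ‖flowInt A t v - t • v‖ ≤ K * ‖v‖ * t ^ 2 := by
  have h1 : ∀ s ∈ Set.Icc 0 t, ‖NormedSpace.exp (s • A) v - v‖ ≤ K * ‖v‖ * s ^ (0 + 1) :=
    norm_le_pow_of_deriv_le 0
      (fun s _ => ((hasDerivAt_exp_apply A s v).sub_const v).hasDerivWithinAt) (by simp)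
      (fun s _ => by
        refine (A.le_of_opNorm_le hK _).trans ?_
        rw [norm_exp_smul_apply hA]; simp)
  refine norm_le_pow_of_deriv_le (L := t) 1 (fun s _ =>
    ((hasDerivAt_flowInt_apply A s v).sub ((hasDerivAt_id s).smul_const v)).hasDerivWithinAt)
    (by simp [flowInt_zero]) (fun s hs => ?_) t ⟨ht, le_rfl⟩
  simpa using h1 s hs

theorem inner_axis_flowInt {A : V →L[ℝ] V} {b : V} (hb : ∀ v, inner ℝ b (A v) = 0) (t : ℝ)
    (v : V) : inner ℝ b (flowInt A t v) = t * inner ℝ b v := by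
  have hd : ∀ s : ℝ, HasDerivAt (fun s : ℝ => inner ℝ b (flowInt A s v) - s * inner ℝ b v)
      (0 : ℝ) s := by
    intro s
    refine (((hasDerivAt_const s b).inner ℝ (hasDerivAt_flowInt_apply A s v)).sub
      ((hasDerivAt_id s).mul_const _)).congr_deriv ?_
    simp [inner_axis_exp hb]
  have hc := is_const_of_deriv_eq_zero (fun s => (hd s).differentiableAt)
    (fun s => (hd s).deriv) t 0
  simp only [flowInt_zero, zero_apply, inner_zero_right, zero_mul, sub_zero] at hc
  linarith

theorem apply_flowInt (A : V →L[ℝ] V) (t : ℝ) (v : V) :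
    A (flowInt A t v) = NormedSpace.exp (t • A) v - v := by
  have := congrArg (fun M : V →L[ℝ] V => M v) (mul_phiOne (t • A))
  simpa [flowInt] using this

theorem flowInt_add_apply (A : V →L[ℝ] V) (a b : ℝ) (v : V) :
    flowInt A a v + flowInt A b (NormedSpace.exp (a • A) v) = flowInt A (a + b) v :=
  congrArg (fun M : V →L[ℝ] V => M v) (phiOne_half_add A a b)

namespace FastOrbit

/-- Grönwall against the free rotation gives the first bound. Inserting it into the equation, with
the force frozen at `c`, gives the second. -/
theorem exists_velocity_expansion (A₀ : V →L[ℝ] V) (ρ : ℝ) {K : ℝ} (hK : 1 ≤ K) :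
    ∃ C : ℝ, 0 ≤ C ∧ ∀ S : FastOrbit A₀ ρ K, S.L ≤ K → ∀ c ∈ Set.Icc 0 S.L,
      ∀ t ∈ Set.Icc 0 S.L,
      ‖S.u t - NormedSpace.exp (t • S.A) (S.u 0)‖ ≤ C * S.ε * t ∧
      ‖S.u t - NormedSpace.exp (t • S.A) (S.u 0) - t • S.F c‖ ≤ C * S.ε * S.L * t := by
  set C₁ := (K * Real.exp (K * K) + 1) * (2 * K ^ 2) with hC₁
  have hC₁0 : 0 ≤ C₁ := by positivity
  refine ⟨K * C₁ + 8 * K ^ 3, by positivity, fun S hL c hc => ?_⟩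
  have hε := S.ε_pos
  have hδ := S.δ_le
  have hd : ∀ t ∈ Set.Icc 0 S.L, HasDerivWithinAt
      (fun t => S.u t - NormedSpace.exp (t • S.A) (S.u 0))
      (S.A (S.u t - NormedSpace.exp (t • S.A) (S.u 0)) + S.F t) (Set.Icc 0 S.L) t := fun t ht => by
    refine ((S.deriv_u t ht).sub (hasDerivAt_exp_apply S.A t (S.u 0)).hasDerivWithinAt).congr_deriv
      ?_
    rw [map_sub, F]; abel
  have h1 : ∀ t ∈ Set.Icc 0 S.L,
      ‖S.u t - NormedSpace.exp (t • S.A) (S.u 0)‖ ≤ C₁ * S.ε * t := fun t ht => by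
    refine (norm_le_mul_of_deriv_le_of_zero (c := 2 * K ^ 2 * S.ε) hK (by positivity) hd (by simp)
      (fun s hs => norm_add_le_of_le (S.A.le_of_opNorm_le S.norm_A _) (S.norm_F hs)) t ht).trans ?_
    have h2 : Real.exp (K * S.L) ≤ Real.exp (K * K) := by gcongr
    have := ht.1
    rw [hC₁]
    calc _ ≤ (K * Real.exp (K * K) + 1) * (2 * K ^ 2 * S.ε) * t := by gcongr
      _ = _ := by ring
  intro t ht
  have hL0 : 0 ≤ S.L := ht.1.trans ht.2
  refine ⟨(h1 t ht).trans ?_, ?_⟩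
  · have := ht.1
    gcongr
    have : C₁ ≤ K * C₁ := le_mul_of_one_le_left hC₁0 hK
    have : 0 ≤ K ^ 3 := by positivity
    linarith
  · have h2 := norm_le_pow_of_deriv_le (c := (K * C₁ + 8 * K ^ 3) * S.ε * S.L) 0
      (fun s hs => (hd s hs).sub
        (((hasDerivWithinAt_id s (Set.Icc 0 S.L)).smul_const (S.F c)))) (by simp)
      (fun s hs => ?_) t ht
    · simpa using h2
    · have e : S.A (S.u s - NormedSpace.exp (s • S.A) (S.u 0)) + S.F s - (1 : ℝ) • S.F c =
          S.A (S.u s - NormedSpace.exp (s • S.A) (S.u 0)) + (S.F s - S.F c) := by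
        rw [one_smul]; abel
      rw [e]
      refine (norm_add_le_of_le (S.A.le_of_opNorm_le_of_le S.norm_A (h1 s hs))
        (S.lip_F hs hc)).trans ?_
      have a1 : |s - c| ≤ S.L := by
        rw [abs_le]; constructor <;> linarith [hs.1, hs.2, hc.1, hc.2]
      have a2 : 4 * K ^ 3 * S.δ * |s - c| ≤ 4 * K ^ 3 * (2 * S.ε) * S.L := by gcongr
      have a3 : K * (C₁ * S.ε * s) ≤ K * (C₁ * S.ε * S.L) := by have := hs.2; gcongr
      rw [pow_zero, mul_one]
      linarith

theorem exists_position_expansion (A₀ : V →L[ℝ] V) (ρ : ℝ) {K : ℝ} (hK : 1 ≤ K) :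
    ∃ C : ℝ, 0 ≤ C ∧ ∀ S : FastOrbit A₀ ρ K, S.L ≤ K → ∀ c ∈ Set.Icc 0 S.L,
      ∀ t ∈ Set.Icc 0 S.L,
      ‖S.x t - S.x 0 - S.ε • flowInt S.A t (S.u 0)‖ ≤ C * S.ε ^ 2 * S.L * t ∧
      ‖S.x t - S.x 0 - S.ε • flowInt S.A t (S.u 0) - (S.ε * (t ^ 2 / 2)) • S.F c‖ ≤
        C * S.ε ^ 2 * S.L ^ 2 * t := by
  obtain ⟨C, hC, h⟩ := exists_velocity_expansion A₀ ρ hK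
  refine ⟨C, hC, fun S hL c hc t ht => ?_⟩
  have hε := S.ε_pos
  have hL0 : 0 ≤ S.L := ht.1.trans ht.2
  have hd : ∀ t ∈ Set.Icc 0 S.L, HasDerivWithinAt
      (fun t => S.x t - S.x 0 - S.ε • flowInt S.A t (S.u 0))
      (S.ε • (S.u t - NormedSpace.exp (t • S.A) (S.u 0))) (Set.Icc 0 S.L) t := fun t ht => by
    refine (((S.deriv_x t ht).sub_const _).sub
      ((hasDerivAt_flowInt_apply S.A t (S.u 0)).const_smul S.ε).hasDerivWithinAt).congr_deriv ?_
    rw [smul_sub]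
  constructor
  · refine (norm_le_pow_of_deriv_le (c := C * S.ε ^ 2 * S.L) 0 hd (by simp [flowInt_zero])
      (fun s hs => ?_) t ht).trans (by simp)
    rw [norm_smul, Real.norm_of_nonneg hε.le, pow_zero, mul_one]
    calc S.ε * ‖S.u s - NormedSpace.exp (s • S.A) (S.u 0)‖ ≤ S.ε * (C * S.ε * s) := by
          gcongr; exact (h S hL c hc s hs).1
      _ ≤ S.ε * (C * S.ε * S.L) := by have := hs.2; gcongr
      _ = _ := by ring
  · have hq : ∀ s : ℝ, HasDerivAt (fun s : ℝ => (S.ε * (s ^ 2 / 2)) • S.F c)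
        ((S.ε * s) • S.F c) s := fun s => by
      have := (((hasDerivAt_pow 2 s).div_const 2).const_mul S.ε).smul_const (S.F c)
      refine this.congr_deriv ?_
      congr 1
      simp
    refine (norm_le_pow_of_deriv_le (c := C * S.ε ^ 2 * S.L ^ 2) 0
      (fun s hs => (hd s hs).sub (hq s).hasDerivWithinAt) (by simp [flowInt_zero])
      (fun s hs => ?_) t ht).trans (by simp)
    rw [mul_smul, ← smul_sub, norm_smul, Real.norm_of_nonneg hε.le, pow_zero, mul_one]
    calc S.ε * ‖S.u s - NormedSpace.exp (s • S.A) (S.u 0) - s • S.F c‖ ≤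
        S.ε * (C * S.ε * S.L * s) := by gcongr; exact (h S hL c hc s hs).2
      _ ≤ S.ε * (C * S.ε * S.L * S.L) := by have := hs.2; gcongr
      _ = _ := by ring

/-- Along the axis the rotation drops out of the equation and only the variation of `F` remains.
This leaves `ε δ` where the full position expansion has `ε²`. -/
theorem inner_position_expansion (S : FastOrbit A₀ ρ K) {b : V} (hbK : ‖b‖ ≤ K)
    (hb : ∀ v, inner ℝ b (S.A v) = 0) {c t : ℝ} (hc : c ∈ Set.Icc 0 S.L)
    (ht : t ∈ Set.Icc 0 S.L) :
    |inner ℝ b (S.x t - S.x 0 - (S.ε * t) • S.u 0 - (S.ε * (t ^ 2 / 2)) • S.F c)| ≤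
      4 * K ^ 4 * (S.ε * S.δ) * S.L ^ 2 * t := by
  have hε := S.ε_pos
  have hδ := S.δ_nonneg
  have hK := S.K_pos
  have hL0 : 0 ≤ S.L := ht.1.trans ht.2
  have hbu : ∀ s ∈ Set.Icc 0 S.L, HasDerivWithinAt (fun s => inner ℝ b (S.u s)) (inner ℝ b (S.F s))
      (Set.Icc 0 S.L) s := fun s hs => by
    refine ((hasDerivWithinAt_const s _ b).inner ℝ (S.deriv_u s hs)).congr_deriv ?_
    rw [inner_add_right, hb]
    simp [F]
  have h1 : ∀ s ∈ Set.Icc 0 S.L, ‖inner ℝ b (S.u s) - inner ℝ b (S.u 0) - s * inner ℝ b (S.F c)‖ ≤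
      4 * K ^ 4 * S.δ * S.L * s ^ (0 + 1) := by
    refine norm_le_pow_of_deriv_le 0 (fun s hs => ((hbu s hs).sub_const _).sub
      ((hasDerivWithinAt_id s _).mul_const _)) (by simp) fun s hs => ?_
    rw [one_mul, ← inner_sub_right, pow_zero, mul_one]
    refine (norm_inner_le_norm _ _).trans ?_
    have a1 : |s - c| ≤ S.L := by
      rw [abs_le]; constructor <;> linarith [hs.1, hs.2, hc.1, hc.2]
    calc ‖b‖ * ‖S.F s - S.F c‖ ≤ K * (4 * K ^ 3 * S.δ * S.L) := by
          gcongr; exact (S.lip_F hs hc).trans (by gcongr)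
      _ = _ := by ring
  have hbx : ∀ s ∈ Set.Icc 0 S.L, HasDerivWithinAt (fun s => inner ℝ b (S.x s))
      (S.ε * inner ℝ b (S.u s)) (Set.Icc 0 S.L) s := fun s hs => by
    refine ((hasDerivWithinAt_const s _ b).inner ℝ (S.deriv_x s hs)).congr_deriv ?_
    simp [inner_smul_right]
  have hq : ∀ s : ℝ, HasDerivAt (fun s : ℝ => S.ε * s * inner ℝ b (S.u 0) +
      S.ε * (s ^ 2 / 2) * inner ℝ b (S.F c))
      (S.ε * inner ℝ b (S.u 0) + S.ε * s * inner ℝ b (S.F c)) s := fun s => by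
    have h1 := (((hasDerivAt_pow 2 s).div_const 2).const_mul S.ε).mul_const (inner ℝ b (S.F c))
    have h2 := ((hasDerivAt_id s).const_mul S.ε).mul_const (inner ℝ b (S.u 0))
    refine (h2.add h1).congr_deriv ?_
    simp
  have h2 := norm_le_pow_of_deriv_le (c := 4 * K ^ 4 * (S.ε * S.δ) * S.L ^ 2) 0
    (fun s hs => ((hbx s hs).sub_const (inner ℝ b (S.x 0))).sub (hq s).hasDerivWithinAt) (by simp)
    (fun s hs => ?_) t ht
  · rw [zero_add, pow_one] at h2
    refine le_trans (le_of_eq ?_) h2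
    rw [Real.norm_eq_abs, Pi.sub_apply]
    congr 1
    simp only [inner_sub_right, inner_smul_right]
    ring
  · have e : S.ε * inner ℝ b (S.u s) -
        (S.ε * inner ℝ b (S.u 0) + S.ε * s * inner ℝ b (S.F c)) =
        S.ε * (inner ℝ b (S.u s) - inner ℝ b (S.u 0) - s * inner ℝ b (S.F c)) := by ring
    rw [e, norm_mul, Real.norm_of_nonneg hε.le, pow_zero, mul_one]
    have h3 := h1 s hs
    rw [zero_add, pow_one] at h3
    calc _ ≤ S.ε * (4 * K ^ 4 * S.δ * S.L * s) := by gcongr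
      _ ≤ S.ε * (4 * K ^ 4 * S.δ * S.L * S.L) := by have := hs.2; gcongr
      _ = _ := by ring

/-- The increment of the velocity in the kick step of the splitting scheme. -/
noncomputable def kick (S : FastOrbit A₀ ρ K) (η : ℝ) (y w : V) : V :=
  NormedSpace.exp (η • S.D y) w + (S.ε * η) • phiOne (η • S.D y) (S.E y) - w

/-- Since `A φ₁(A) = e^A - 1`, the kick is a filtered multiple of the force evaluated at `(y, w)`,
which makes it comparable with `η F`. -/
theorem kick_eq (S : FastOrbit A₀ ρ K) (η : ℝ) (y w : V) :
    S.kick η y w = η • phiOne (η • S.D y) (S.D y w + S.ε • S.E y) := by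
  have h := congrArg (fun M : V →L[ℝ] V => M w)
    ((commute_phiOne (η • S.D y)).symm.trans (mul_phiOne (η • S.D y)))
  simp only [sub_apply, one_apply_eq_self] at h
  have h' : η • phiOne (η • S.D y) (S.D y w) = NormedSpace.exp (η • S.D y) w - w := by
    rw [← h, ← map_smul]; rfl
  rw [kick, map_add, smul_add, h', map_smul, smul_smul, mul_comm η]
  abel

theorem kick_error_arith {K ε κ d e η C : ℝ} (hK : 1 ≤ K) (hε : 0 ≤ ε) (hκ : 0 ≤ κ) (hκε : κ ≤ ε)
    (hκ1 : κ ≤ 1) (hd : 0 ≤ d) (he : 0 ≤ e) (hηK : η * K ≤ 1) (hC : 0 ≤ C) :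
    Real.exp 1 * (η * (K * κ)) ^ 2 * (3 * K ^ 2 * ε) +
      (K * κ * d * (2 * K) + K * κ * e + ε * (K * d) + K * κ * (C * ε * η * (η / 2)) +
        η / 2 * (K * κ * d * (3 * K ^ 2 * ε) + K * κ * (K * κ * d * (2 * K) + K * κ * e +
          K * κ * (C * ε * (η / 2)) + ε * (K * d)))) ≤
      (3 * Real.exp 1 * K ^ 4 + 20 * K ^ 2 + 2 * K ^ 2 * C) *
        (ε * d + κ * e + κ * ε * η ^ 2) := by
  have hK0 : 0 ≤ K := by linarith
  have hηκ : η * (K * κ) ≤ 1 := by nlinarith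
  have hKK : K ≤ K ^ 2 := by nlinarith
  have b0 : Real.exp 1 * (η * (K * κ)) ^ 2 * (3 * K ^ 2 * ε) ≤
      3 * Real.exp 1 * K ^ 4 * (κ * ε * η ^ 2) := by
    calc _ = 3 * Real.exp 1 * K ^ 4 * (κ * (κ * ε * η ^ 2)) := by ring
      _ ≤ 3 * Real.exp 1 * K ^ 4 * (1 * (κ * ε * η ^ 2)) := by gcongr
      _ = _ := by ring
  have b1 : K * κ * d * (2 * K) ≤ 2 * K ^ 2 * (ε * d) := by
    calc _ = 2 * K ^ 2 * (κ * d) := by ring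
      _ ≤ _ := by gcongr
  have b2 : K * κ * e ≤ K ^ 2 * (κ * e) := by
    rw [mul_assoc]; gcongr
  have b3 : ε * (K * d) ≤ K ^ 2 * (ε * d) := by
    calc _ = K * (ε * d) := by ring
      _ ≤ _ := by gcongr
  have b4 : K * κ * (C * ε * η * (η / 2)) ≤ K ^ 2 * C * (κ * ε * η ^ 2) := by
    calc _ = K / 2 * C * (κ * ε * η ^ 2) := by ring
      _ ≤ _ := by gcongr; linarith
  have c1 : η / 2 * (K * κ * d * (3 * K ^ 2 * ε)) ≤ 3 * K ^ 2 * (ε * d) := by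
    calc _ = (η * (K * κ)) / 2 * (3 * K ^ 2 * (ε * d)) := by ring
      _ ≤ 1 * (3 * K ^ 2 * (ε * d)) := by gcongr; linarith
      _ = _ := one_mul _
  have c2 : η / 2 * (K * κ * (K * κ * d * (2 * K) + K * κ * e + ε * (K * d))) ≤
      2 * K ^ 2 * (ε * d) + K ^ 2 * (κ * e) + K ^ 2 * (ε * d) := by
    calc _ = (η * (K * κ)) / 2 * (K * κ * d * (2 * K) + K * κ * e + ε * (K * d)) := by ring
      _ ≤ 1 * (2 * K ^ 2 * (ε * d) + K ^ 2 * (κ * e) + K ^ 2 * (ε * d)) := by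
        gcongr; linarith
      _ = _ := one_mul _
  have c3 : η / 2 * (K * κ * (K * κ * (C * ε * (η / 2)))) ≤ K ^ 2 * C * (κ * ε * η ^ 2) := by
    calc _ = κ / 4 * (K ^ 2 * C * (κ * ε * η ^ 2)) := by ring
      _ ≤ 1 * (K ^ 2 * C * (κ * ε * η ^ 2)) := by gcongr; linarith
      _ = _ := one_mul _
  have p1 : 0 ≤ (3 * Real.exp 1 * K ^ 4 + 2 * K ^ 2 * C) * (ε * d + κ * e) := by positivity
  have p2 : 0 ≤ K ^ 2 * (ε * d) := by positivity
  have p3 : 0 ≤ K ^ 2 * (κ * e) := by positivity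
  have p4 : 0 ≤ K ^ 2 * (κ * ε * η ^ 2) := by positivity
  linarith

/-- The velocity before the kick lags behind the true midpoint velocity by about `(η/2) F`, an error
of first order in `η` inside `D`. The term `(η/2) D` of `φ₁(η D)` compensates exactly this lag, and
`κ ε η²` is left besides the propagated errors `d` and `e`. -/
theorem exists_kick_error (A₀ : V →L[ℝ] V) (ρ : ℝ) {K : ℝ} (hK : 1 ≤ K) :
    ∃ C : ℝ, 0 ≤ C ∧ ∀ S : FastOrbit A₀ ρ K, 0 ≤ S.L → S.L * K ≤ 1 → ∀ (y w : V) (d e : ℝ),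
      ‖y‖ ≤ ρ → ‖w‖ ≤ 2 * K → ‖y - S.x (S.L / 2)‖ ≤ d →
      ‖w - NormedSpace.exp ((S.L / 2) • S.A) (S.u 0)‖ ≤ e →
      ‖S.kick S.L y w - S.L • S.F (S.L / 2)‖ ≤
        S.L * (C * (S.ε * d + S.κ * e + S.κ * S.ε * S.L ^ 2)) := by
  obtain ⟨C, hC, h⟩ := exists_velocity_expansion A₀ ρ hK
  refine ⟨3 * Real.exp 1 * K ^ 4 + 20 * K ^ 2 + 2 * K ^ 2 * C, by positivity,
    fun S hL0 hLK y w d e hy hw hd he => ?_⟩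
  have hε := S.ε_pos
  have hε1 := S.ε_le
  have hκ := S.κ_nonneg
  have hκε := S.κ_le
  have hK0 := S.K_pos
  set η := S.L with hη
  have hmid : η / 2 ∈ Set.Icc 0 S.L := ⟨by linarith, by linarith⟩
  have hηK : η ≤ K := by nlinarith
  have hd0 : 0 ≤ d := (norm_nonneg _).trans hd
  have he0 : 0 ≤ e := (norm_nonneg _).trans he
  obtain ⟨hu1, hu2⟩ := h S hηK _ hmid _ hmid
  set xm := S.x (η / 2) with hxm
  set um := S.u (η / 2) with hum
  set wm := NormedSpace.exp ((η / 2) • S.A) (S.u 0) with hwm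
  set Fm := S.F (η / 2) with hFm
  have hFm' : Fm = S.D xm um + S.ε • S.E xm := rfl
  have hxmρ : ‖xm‖ ≤ ρ := S.norm_x _ hmid
  set f := S.D y w + S.ε • S.E y with hf
  have hDy : ‖S.D y‖ ≤ K * S.κ := S.norm_D hy
  have hDm : ‖S.D xm‖ ≤ K * S.κ := S.norm_D hxmρ
  have hDd : ‖S.D y - S.D xm‖ ≤ K * S.κ * d := (S.hD.lipschitz hy hxmρ).trans (by gcongr)
  have hEd : ‖S.ε • (S.E y - S.E xm)‖ ≤ S.ε * (K * d) := by
    rw [norm_smul, Real.norm_of_nonneg hε.le]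
    gcongr
    exact (S.hE.lipschitz hy hxmρ).trans (by gcongr)
  have hηD : ‖η • S.D y‖ ≤ η * (K * S.κ) := by
    rw [norm_smul, Real.norm_of_nonneg hL0]; gcongr
  have hηκ : η * (K * S.κ) ≤ S.κ := by nlinarith
  have hnf : ‖f‖ ≤ 3 * K ^ 2 * S.ε := by
    have a1 := (S.D y).le_of_opNorm_le_of_le hDy hw
    have a2 : ‖S.ε • S.E y‖ ≤ S.ε * K := by
      rw [norm_smul, Real.norm_of_nonneg hε.le]
      exact mul_le_mul_of_nonneg_left (S.norm_E hy) hε.le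
    refine (norm_add_le_of_le a1 a2).trans ?_
    have a3 : K * S.κ * (2 * K) ≤ K * S.ε * (2 * K) := by gcongr
    have a4 : S.ε * K * 1 ≤ S.ε * K * K := by gcongr
    nlinarith
  have t1 : ‖(S.D y - S.D xm) w‖ ≤ K * S.κ * d * (2 * K) :=
    (S.D y - S.D xm).le_of_opNorm_le_of_le hDd hw
  have t2 : ‖S.D xm (w - wm)‖ ≤ K * S.κ * e := (S.D xm).le_of_opNorm_le_of_le hDm he
  have t3 : ‖S.D xm (um - wm)‖ ≤ K * S.κ * (C * S.ε * (η / 2)) :=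
    (S.D xm).le_of_opNorm_le_of_le hDm hu1
  have t4 : ‖S.D xm (um - wm - (η / 2) • Fm)‖ ≤ K * S.κ * (C * S.ε * η * (η / 2)) :=
    (S.D xm).le_of_opNorm_le_of_le hDm hu2
  have t5 : ‖(S.D y - S.D xm) f‖ ≤ K * S.κ * d * (3 * K ^ 2 * S.ε) :=
    (S.D y - S.D xm).le_of_opNorm_le_of_le hDd hnf
  have hfF : f - Fm = (S.D y - S.D xm) w + S.D xm (w - wm) - S.D xm (um - wm) +
      S.ε • (S.E y - S.E xm) := by
    rw [hf, hFm']; simp only [sub_apply, map_sub, smul_sub]; abel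
  have t6 : ‖f - Fm‖ ≤ K * S.κ * d * (2 * K) + K * S.κ * e + K * S.κ * (C * S.ε * (η / 2)) +
      S.ε * (K * d) := by
    rw [hfF]
    exact norm_add_le_of_le (norm_sub_le_of_le (norm_add_le_of_le t1 t2) t3) hEd
  have t7 : ‖S.D xm (f - Fm)‖ ≤ K * S.κ * (K * S.κ * d * (2 * K) + K * S.κ * e +
      K * S.κ * (C * S.ε * (η / 2)) + S.ε * (K * d)) := (S.D xm).le_of_opNorm_le_of_le hDm t6
  have hphi : ‖(phiOne (η • S.D y) - (1 + (2 : ℝ)⁻¹ • (η • S.D y))) f‖ ≤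
      Real.exp 1 * (η * (K * S.κ)) ^ 2 * (3 * K ^ 2 * S.ε) := by
    refine ContinuousLinearMap.le_of_opNorm_le_of_le _ ?_ hnf
    refine (norm_phiOne_sub_le _ (hηD.trans (hηκ.trans (hκε.trans hε1)))).trans ?_
    gcongr
  -- The cancellation is made explicit: `(η/2) D Fm` is moved from the `φ₁` term into the velocity
  -- lag `um - wm`.
  have main : S.kick η y w - η • Fm = η • ((phiOne (η • S.D y) - (1 + (2 : ℝ)⁻¹ • (η • S.D y))) f +
      ((S.D y - S.D xm) w + S.D xm (w - wm) + S.ε • (S.E y - S.E xm)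
        - S.D xm (um - wm - (η / 2) • Fm) +
        (η / 2) • ((S.D y - S.D xm) f + S.D xm (f - Fm)))) := by
    rw [kick_eq, ← hf, ← smul_sub]
    congr 1
    have e1 : (S.D y - S.D xm) w + S.D xm (w - wm) + S.ε • (S.E y - S.E xm) -
        S.D xm (um - wm) = f - Fm := by rw [hfF]; abel
    have e2 : (S.D y - S.D xm) w + S.D xm (w - wm) + S.ε • (S.E y - S.E xm)
        - S.D xm (um - wm - (η / 2) • Fm) = f - Fm + (η / 2) • S.D xm Fm := by
      rw [map_sub (S.D xm) (um - wm), map_smul, ← e1]; abel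
    rw [e2]
    simp only [sub_apply, add_apply, smul_apply, one_apply_eq_self, map_sub]
    module
  rw [main, norm_smul, Real.norm_of_nonneg hL0]
  refine mul_le_mul_of_nonneg_left ?_ hL0
  have t8 : ‖(η / 2) • ((S.D y - S.D xm) f + S.D xm (f - Fm))‖ ≤ η / 2 *
      (K * S.κ * d * (3 * K ^ 2 * S.ε) + K * S.κ * (K * S.κ * d * (2 * K) + K * S.κ * e +
      K * S.κ * (C * S.ε * (η / 2)) + S.ε * (K * d))) := by
    rw [norm_smul, Real.norm_of_nonneg hmid.1]
    exact mul_le_mul_of_nonneg_left (norm_add_le_of_le t5 t7) hmid.1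
  refine (norm_add_le_of_le hphi (norm_add_le_of_le (norm_sub_le_of_le (norm_add_le_of_le
    (norm_add_le_of_le t1 t2) hEd) t4) t8)).trans ?_
  exact kick_error_arith hK hε.le hκ hκε (hκε.trans hε1) hd0 he0 hLK hC

end FastOrbit

end LocalErrors

/-! ### Propagation of errors -/

section Propagation

set_option linter.unusedSectionVars false

variable {V : Type*} [NormedAddCommGroup V] [InnerProductSpace ℝ V] [CompleteSpace V]
  [Nontrivial V] {A₀ : V →L[ℝ] V} {ρ K : ℝ}

namespace FastOrbit

/-- The intermediate position in a step of the splitting scheme. -/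
noncomputable def midPos (S : FastOrbit A₀ ρ K) (η : ℝ) (p : V × V) : V :=
  p.1 + S.ε • flowInt S.A (η / 2) p.2

/-- The velocity before the kick in a step of the splitting scheme. -/
noncomputable def midVel (S : FastOrbit A₀ ρ K) (η : ℝ) (p : V × V) : V :=
  NormedSpace.exp ((η / 2) • S.A) p.2

/-- The kick in a step of the splitting scheme. -/
noncomputable def stepKick (S : FastOrbit A₀ ρ K) (η : ℝ) (p : V × V) : V :=
  S.kick η (S.midPos η p) (S.midVel η p)

/-- One step of the splitting scheme in fast time. -/
noncomputable def step (S : FastOrbit A₀ ρ K) (η : ℝ) (p : V × V) : V × V :=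
  (S.midPos η p + S.ε • flowInt S.A (η / 2) (S.midVel η p + S.stepKick η p),
    NormedSpace.exp ((η / 2) • S.A) (S.midVel η p + S.stepKick η p))

theorem step_fst (S : FastOrbit A₀ ρ K) (η : ℝ) (p : V × V) :
    (S.step η p).1 = p.1 + S.ε • flowInt S.A η p.2 +
      S.ε • flowInt S.A (η / 2) (S.stepKick η p) := by
  have h := flowInt_add_apply S.A (η / 2) (η / 2) p.2
  rw [add_halves] at h
  change p.1 + S.ε • flowInt S.A (η / 2) p.2 + S.ε • flowInt S.A (η / 2)
    (NormedSpace.exp ((η / 2) • S.A) p.2 + S.stepKick η p) = _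
  rw [map_add, ← h, smul_add, smul_add]
  abel

theorem step_snd (S : FastOrbit A₀ ρ K) (η : ℝ) (p : V × V) :
    (S.step η p).2 = NormedSpace.exp (η • S.A) p.2 +
      NormedSpace.exp ((η / 2) • S.A) (S.stepKick η p) := by
  have h := exp_add_smul S.A (η / 2) (η / 2)
  rw [add_halves] at h
  change NormedSpace.exp ((η / 2) • S.A) (S.midVel η p + S.stepKick η p) = _
  rw [midVel, map_add, h]; rfl

/-- The half-step position errs by the initial position error, `ε` times the velocity error, and `ε²
η²`. The first of these enters the kick with a factor `ε`, and the velocity error also enters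
through `κ`; collecting terms produces `δ`. -/
theorem exists_step_kick_error (A₀ : V →L[ℝ] V) (ρ : ℝ) {K : ℝ} (hK : 1 ≤ K) :
    ∃ C : ℝ, 0 ≤ C ∧ ∀ S : FastOrbit A₀ ρ K, 0 ≤ S.L → S.L * K ≤ 1 → ∀ p : V × V,
      ‖S.midPos S.L p‖ ≤ ρ → ‖p.2‖ ≤ 2 * K →
      ‖S.stepKick S.L p - S.L • S.F (S.L / 2)‖ ≤
        S.L * (C * (S.ε * ‖p.1 - S.x 0‖ + S.δ * ‖p.2 - S.u 0‖ + S.ε * S.δ * S.L ^ 2)) := by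
  obtain ⟨C₁, hC₁, h₁⟩ := exists_kick_error A₀ ρ hK
  obtain ⟨C₂, hC₂, h₂⟩ := exists_position_expansion A₀ ρ hK
  refine ⟨C₁ * (2 + C₂), by positivity, fun S hL0 hLK p hy hp => ?_⟩
  have hε := S.ε_pos
  have hε1 := S.ε_le
  have hκ := S.κ_nonneg
  have hLK' : S.L ≤ K := by nlinarith
  have hL1 : S.L ≤ 1 := by nlinarith
  have hmid : S.L / 2 ∈ Set.Icc 0 S.L := ⟨by linarith, by linarith⟩
  have hd : ‖S.midPos S.L p - S.x (S.L / 2)‖ ≤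
      ‖p.1 - S.x 0‖ + S.ε * ‖p.2 - S.u 0‖ + C₂ * S.ε ^ 2 * S.L ^ 2 := by
    have e : S.midPos S.L p - S.x (S.L / 2) = (p.1 - S.x 0) +
        S.ε • flowInt S.A (S.L / 2) (p.2 - S.u 0) -
        (S.x (S.L / 2) - S.x 0 - S.ε • flowInt S.A (S.L / 2) (S.u 0)) := by
      rw [midPos, map_sub, smul_sub]; abel
    rw [e]
    have a1 : ‖S.ε • flowInt S.A (S.L / 2) (p.2 - S.u 0)‖ ≤ S.ε * ‖p.2 - S.u 0‖ := by
      rw [norm_smul, Real.norm_of_nonneg hε.le]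
      gcongr
      refine (norm_flowInt_apply_le S.skew hmid.1 _).trans ?_
      exact mul_le_of_le_one_left (norm_nonneg _) (by linarith)
    have a2 := (h₂ S hLK' _ hmid _ hmid).1
    refine norm_sub_le_of_le (norm_add_le_of_le le_rfl a1) (a2.trans ?_)
    have : 0 ≤ C₂ * S.ε ^ 2 * S.L ^ 2 := by positivity
    nlinarith
  have he : ‖S.midVel S.L p - NormedSpace.exp ((S.L / 2) • S.A) (S.u 0)‖ ≤ ‖p.2 - S.u 0‖ := by
    rw [midVel, ← map_sub, norm_exp_smul_apply S.skew]
  have hw : ‖S.midVel S.L p‖ ≤ 2 * K := by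
    rw [midVel, norm_exp_smul_apply S.skew]; exact hp
  refine (h₁ S hL0 hLK _ _ _ _ hy hw hd he).trans ?_
  refine mul_le_mul_of_nonneg_left ?_ hL0
  rw [mul_assoc C₁ (2 + C₂)]
  refine mul_le_mul_of_nonneg_left ?_ hC₁
  unfold δ
  have p1 := norm_nonneg (p.1 - S.x 0)
  have p2 := norm_nonneg (p.2 - S.u 0)
  have q1 : 0 ≤ S.ε * ‖p.1 - S.x 0‖ := by positivity
  have q2 : 0 ≤ (S.ε ^ 2 + S.κ) * ‖p.2 - S.u 0‖ := by positivity
  have q3 : 0 ≤ S.ε ^ 3 * S.L ^ 2 := by positivity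
  have q4 : 0 ≤ S.κ * S.ε * S.L ^ 2 := by positivity
  have q5 := mul_nonneg hC₂ q1
  have q6 := mul_nonneg hC₂ q2
  have q7 := mul_nonneg hC₂ q4
  calc _ = S.ε * ‖p.1 - S.x 0‖ + (S.ε ^ 2 + S.κ) * ‖p.2 - S.u 0‖ + C₂ * (S.ε ^ 3 * S.L ^ 2) +
        S.κ * S.ε * S.L ^ 2 := by ring
    _ ≤ 2 * (S.ε * ‖p.1 - S.x 0‖) + 2 * ((S.ε ^ 2 + S.κ) * ‖p.2 - S.u 0‖) +
        (2 + C₂) * (S.ε ^ 3 * S.L ^ 2) + 2 * (S.κ * S.ε * S.L ^ 2) + C₂ * (S.ε * ‖p.1 - S.x 0‖) +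
        C₂ * ((S.ε ^ 2 + S.κ) * ‖p.2 - S.u 0‖) + C₂ * (S.κ * S.ε * S.L ^ 2) := by linarith
    _ = _ := by ring

/-- A kick `η F` acting during half a step displaces by `ε (η²/2) F` to leading order, which matches
the second-order term of the exact solution. -/
theorem exists_step_position_error (A₀ : V →L[ℝ] V) (ρ : ℝ) {K : ℝ} (hK : 1 ≤ K) :
    ∃ C : ℝ, 0 ≤ C ∧ ∀ S : FastOrbit A₀ ρ K, 0 ≤ S.L → S.L * K ≤ 1 → ∀ p : V × V,
      ‖(S.step S.L p).1 - S.x S.L‖ ≤ ‖p.1 - S.x 0‖ + S.ε * S.L * ‖p.2 - S.u 0‖ +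
        S.ε * S.L * ‖S.stepKick S.L p - S.L • S.F (S.L / 2)‖ + C * S.ε ^ 2 * S.L ^ 3 := by
  obtain ⟨C₂, hC₂, h₂⟩ := exists_position_expansion A₀ ρ hK
  refine ⟨2 * K ^ 3 + C₂, by positivity, fun S hL0 hLK p => ?_⟩
  have hε := S.ε_pos
  have hK0 := S.K_pos
  have hLK' : S.L ≤ K := by nlinarith
  have hmid : S.L / 2 ∈ Set.Icc 0 S.L := ⟨by linarith, by linarith⟩
  have hend : S.L ∈ Set.Icc 0 S.L := ⟨hL0, le_rfl⟩
  set r := S.stepKick S.L p - S.L • S.F (S.L / 2) with hr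
  have hkick : S.stepKick S.L p = S.L • S.F (S.L / 2) + r := by rw [hr]; abel
  have e : (S.step S.L p).1 - S.x S.L = (p.1 - S.x 0) + S.ε • flowInt S.A S.L (p.2 - S.u 0) +
      S.ε • flowInt S.A (S.L / 2) r +
      (S.ε * S.L) • (flowInt S.A (S.L / 2) (S.F (S.L / 2)) - (S.L / 2) • S.F (S.L / 2)) -
      (S.x S.L - S.x 0 - S.ε • flowInt S.A S.L (S.u 0) -
        (S.ε * (S.L ^ 2 / 2)) • S.F (S.L / 2)) := by
    rw [step_fst, hkick]
    simp only [map_sub, map_add, map_smul]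
    module
  have a1 : ‖S.ε • flowInt S.A S.L (p.2 - S.u 0)‖ ≤ S.ε * S.L * ‖p.2 - S.u 0‖ := by
    rw [norm_smul, Real.norm_of_nonneg hε.le, mul_assoc]
    gcongr
    exact norm_flowInt_apply_le S.skew hL0 _
  have a2 : ‖S.ε • flowInt S.A (S.L / 2) r‖ ≤ S.ε * S.L * ‖r‖ := by
    rw [norm_smul, Real.norm_of_nonneg hε.le, mul_assoc]
    gcongr
    refine (norm_flowInt_apply_le S.skew hmid.1 _).trans ?_
    gcongr
    linarith
  have a3 : ‖(S.ε * S.L) • (flowInt S.A (S.L / 2) (S.F (S.L / 2)) - (S.L / 2) • S.F (S.L / 2))‖ ≤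
      2 * K ^ 3 * S.ε ^ 2 * S.L ^ 3 := by
    rw [norm_smul, Real.norm_of_nonneg (by positivity)]
    calc _ ≤ S.ε * S.L * (K * (2 * K ^ 2 * S.ε) * S.L ^ 2) := by
          gcongr
          refine (norm_flowInt_sub_le S.skew S.norm_A hmid.1 _).trans ?_
          have := S.norm_F hmid
          have := hmid.2
          have := hmid.1
          gcongr
      _ = _ := by ring
  have a4 := (h₂ S hLK' _ hmid _ hend).2
  rw [e]
  refine (norm_sub_le_of_le (norm_add_le_of_le (norm_add_le_of_le (norm_add_le_of_le le_rfl a1) a2)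
    a3) a4).trans (le_of_eq ?_)
  ring

theorem inner_step_position_error (S : FastOrbit A₀ ρ K) (hL0 : 0 ≤ S.L) {b : V} (hbK : ‖b‖ ≤ K)
    (hb : ∀ v, inner ℝ b (S.A v) = 0) (p : V × V) :
    |inner ℝ b ((S.step S.L p).1 - S.x S.L)| ≤ |inner ℝ b (p.1 - S.x 0)| +
      S.ε * S.L * |inner ℝ b (p.2 - S.u 0)| +
        S.ε * S.L * (K * ‖S.stepKick S.L p - S.L • S.F (S.L / 2)‖) +
        4 * K ^ 4 * (S.ε * S.δ) * S.L ^ 3 := by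
  have hε := S.ε_pos
  have hmid : S.L / 2 ∈ Set.Icc 0 S.L := ⟨by linarith, by linarith⟩
  have hend : S.L ∈ Set.Icc 0 S.L := ⟨hL0, le_rfl⟩
  set r := S.stepKick S.L p - S.L • S.F (S.L / 2) with hr
  have hkick : S.stepKick S.L p = S.L • S.F (S.L / 2) + r := by rw [hr]; abel
  have e : inner ℝ b ((S.step S.L p).1 - S.x S.L) = inner ℝ b (p.1 - S.x 0) +
      S.ε * S.L * inner ℝ b (p.2 - S.u 0) + S.ε * (S.L / 2) * inner ℝ b r -
      inner ℝ b (S.x S.L - S.x 0 - (S.ε * S.L) • S.u 0 -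
        (S.ε * (S.L ^ 2 / 2)) • S.F (S.L / 2)) := by
    rw [step_fst, hkick]
    simp only [map_add, map_smul, inner_sub_right, inner_add_right, inner_smul_right,
      inner_axis_flowInt hb]
    ring
  have a1 := S.inner_position_expansion hbK hb hmid hend
  have a2 : |inner ℝ b r| ≤ K * ‖r‖ :=
    (abs_real_inner_le_norm b r).trans (by gcongr)
  have a3 : |S.ε * S.L * inner ℝ b (p.2 - S.u 0)| = S.ε * S.L * |inner ℝ b (p.2 - S.u 0)| := by
    rw [abs_mul, abs_of_nonneg (by positivity)]
  have a4 : |S.ε * (S.L / 2) * inner ℝ b r| ≤ S.ε * S.L * (K * ‖r‖) := by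
    rw [abs_mul, abs_of_nonneg (by positivity)]
    have := S.K_pos
    gcongr
    linarith
  rw [e]
  refine (abs_sub _ _).trans ?_
  have b1 := abs_add_le (inner ℝ b (p.1 - S.x 0) + S.ε * S.L * inner ℝ b (p.2 - S.u 0))
    (S.ε * (S.L / 2) * inner ℝ b r)
  have b2 := abs_add_le (inner ℝ b (p.1 - S.x 0)) (S.ε * S.L * inner ℝ b (p.2 - S.u 0))
  have a1' : 4 * K ^ 4 * (S.ε * S.δ) * S.L ^ 2 * S.L = 4 * K ^ 4 * (S.ε * S.δ) * S.L ^ 3 := by ring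
  linarith

theorem continuousOn_F (S : FastOrbit A₀ ρ K) : ContinuousOn S.F (Set.Icc 0 S.L) := by
  have hK := S.K_pos
  have hδ := S.δ_nonneg
  exact LipschitzOnWith.continuousOn (K := ⟨4 * K ^ 3 * S.δ, by positivity⟩)
    (LipschitzOnWith.of_dist_le_mul fun t ht r hr => by
      rw [dist_eq_norm, Real.dist_eq]
      exact S.lip_F ht hr)

end FastOrbit

theorem integral_eq_sub_of_within {g g' : ℝ → V} {L a b : ℝ} (hab : a ≤ b) (ha : 0 ≤ a)
    (hb : b ≤ L) (h : ∀ t ∈ Set.Icc 0 L, HasDerivWithinAt g (g' t) (Set.Icc 0 L) t)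
    (hc : ContinuousOn g' (Set.Icc 0 L)) : ∫ s in a..b, g' s = g b - g a := by
  have hsub : Set.Icc a b ⊆ Set.Icc 0 L := Set.Icc_subset_Icc ha hb
  refine intervalIntegral.integral_eq_sub_of_hasDerivAt_of_le hab
    (fun t ht => ((h t (hsub ht)).mono hsub).continuousWithinAt) (fun t ht => ?_) ?_
  · exact (h t (hsub ⟨ht.1.le, ht.2.le⟩)).hasDerivAt
      (Icc_mem_nhds (by linarith [ht.1]) (by linarith [ht.2]))
  · apply ContinuousOn.intervalIntegrable
    rw [Set.uIcc_of_le hab]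
    exact hc.mono hsub

namespace FastOrbit

/-- The splitting scheme in fast time. -/
noncomputable def seq (S : FastOrbit A₀ ρ K) (η : ℝ) : ℕ → V × V
  | 0 => (S.x 0, S.u 0)
  | n + 1 => S.step η (seq S η n)

/-- The deviation of the `n`-th kick from the midpoint value of the force. -/
noncomputable def res (S : FastOrbit A₀ ρ K) (η : ℝ) (n : ℕ) : V :=
  S.stepKick η (S.seq η n) - η • S.F (n * η + η / 2)

theorem cell_bounds {η L : ℝ} (hη : 0 ≤ η) {n : ℕ} (hn : (n + 1 : ℕ) * η ≤ L) :
    (0 : ℝ) ≤ n * η ∧ (n : ℝ) * η ≤ (n + 1 : ℕ) * η ∧ (n : ℝ) * η ≤ L := by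
  push_cast at hn ⊢
  exact ⟨by positivity, by nlinarith, by nlinarith⟩

/-- Rotated back, the exact velocity has derivative `e^{-sA} F`, while the scheme adds `e^{-sA}`
times the kick at the midpoint of each cell. Nothing but residuals and quadrature distinguishes the
two. -/
theorem velocity_error_eq (S : FastOrbit A₀ ρ K) {η : ℝ} (hη : 0 ≤ η) (n : ℕ)
    (hn : n * η ≤ S.L) :
    NormedSpace.exp ((-(n * η)) • S.A) ((S.seq η n).2 - S.u (n * η)) =
      ∑ j ∈ Finset.range n, NormedSpace.exp ((-(j * η + η / 2)) • S.A) (S.res η j) -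
        midErr (fun s => NormedSpace.exp ((-s) • S.A) (S.F s)) η 0 n := by
  induction n with
  | zero => simp [seq, midErr]
  | succ n ih =>
    obtain ⟨h0, h1, h2⟩ := cell_bounds hη hn
    have hint := integral_eq_sub_of_within (g := fun s => NormedSpace.exp ((-s) • S.A) (S.u s))
      (g' := fun s => NormedSpace.exp ((-s) • S.A) (S.F s)) h1 h0 hn (fun t ht => by
        refine ((hasDerivAt_exp_neg_smul S.A t).hasDerivWithinAt.clm_apply
          (S.deriv_u t ht)).congr_deriv ?_
        rw [commute_exp_smul, map_add]
        simp only [neg_apply, F]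
        rw [show (NormedSpace.exp ((-t) • S.A) * S.A) (S.u t) =
          NormedSpace.exp ((-t) • S.A) (S.A (S.u t)) from rfl]
        abel)
      (ContinuousOn.clm_apply (c11_exp_neg S.norm_A S.skew (convex_Icc _ _)).continuousOn
        S.continuousOn_F)
    have hk : S.stepKick η (S.seq η n) = S.res η n + η • S.F (n * η + η / 2) := by
      rw [res]; abel
    have e1 : NormedSpace.exp ((-((n + 1 : ℕ) * η)) • S.A) (S.seq η (n + 1)).2 =
        NormedSpace.exp ((-(n * η)) • S.A) (S.seq η n).2 +
          NormedSpace.exp ((-(n * η + η / 2)) • S.A) (S.stepKick η (S.seq η n)) := by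
      rw [seq, step_snd, map_add]
      congr 1
      · rw [show (-(n * η) : ℝ) = -((n + 1 : ℕ) * η) + η by push_cast; ring, exp_add_smul]; rfl
      · rw [show (-(n * η + η / 2) : ℝ) = -((n + 1 : ℕ) * η) + η / 2 by push_cast; ring,
          exp_add_smul]; rfl
    rw [Finset.sum_range_succ, midErr_succ, zero_add, zero_add]
    have hint' : ∫ s in (n * η)..((n + 1) * η), NormedSpace.exp ((-s) • S.A) (S.F s) =
        NormedSpace.exp ((-((n + 1 : ℕ) * η)) • S.A) (S.u ((n + 1 : ℕ) * η)) -
          NormedSpace.exp ((-(n * η)) • S.A) (S.u (n * η)) := by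
      rw [← hint]; push_cast; rfl
    rw [hint', map_sub, e1, hk, map_add, map_smul]
    have ih' := ih h2
    rw [map_sub, sub_eq_iff_eq_add] at ih'
    rw [ih']
    abel

theorem inner_velocity_error_eq (S : FastOrbit A₀ ρ K) {η : ℝ} (hη : 0 ≤ η) {b : V}
    (hb : ∀ v, inner ℝ b (S.A v) = 0) (n : ℕ) (hn : n * η ≤ S.L) :
    inner ℝ b ((S.seq η n).2 - S.u (n * η)) =
      inner ℝ b (∑ j ∈ Finset.range n, S.res η j - midErr S.F η 0 n) := by
  induction n with
  | zero => simp [seq, midErr]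
  | succ n ih =>
    obtain ⟨h0, h1, h2⟩ := cell_bounds hη hn
    have hint := integral_eq_sub_of_within (V := ℝ) (g := fun s => inner ℝ b (S.u s))
      (g' := fun s => inner ℝ b (S.F s)) h1 h0 hn (fun t ht => by
        refine ((hasDerivWithinAt_const t _ b).inner ℝ (S.deriv_u t ht)).congr_deriv ?_
        rw [inner_add_right, hb]
        simp [F])
      (ContinuousOn.inner continuousOn_const S.continuousOn_F)
    have hII : IntervalIntegrable S.F MeasureTheory.volume (n * η) ((n + 1 : ℕ) * η) := by
      apply ContinuousOn.intervalIntegrable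
      rw [Set.uIcc_of_le h1]
      exact S.continuousOn_F.mono (Set.Icc_subset_Icc h0 hn)
    have hint' : inner ℝ b (∫ s in (n * η)..((n + 1) * η), S.F s) =
        inner ℝ b (S.u ((n + 1 : ℕ) * η)) - inner ℝ b (S.u (n * η)) := by
      rw [← hint, ← innerSL_apply_apply ℝ, show ((n : ℝ) + 1) = ((n + 1 : ℕ) : ℝ) by push_cast; rfl,
        ← (innerSL ℝ b).intervalIntegral_comp_comm hII]
      rfl
    have hk : S.stepKick η (S.seq η n) = S.res η n + η • S.F (n * η + η / 2) := by
      rw [res]; abel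
    have ih' := ih h2
    rw [Finset.sum_range_succ, midErr_succ, zero_add, zero_add, seq, step_snd, hk]
    simp only [inner_sub_right, inner_add_right, inner_axis_exp hb] at ih' ⊢
    rw [hint']
    linarith

/-- The quantity `ε u - A x` has derivative `ε F` along the flow. Because `A ∫₀ᵗ e^{sA} ds = e^{tA}
- 1`, the scheme changes it by exactly `ε` times the kick. Transverse position errors thus
accumulate without any rotating terms. -/
theorem apply_position_error_eq (S : FastOrbit A₀ ρ K) {η : ℝ} (hη : 0 ≤ η) (n : ℕ)
    (hn : n * η ≤ S.L) :
    S.A ((S.seq η n).1 - S.x (n * η)) - S.ε • ((S.seq η n).2 - S.u (n * η)) =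
      -(S.ε • (∑ j ∈ Finset.range n, S.res η j - midErr S.F η 0 n)) := by
  induction n with
  | zero => simp [seq, midErr]
  | succ n ih =>
    obtain ⟨h0, h1, h2⟩ := cell_bounds hη hn
    have hint := integral_eq_sub_of_within (g := fun s => S.ε • S.u s - S.A (S.x s))
      (g' := fun s => S.ε • S.F s) h1 h0 hn (fun t ht => by
        refine (((S.deriv_u t ht).const_smul S.ε).sub
          (S.A.hasFDerivAt.comp_hasDerivWithinAt t (S.deriv_x t ht))).congr_deriv ?_
        rw [map_smul, F, smul_add]; abel)
      (S.continuousOn_F.const_smul S.ε)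
    have hint' : S.ε • (∫ s in (n * η)..((n + 1) * η), S.F s) =
        S.ε • S.u ((n + 1 : ℕ) * η) - S.A (S.x ((n + 1 : ℕ) * η)) -
          (S.ε • S.u (n * η) - S.A (S.x (n * η))) := by
      rw [← hint, intervalIntegral.integral_smul]; push_cast; rfl
    have hk : S.stepKick η (S.seq η n) = S.res η n + η • S.F (n * η + η / 2) := by
      rw [res]; abel
    have e1 : S.A (S.seq η (n + 1)).1 - S.ε • (S.seq η (n + 1)).2 =
        S.A (S.seq η n).1 - S.ε • (S.seq η n).2 - S.ε • S.stepKick η (S.seq η n) := by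
      rw [seq, step_fst, step_snd, map_add, map_add, map_smul, map_smul, apply_flowInt,
        apply_flowInt]
      module
    have ih' := ih h2
    rw [Finset.sum_range_succ, midErr_succ, zero_add, zero_add]
    rw [map_sub] at ih' ⊢
    have e2 : S.A (S.seq η (n + 1)).1 - S.A (S.x ((n + 1 : ℕ) * η)) -
        S.ε • ((S.seq η (n + 1)).2 - S.u ((n + 1 : ℕ) * η)) =
        (S.A (S.seq η n).1 - S.A (S.x (n * η)) - S.ε • ((S.seq η n).2 - S.u (n * η))) -
        S.ε • S.stepKick η (S.seq η n) + S.ε • (∫ s in (n * η)..((n + 1) * η), S.F s) := by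
      rw [hint', smul_sub, smul_sub]
      have := e1
      rw [sub_eq_iff_eq_add] at this
      rw [this]
      abel
    rw [e2, ih', hk]
    module

end FastOrbit

end Propagation

/-! ### Global error bounds -/

section GlobalErrors

set_option linter.unusedSectionVars false

/-- The discrete Grönwall inequality in summed form. -/
theorem le_mul_exp_of_le_sum {s : ℕ → ℝ} {a c : ℝ} (ha : 0 ≤ a) (hc : 0 ≤ c) {n : ℕ}
    (h : ∀ m ≤ n, s m ≤ c + a * ∑ j ∈ Finset.range m, s j) : s n ≤ c * Real.exp (a * n) := by
  have h1 : ∀ m ≤ n, c + a * ∑ j ∈ Finset.range m, s j ≤ c * (1 + a) ^ m := by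
    intro m
    induction m with
    | zero => intro _; simp
    | succ m ih =>
      intro hm
      have i1 := ih (by omega)
      have i2 := h m (by omega)
      rw [Finset.sum_range_succ, pow_succ]
      nlinarith
  refine (h n le_rfl).trans ((h1 n le_rfl).trans ?_)
  gcongr
  rw [mul_comm, Real.exp_nat_mul]
  gcongr
  linarith [Real.add_one_le_exp a]

variable {V : Type*} [NormedAddCommGroup V] [InnerProductSpace ℝ V] [CompleteSpace V]
  [Nontrivial V] {A₀ : V →L[ℝ] V} {ρ K : ℝ}

namespace FastOrbit

/-- The position error of the splitting scheme. -/
noncomputable def errX (S : FastOrbit A₀ ρ K) (η : ℝ) (n : ℕ) : V :=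
  (S.seq η n).1 - S.x (n * η)

/-- The velocity error of the splitting scheme. -/
noncomputable def errV (S : FastOrbit A₀ ρ K) (η : ℝ) (n : ℕ) : V :=
  (S.seq η n).2 - S.u (n * η)

/-- The margin two in `ρ` covers a position error of at most one and a half-step displacement of at
most one, so the kick is evaluated where the fields are controlled. -/
theorem exists_res_le (A₀ : V →L[ℝ] V) (ρ : ℝ) {K : ℝ} (hK : 1 ≤ K) :
    ∃ C : ℝ, 0 ≤ C ∧ ∀ (S : FastOrbit A₀ ρ K) (η : ℝ) (n : ℕ), 0 ≤ η → η * K ≤ 1 →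
      (∀ t ∈ Set.Icc 0 S.L, ‖S.x t‖ + 2 ≤ ρ) → (n + 1 : ℕ) * η ≤ S.L →
      ‖S.errX η n‖ + ‖S.errV η n‖ ≤ 1 →
      ‖S.res η n‖ ≤
        η * (C * (S.ε * ‖S.errX η n‖ + S.δ * ‖S.errV η n‖ + S.ε * S.δ * η ^ 2)) := by
  obtain ⟨C, hC, h⟩ := exists_step_kick_error A₀ ρ hK
  refine ⟨C, hC, fun S η n hη hηK hρ hn herr => ?_⟩
  obtain ⟨h0, h1, h2⟩ := cell_bounds hη hn
  have hε := S.ε_pos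
  have hε1 := S.ε_le
  have hw : n * η + η ≤ S.L := by push_cast at hn; linarith
  have hmem : (n : ℝ) * η ∈ Set.Icc 0 S.L := ⟨h0, h2⟩
  have hX : ‖(S.seq η n).1‖ ≤ ‖S.x (n * η)‖ + ‖S.errX η n‖ := by
    have := norm_add_le (S.x (n * η)) (S.errX η n)
    rwa [errX, add_sub_cancel] at this
  have hV : ‖(S.seq η n).2‖ ≤ ‖S.u (n * η)‖ + ‖S.errV η n‖ := by
    have := norm_add_le (S.u (n * η)) (S.errV η n)
    rwa [errV, add_sub_cancel] at this
  have hu := S.norm_u _ hmem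
  have hV2 : ‖(S.seq η n).2‖ ≤ 2 * K := by linarith [norm_nonneg (S.errX η n)]
  have hmid : ‖S.midPos η (S.seq η n)‖ ≤ ρ := by
    have a1 : ‖S.ε • flowInt S.A (η / 2) (S.seq η n).2‖ ≤ 1 := by
      rw [norm_smul, Real.norm_of_nonneg hε.le]
      have a2 := norm_flowInt_apply_le S.skew (by linarith : 0 ≤ η / 2) (S.seq η n).2
      have a3 : η / 2 * ‖(S.seq η n).2‖ ≤ η / 2 * (2 * K) := by gcongr
      exact mul_le_one₀ hε1 (norm_nonneg _) (by linarith)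
    have := norm_add_le_of_le hX a1
    rw [midPos]
    linarith [hρ _ hmem, norm_nonneg (S.errV η n)]
  have hmain := h (S.window (n * η) η h0 hw) hη hηK (S.seq η n) hmid hV2
  change ‖S.stepKick η (S.seq η n) - η • S.F (n * η + η / 2)‖ ≤ η * (C * (S.ε *
    ‖(S.seq η n).1 - S.x (n * η + 0)‖ + S.δ * ‖(S.seq η n).2 - S.u (n * η + 0)‖ +
    S.ε * S.δ * η ^ 2)) at hmain
  rwa [add_zero] at hmain

theorem exists_errX_succ_le (A₀ : V →L[ℝ] V) (ρ : ℝ) {K : ℝ} (hK : 1 ≤ K) :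
    ∃ C : ℝ, 0 ≤ C ∧ ∀ (S : FastOrbit A₀ ρ K) (η : ℝ) (n : ℕ), 0 ≤ η → η * K ≤ 1 →
      (n + 1 : ℕ) * η ≤ S.L →
      ‖S.errX η (n + 1)‖ ≤ ‖S.errX η n‖ + S.ε * η * ‖S.errV η n‖ + S.ε * η * ‖S.res η n‖ +
        C * S.ε ^ 2 * η ^ 3 := by
  obtain ⟨C, hC, h⟩ := exists_step_position_error A₀ ρ hK
  refine ⟨C, hC, fun S η n hη hηK hn => ?_⟩
  obtain ⟨h0, h1, h2⟩ := cell_bounds hη hn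
  have e : (n : ℝ) * η + η = (n + 1 : ℕ) * η := by push_cast; ring
  have hmain := h (S.window (n * η) η h0 (e.trans_le hn)) hη hηK (S.seq η n)
  change ‖(S.seq η (n + 1)).1 - S.x (n * η + η)‖ ≤ ‖(S.seq η n).1 - S.x (n * η + 0)‖ +
    S.ε * η * ‖(S.seq η n).2 - S.u (n * η + 0)‖ + S.ε * η * ‖S.res η n‖ + C * S.ε ^ 2 * η ^ 3
    at hmain
  rwa [add_zero, e] at hmain

theorem inner_errX_succ_le (S : FastOrbit A₀ ρ K) {η : ℝ} {n : ℕ} (hη : 0 ≤ η) {b : V}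
    (hbK : ‖b‖ ≤ K) (hb : ∀ v, inner ℝ b (S.A v) = 0) (hn : (n + 1 : ℕ) * η ≤ S.L) :
    |inner ℝ b (S.errX η (n + 1))| ≤ |inner ℝ b (S.errX η n)| +
      S.ε * η * |inner ℝ b (S.errV η n)| + S.ε * η * (K * ‖S.res η n‖) +
        4 * K ^ 4 * (S.ε * S.δ) * η ^ 3 := by
  obtain ⟨h0, h1, h2⟩ := cell_bounds hη hn
  have e : (n : ℝ) * η + η = (n + 1 : ℕ) * η := by push_cast; ring
  have hmain := inner_step_position_error (S.window (n * η) η h0 (e.trans_le hn)) hη hbK hb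
    (S.seq η n)
  change |inner ℝ b ((S.seq η (n + 1)).1 - S.x (n * η + η))| ≤
    |inner ℝ b ((S.seq η n).1 - S.x (n * η + 0))| +
    S.ε * η * |inner ℝ b ((S.seq η n).2 - S.u (n * η + 0))| + S.ε * η * (K * ‖S.res η n‖) +
    4 * K ^ 4 * (S.ε * S.δ) * η ^ 3 at hmain
  rwa [add_zero, e] at hmain

theorem le_sum_of_succ_le {f g : ℕ → ℝ} {n : ℕ} (h0 : f 0 ≤ 0)
    (h : ∀ j < n, f (j + 1) ≤ f j + g j) : f n ≤ ∑ j ∈ Finset.range n, g j := by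
  have : ∀ m ≤ n, f m ≤ ∑ j ∈ Finset.range m, g j := by
    intro m
    induction m with
    | zero => intro _; simpa using h0
    | succ m ih =>
      intro hm
      rw [Finset.sum_range_succ]
      linarith [ih (by omega), h m (by omega)]
  exact this n le_rfl

theorem cast_mul_le_of_le {η L : ℝ} (hη : 0 ≤ η) {m n : ℕ} (hmn : m ≤ n) (hn : n * η ≤ L) :
    m * η ≤ L := by
  refine le_trans ?_ hn
  gcongr

theorem errX_zero (S : FastOrbit A₀ ρ K) (η : ℝ) : S.errX η 0 = 0 := by simp [errX, seq]

theorem norm_errV_le (S : FastOrbit A₀ ρ K) {η : ℝ} (hη : 0 ≤ η) {n : ℕ} (hn : n * η ≤ S.L) :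
    ‖S.errV η n‖ ≤ ∑ j ∈ Finset.range n, ‖S.res η j‖ +
      ‖midErr (fun s => NormedSpace.exp ((-s) • S.A) (S.F s)) η 0 n‖ := by
  rw [errV, ← norm_exp_smul_apply S.skew (-(n * η)), S.velocity_error_eq hη n hn]
  refine norm_sub_le_of_le (norm_sum_le_of_le _ fun j _ => ?_) le_rfl
  rw [norm_exp_smul_apply S.skew]

/-- The uniform bound `O(ε η²)` for positions and velocities. -/
theorem exists_weak_bound (A₀ : V →L[ℝ] V) (ρ : ℝ) {K ω : ℝ} (hK : 1 ≤ K) (hω : ω ≠ 0)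
    (hA₀ : A₀ * (A₀ * A₀) = -(ω ^ 2) • A₀) :
    ∃ C : ℝ, 0 ≤ C ∧ ∀ (S : FastOrbit A₀ ρ K) (η : ℝ) (N : ℕ), 0 ≤ η → 3 ≤ N →
      ω * (N * η) = 2 * Real.pi → N * η ≤ K → η * K ≤ 1 → C * η ^ 2 ≤ 1 →
      (∀ t ∈ Set.Icc 0 S.L, ‖S.x t‖ + 2 ≤ ρ) → ∀ n : ℕ, n * η ≤ S.L →
      ‖S.errX η n‖ + ‖S.errV η n‖ ≤ C * (S.ε * η ^ 2) := by
  obtain ⟨C₁, hC₁, h₁⟩ := exists_res_le A₀ ρ hK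
  obtain ⟨C₂, hC₂, h₂⟩ := exists_errX_succ_le A₀ ρ hK
  obtain ⟨C₃, hC₃, h₃⟩ := exists_midErr_exp_force A₀ ρ hK hω hA₀
  refine ⟨(K * (4 * C₁ + C₂) + C₃) * Real.exp ((1 + 4 * C₁) * K), by positivity,
    fun S η N hη hN hper hNK hηK hsmall hρ => ?_⟩
  have hε := S.ε_pos
  have hε1 := S.ε_le
  have hδ := S.δ_le
  have hδ0 := S.δ_nonneg
  have hη1 : η ≤ 1 := by nlinarith
  have hεη : S.ε * η ≤ 1 := by nlinarith
  intro n
  -- A bootstrap: the bound at earlier steps and the smallness of `η` keep the errors below one, as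
  -- the residual estimate requires.
  induction n using Nat.strong_induction_on with
  | _ n ih =>
    intro hn
    have hnK : S.ε * η * n ≤ K := by
      calc S.ε * η * n = S.ε * (n * η) := by ring
        _ ≤ S.ε * S.L := by gcongr
        _ ≤ K := S.εL_le
    have hle1 : ∀ j < n, ‖S.errX η j‖ + ‖S.errV η j‖ ≤ 1 := fun j hj => by
      refine (ih j hj (cast_mul_le_of_le hη hj.le hn)).trans (le_trans ?_ hsmall)
      gcongr
      exact mul_le_of_le_one_left (sq_nonneg _) hε1
    have hres : ∀ j < n, ‖S.res η j‖ ≤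
        2 * C₁ * (S.ε * η) * (‖S.errX η j‖ + ‖S.errV η j‖) + 2 * C₁ * (S.ε ^ 2 * η ^ 3) :=
      fun j hj => by
      refine (h₁ S η j hη hηK hρ (cast_mul_le_of_le hη hj hn) (hle1 j hj)).trans ?_
      have a1 : S.δ * ‖S.errV η j‖ ≤ 2 * S.ε * ‖S.errV η j‖ := by gcongr
      have a2 : S.ε * S.δ * η ^ 2 ≤ S.ε * (2 * S.ε) * η ^ 2 := by gcongr
      have a3 : 0 ≤ S.ε * ‖S.errX η j‖ := by positivity
      calc _ ≤ η * (C₁ * (2 * (S.ε * ‖S.errX η j‖) + 2 * S.ε * ‖S.errV η j‖ +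
            S.ε * (2 * S.ε) * η ^ 2)) :=
          mul_le_mul_of_nonneg_left (mul_le_mul_of_nonneg_left (by linarith) hC₁) hη
        _ = _ := by ring
    have hsum : ∀ m ≤ n, ‖S.errX η m‖ + ‖S.errV η m‖ ≤
        (K * (4 * C₁ + C₂) + C₃) * (S.ε * η ^ 2) + (1 + 4 * C₁) * (S.ε * η) *
          ∑ j ∈ Finset.range m, (‖S.errX η j‖ + ‖S.errV η j‖) := fun m hm => by
      have hmL := cast_mul_le_of_le hη hm hn
      have b1 := S.norm_errV_le hη hmL
      have b2 := h₃ S η N hη hN hper hNK m hmL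
      have b3 : ‖S.errX η m‖ ≤ ∑ j ∈ Finset.range m, (S.ε * η * (‖S.errX η j‖ + ‖S.errV η j‖) +
          ‖S.res η j‖ + C₂ * S.ε ^ 2 * η ^ 3) := by
        refine le_sum_of_succ_le (f := fun j => ‖S.errX η j‖) (by simp [errX_zero]) fun j hj => ?_
        refine (h₂ S η j hη hηK (cast_mul_le_of_le hη (hj.trans_le hm) hn)).trans ?_
        have c1 : S.ε * η * ‖S.res η j‖ ≤ 1 * ‖S.res η j‖ := by gcongr
        have c2 : 0 ≤ S.ε * η * ‖S.errX η j‖ := by positivity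
        linarith
      have b4 : ∑ j ∈ Finset.range m, (S.ε * η * (‖S.errX η j‖ + ‖S.errV η j‖) +
          ‖S.res η j‖ + C₂ * S.ε ^ 2 * η ^ 3) + ∑ j ∈ Finset.range m, ‖S.res η j‖ ≤
          ∑ j ∈ Finset.range m, ((1 + 4 * C₁) * (S.ε * η) * (‖S.errX η j‖ + ‖S.errV η j‖) +
            (4 * C₁ + C₂) * (S.ε ^ 2 * η ^ 3)) := by
        rw [← Finset.sum_add_distrib]
        refine Finset.sum_le_sum fun j hj => ?_
        have := hres j ((Finset.mem_range.1 hj).trans_le hm)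
        linarith
      have b6 : ∑ j ∈ Finset.range m, ((1 + 4 * C₁) * (S.ε * η) *
          (‖S.errX η j‖ + ‖S.errV η j‖) + (4 * C₁ + C₂) * (S.ε ^ 2 * η ^ 3)) =
          (1 + 4 * C₁) * (S.ε * η) * ∑ j ∈ Finset.range m, (‖S.errX η j‖ + ‖S.errV η j‖) +
            m * ((4 * C₁ + C₂) * (S.ε ^ 2 * η ^ 3)) := by
        rw [Finset.sum_add_distrib, ← Finset.mul_sum, Finset.sum_const, Finset.card_range,
          nsmul_eq_mul]
      -- Local errors `ε² η³`, over at most `K / (ε η)` steps.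
      have b5 : (m : ℝ) * ((4 * C₁ + C₂) * (S.ε ^ 2 * η ^ 3)) ≤
          K * (4 * C₁ + C₂) * (S.ε * η ^ 2) := by
        calc _ = (S.ε * η * m) * ((4 * C₁ + C₂) * (S.ε * η ^ 2)) := by ring
          _ ≤ K * ((4 * C₁ + C₂) * (S.ε * η ^ 2)) := by
            gcongr
            exact le_trans (by gcongr) hnK
          _ = _ := by ring
      linarith
    refine (le_mul_exp_of_le_sum (s := fun m => ‖S.errX η m‖ + ‖S.errV η m‖) (by positivity)
      (by positivity) hsum).trans ?_
    have : (1 + 4 * C₁) * (S.ε * η) * n ≤ (1 + 4 * C₁) * K := by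
      rw [mul_assoc]; gcongr
    calc _ ≤ (K * (4 * C₁ + C₂) + C₃) * (S.ε * η ^ 2) * Real.exp ((1 + 4 * C₁) * K) := by gcongr
      _ = _ := by ring

/-- The improved bound `O(δ η²)` for positions and parallel velocities. -/
theorem exists_strong_bound (A₀ : V →L[ℝ] V) (ρ : ℝ) {K ω β : ℝ} (hK : 1 ≤ K) (hω : ω ≠ 0)
    (hA₀ : A₀ * (A₀ * A₀) = -(ω ^ 2) • A₀) (hβ : 0 < β) :
    ∃ C : ℝ, 0 ≤ C ∧ ∀ (S : FastOrbit A₀ ρ K) (η : ℝ) (N : ℕ) (b : V), 0 ≤ η → 3 ≤ N →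
      ω * (N * η) = 2 * Real.pi → N * η ≤ K → η * K ≤ 1 → C * η ^ 2 ≤ 1 →
      (∀ t ∈ Set.Icc 0 S.L, ‖S.x t‖ + 2 ≤ ρ) → ‖b‖ ≤ K → (∀ v, inner ℝ b (S.A v) = 0) →
      (∀ v, β * ‖v‖ ≤ ‖S.A v‖ + |inner ℝ b v|) → ∀ n : ℕ, n * η ≤ S.L →
      ‖S.errX η n‖ ≤ C * (S.δ * η ^ 2) ∧ |inner ℝ b (S.errV η n)| ≤ C * (S.δ * η ^ 2) ∧
        ‖S.errV η n‖ ≤ C * (S.ε * η ^ 2) := by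
  obtain ⟨C₁, hC₁, h₁⟩ := exists_res_le A₀ ρ hK
  obtain ⟨C₄, hC₄, h₄⟩ := exists_midErr_force A₀ ρ hK hω hA₀
  obtain ⟨Cw, hCw, hw⟩ := exists_weak_bound A₀ ρ hK hω hA₀
  -- The residual sum enters the axial velocity, the transverse position and the axial position with
  -- factors `K`, `1` and `K`; hence `2 * K + 1`.
  set C₅ := (2 * K + 1) * (K * (C₁ * (Cw + 1)) + C₄) + Cw + 4 * K ^ 5 with hC₅
  set G := C₅ * Real.exp ((1 + (2 * K + 1) * (C₁ * β⁻¹)) * K) with hG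
  have hC₅0 : 0 ≤ C₅ := by positivity
  have hG0 : 0 ≤ G := by positivity
  refine ⟨Cw + G + β⁻¹ * G, by positivity,
    fun S η N b hη hN hper hNK hηK hsmall hρ hbK hb hβb n hn => ?_⟩
  have hε := S.ε_pos
  have hε1 := S.ε_le
  have hδ := S.δ_le
  have hδ0 := S.δ_nonneg
  have hβG : 0 ≤ β⁻¹ * G := by positivity
  have hη1 : η ≤ 1 := by nlinarith
  have hεη : S.ε * η ≤ 1 := by nlinarith
  have hsmall' : Cw * η ^ 2 ≤ 1 := by
    refine le_trans ?_ hsmall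
    gcongr
    linarith
  have hweak := hw S η N hη hN hper hNK hηK hsmall' hρ
  have hweakV : ∀ m : ℕ, m * η ≤ S.L → ‖S.errV η m‖ ≤ Cw * (S.ε * η ^ 2) := fun m hm => by
    linarith [hweak m hm, norm_nonneg (S.errX η m)]
  have hnK : S.ε * η * n ≤ K := by
    calc S.ε * η * n = S.ε * (n * η) := by ring
      _ ≤ S.ε * S.L := by gcongr
      _ ≤ K := S.εL_le
  have hmK : ∀ m ≤ n, ∀ y : ℝ, 0 ≤ y → (m : ℝ) * (S.ε * η * y) ≤ K * y := fun m hm y hy => by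
    calc (m : ℝ) * (S.ε * η * y) = S.ε * η * m * y := by ring
      _ ≤ K * y := by
        gcongr
        exact le_trans (by gcongr) hnK
  -- The Grönwall quantity omits the transverse velocity, which is only `O(ε η²)`. That component
  -- enters the residual with a factor `δ` and the transverse position with a factor `ε`, so its
  -- weak bound suffices.
  set r : ℕ → ℝ := fun m => |inner ℝ b (S.errX η m)| + ‖S.A (S.errX η m)‖ +
    |inner ℝ b (S.errV η m)| with hr
  have hXr : ∀ m, ‖S.errX η m‖ ≤ β⁻¹ * r m := fun m => by
    have h1 := hβb (S.errX η m)
    have h2 := abs_nonneg (inner ℝ b (S.errV η m))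
    rw [← div_eq_inv_mul, le_div_iff₀' hβ]
    change _ ≤ |inner ℝ b (S.errX η m)| + ‖S.A (S.errX η m)‖ + |inner ℝ b (S.errV η m)|
    linarith
  have hres : ∀ j < n, ‖S.res η j‖ ≤
      C₁ * β⁻¹ * (S.ε * η) * r j + S.ε * η * (C₁ * (Cw + 1) * (S.δ * η ^ 2)) := fun j hj => by
    have hjL := cast_mul_le_of_le hη hj.le hn
    have hle1 : ‖S.errX η j‖ + ‖S.errV η j‖ ≤ 1 := by
      refine (hweak j hjL).trans (le_trans ?_ hsmall')
      gcongr
      exact mul_le_of_le_one_left (sq_nonneg _) hε1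
    refine (h₁ S η j hη hηK hρ (cast_mul_le_of_le hη hj hn) hle1).trans ?_
    calc _ ≤ η * (C₁ * (S.ε * (β⁻¹ * r j) + S.δ * (Cw * (S.ε * η ^ 2)) + S.ε * S.δ * η ^ 2)) := by
          gcongr
          · exact hXr j
          · exact hweakV j hjL
      _ = _ := by ring
  have hR : ∀ m ≤ n, ∑ j ∈ Finset.range m, ‖S.res η j‖ ≤
      C₁ * β⁻¹ * (S.ε * η) * ∑ j ∈ Finset.range m, r j +
        K * (C₁ * (Cw + 1)) * (S.δ * η ^ 2) := fun m hm => by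
    have h1 := Finset.sum_le_sum fun j (hj : j ∈ Finset.range m) =>
      hres j ((Finset.mem_range.1 hj).trans_le hm)
    rw [Finset.sum_add_distrib, ← Finset.mul_sum, Finset.sum_const, Finset.card_range,
      nsmul_eq_mul] at h1
    have h2 := hmK m hm (C₁ * (Cw + 1) * (S.δ * η ^ 2)) (by positivity)
    linarith
  have hM : ∀ m ≤ n, ‖∑ j ∈ Finset.range m, S.res η j - midErr S.F η 0 m‖ ≤
      ∑ j ∈ Finset.range m, ‖S.res η j‖ + C₄ * (S.δ * η ^ 2) := fun m hm =>
    norm_sub_le_of_le (norm_sum_le _ _)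
      (h₄ S η N hη hN hper hNK m (cast_mul_le_of_le hη hm hn))
  have hsum : ∀ m ≤ n, r m ≤ C₅ * (S.δ * η ^ 2) +
      (1 + (2 * K + 1) * (C₁ * β⁻¹)) * (S.ε * η) * ∑ j ∈ Finset.range m, r j := fun m hm => by
    have hmL := cast_mul_le_of_le hη hm hn
    set R := ∑ j ∈ Finset.range m, ‖S.res η j‖ with hRdef
    have hR0 : 0 ≤ R := Finset.sum_nonneg fun _ _ => norm_nonneg _
    have hK0 := S.K_pos
    have b1 : |inner ℝ b (S.errV η m)| ≤ K * (R + C₄ * (S.δ * η ^ 2)) := by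
      rw [errV, S.inner_velocity_error_eq hη hb m hmL]
      refine (abs_real_inner_le_norm _ _).trans ?_
      have := hM m hm
      gcongr
    have b2 : ‖S.A (S.errX η m)‖ ≤ R + (Cw + C₄) * (S.δ * η ^ 2) := by
      have e : S.A (S.errX η m) = S.ε • S.errV η m +
          -(S.ε • (∑ j ∈ Finset.range m, S.res η j - midErr S.F η 0 m)) := by
        rw [← S.apply_position_error_eq hη m hmL, errX, errV]; abel
      rw [e]
      have c1 : ‖S.ε • S.errV η m‖ ≤ Cw * (S.δ * η ^ 2) := by
        rw [norm_smul, Real.norm_of_nonneg hε.le]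
        calc _ ≤ S.ε * (Cw * (S.ε * η ^ 2)) := by gcongr; exact hweakV m hmL
          _ = Cw * (S.ε ^ 2 * η ^ 2) := by ring
          _ ≤ _ := by gcongr; exact S.sq_le_δ
      have c2 : ‖-(S.ε • (∑ j ∈ Finset.range m, S.res η j - midErr S.F η 0 m))‖ ≤
          R + C₄ * (S.δ * η ^ 2) := by
        rw [norm_neg, norm_smul, Real.norm_of_nonneg hε.le]
        exact (mul_le_of_le_one_left (norm_nonneg _) hε1).trans (hM m hm)
      linarith [norm_add_le_of_le c1 c2]
    have b3 : |inner ℝ b (S.errX η m)| ≤ S.ε * η * ∑ j ∈ Finset.range m, r j + K * R +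
        4 * K ^ 5 * (S.δ * η ^ 2) := by
      have c0 : |inner ℝ b (S.errX η m)| ≤ ∑ j ∈ Finset.range m, (S.ε * η * r j +
          K * ‖S.res η j‖ + S.ε * η * (4 * K ^ 4 * (S.δ * η ^ 2))) := by
        refine le_sum_of_succ_le (f := fun j => |inner ℝ b (S.errX η j)|)
          (by simp [errX_zero]) fun j hj => ?_
        refine (S.inner_errX_succ_le hη hbK hb
          (cast_mul_le_of_le hη (hj.trans_le hm) hn)).trans ?_
        have c1 : S.ε * η * (K * ‖S.res η j‖) ≤ 1 * (K * ‖S.res η j‖) := by gcongr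
        have c2 : S.ε * η * |inner ℝ b (S.errV η j)| ≤ S.ε * η * r j := by
          gcongr
          change _ ≤ |inner ℝ b (S.errX η j)| + ‖S.A (S.errX η j)‖ + |inner ℝ b (S.errV η j)|
          linarith [abs_nonneg (inner ℝ b (S.errX η j)), norm_nonneg (S.A (S.errX η j))]
        linarith
      rw [Finset.sum_add_distrib, Finset.sum_add_distrib, ← Finset.mul_sum, ← Finset.mul_sum,
        Finset.sum_const, Finset.card_range, nsmul_eq_mul] at c0
      have c3 := hmK m hm (4 * K ^ 4 * (S.δ * η ^ 2)) (by positivity)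
      linarith
    have hRm := hR m hm
    have b4 : (2 * K + 1) * R ≤ (2 * K + 1) * (C₁ * β⁻¹ * (S.ε * η) * ∑ j ∈ Finset.range m, r j +
        K * (C₁ * (Cw + 1)) * (S.δ * η ^ 2)) := by gcongr
    have b5 : 0 ≤ K * C₄ * (S.δ * η ^ 2) := by positivity
    change |inner ℝ b (S.errX η m)| + ‖S.A (S.errX η m)‖ + |inner ℝ b (S.errV η m)| ≤ _
    rw [hC₅]
    linarith
  have hfin : r n ≤ G * (S.δ * η ^ 2) := by
    refine (le_mul_exp_of_le_sum (by positivity) (by positivity) hsum).trans ?_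
    have : (1 + (2 * K + 1) * (C₁ * β⁻¹)) * (S.ε * η) * n ≤
        (1 + (2 * K + 1) * (C₁ * β⁻¹)) * K := by
      rw [mul_assoc]
      have := S.K_pos
      gcongr
    calc _ ≤ C₅ * (S.δ * η ^ 2) * Real.exp ((1 + (2 * K + 1) * (C₁ * β⁻¹)) * K) := by gcongr
      _ = _ := by rw [hG]; ring
  have hp : 0 ≤ S.δ * η ^ 2 := by positivity
  have hp' : 0 ≤ S.ε * η ^ 2 := by positivity
  refine ⟨?_, ?_, ?_⟩
  · have h1 : β⁻¹ * r n ≤ β⁻¹ * (G * (S.δ * η ^ 2)) := by gcongr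
    have h2 := mul_nonneg (add_nonneg hCw hG0) hp
    linarith [hXr n]
  · have h1 : |inner ℝ b (S.errV η n)| ≤ r n := by
      change _ ≤ |inner ℝ b (S.errX η n)| + ‖S.A (S.errX η n)‖ + |inner ℝ b (S.errV η n)|
      linarith [abs_nonneg (inner ℝ b (S.errX η n)), norm_nonneg (S.A (S.errX η n))]
    have h2 := mul_nonneg (add_nonneg hCw hβG) hp
    linarith
  · have h2 := mul_nonneg (add_nonneg hG0 hβG) hp'
    linarith [hweakV n hn]

end FastOrbit

end GlobalErrors

/-! ### The charged particle in fast time -/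

section Fields

set_option linter.unusedSectionVars false

variable {V : Type*} [NormedAddCommGroup V] [InnerProductSpace ℝ V] [CompleteSpace V]
  [Nontrivial V]

/-- A `C²` vector field has bounded values and bounded, Lipschitz derivative on balls. -/
theorem exists_C11Ball [ProperSpace V] {f : V → V} (hf : ContDiff ℝ 2 f) (ρ : ℝ) :
    ∃ c : ℝ, 0 ≤ c ∧ C11Ball f (fderiv ℝ f) ρ c := by
  have hd : ContDiff ℝ 1 (fderiv ℝ f) := hf.fderiv_right (by norm_num)
  have hdd : Continuous fun y => ‖fderiv ℝ (fderiv ℝ f) y‖ :=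
    (hd.continuous_fderiv (by norm_num)).norm
  have hK := isCompact_closedBall (0 : V) ρ
  obtain ⟨c₀, h0⟩ := hK.exists_bound_of_continuousOn hf.continuous.continuousOn
  obtain ⟨c₁, h1⟩ := hK.exists_bound_of_continuousOn hd.continuous.continuousOn
  obtain ⟨c₂, h2⟩ := hK.exists_bound_of_continuousOn hdd.continuousOn
  refine ⟨|c₀| + |c₁| + |c₂|, by positivity, fun y hy => ⟨?_, ?_, ?_, fun z hz => ?_⟩⟩
  · exact (hf.differentiable (by norm_num) y).hasFDerivAt
  · linarith [h0 y hy, le_abs_self c₀, abs_nonneg c₁, abs_nonneg c₂]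
  · linarith [h1 y hy, le_abs_self c₁, abs_nonneg c₀, abs_nonneg c₂]
  · refine ((convex_closedBall (0 : V) ρ).norm_image_sub_le_of_norm_hasFDerivWithin_le
      (fun w _ => ((hd.differentiable (by norm_num) w).hasFDerivAt).hasFDerivWithinAt)
      (fun w hw => (le_abs_self _).trans (h2 w hw))
      hz hy).trans ?_
    gcongr
    linarith [le_abs_self c₂, abs_nonneg c₀, abs_nonneg c₁]

theorem C11Ball.mono {G : Type*} [NormedAddCommGroup G] [NormedSpace ℝ G] {f : V → G}
    {f' : V → V →L[ℝ] G} {ρ c d : ℝ} (h : C11Ball f f' ρ c) (hcd : c ≤ d) : C11Ball f f' ρ d := fun y hy => by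
  obtain ⟨h1, h2, h3, h4⟩ := h y hy
  exact ⟨h1, h2.trans hcd, h3.trans hcd, fun z hz => (h4 z hz).trans (by gcongr)⟩

theorem norm_smul_le_of_le_one {s ρ : ℝ} (hs : 0 ≤ s) (hs1 : s ≤ 1) {y : V} (hy : ‖y‖ ≤ ρ) :
    ‖s • y‖ ≤ ρ := by
  rw [norm_smul, Real.norm_of_nonneg hs]
  exact (mul_le_of_le_one_left (norm_nonneg _) hs1).trans hy

theorem C11Ball.comp_smul_lipschitz {B : V → V} {B' : V → V →L[ℝ] V} {ρ c s : ℝ}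
    (hB : C11Ball B B' ρ c) (hs : 0 ≤ s) (hs1 : s ≤ 1) {y z : V} (hy : ‖y‖ ≤ ρ) (hz : ‖z‖ ≤ ρ) :
    ‖B (s • y) - B (s • z)‖ ≤ c * (s * ‖y - z‖) := by
  refine (hB.lipschitz (norm_smul_le_of_le_one hs hs1 hy)
    (norm_smul_le_of_le_one hs hs1 hz)).trans_eq ?_
  rw [← smul_sub, norm_smul, Real.norm_of_nonneg hs]

/-- The slowly varying part of an operator-valued field `Λ ∘ B` is of size `s` when `B` is evaluated at
`s • y`. -/
theorem C11Ball.clm_comp_smul_sub {Λ : V →L[ℝ] V →L[ℝ] V} (hΛ : ‖Λ‖ ≤ 1) {B : V → V} {B' : V → V →L[ℝ] V} {ρ c s : ℝ}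
    (hc : 0 ≤ c) (hB : C11Ball B B' ρ c) (hs : 0 ≤ s) (hs1 : s ≤ 1) {x₀ : V} (hx₀ : ‖x₀‖ ≤ ρ) :
    C11Ball (fun y => Λ (B (s • y)) - Λ (B (s • x₀)))
      (fun y => s • Λ.comp (B' (s • y))) ρ (c * (2 * ρ + 1) * s) := by
  have hρ : 0 ≤ ρ := (norm_nonneg _).trans hx₀
  have hcs : 0 ≤ c * s := mul_nonneg hc hs
  have hcρ : 0 ≤ c * s * ρ := mul_nonneg hcs hρ
  intro y hy
  have hy' := mem_closedBall_zero_iff.1 hy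
  have hsy := mem_closedBall_zero_iff.2 (norm_smul_le_of_le_one hs hs1 hy')
  refine ⟨?_, ?_, ?_, fun z hz => ?_⟩
  · have h1 : HasFDerivAt (fun y : V => s • y) (s • ContinuousLinearMap.id ℝ V) y :=
      (hasFDerivAt_id y).const_smul s
    have h2 := (Λ.hasFDerivAt.comp y ((hB _ hsy).1.comp y h1)).sub_const (Λ (B (s • x₀)))
    refine h2.congr_fderiv ?_
    ext v w
    simp
  · change ‖Λ (B (s • y)) - Λ (B (s • x₀))‖ ≤ _
    rw [← map_sub]
    refine (Λ.le_of_opNorm_le hΛ _).trans ?_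
    rw [one_mul]
    refine ((hB.comp_smul_lipschitz hs hs1 hy' hx₀).trans ?_)
    have : ‖y - x₀‖ ≤ 2 * ρ := (norm_sub_le _ _).trans (by linarith)
    have := mul_le_mul_of_nonneg_left this hcs
    linarith
  · have h1 : ‖Λ.comp (B' (s • y))‖ ≤ 1 * c :=
      (ContinuousLinearMap.opNorm_comp_le _ _).trans
        (mul_le_mul hΛ (hB _ hsy).2.2.1 (norm_nonneg _) zero_le_one)
    rw [norm_smul, Real.norm_of_nonneg hs]
    have := mul_le_mul_of_nonneg_left h1 hs
    linarith
  · have hz' := mem_closedBall_zero_iff.1 hz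
    have hsz := mem_closedBall_zero_iff.2 (norm_smul_le_of_le_one hs hs1 hz')
    have h1 : ‖Λ.comp (B' (s • y) - B' (s • z))‖ ≤ 1 * (c * (s * ‖y - z‖)) := by
      refine (ContinuousLinearMap.opNorm_comp_le _ _).trans
        (mul_le_mul hΛ ?_ (norm_nonneg _) zero_le_one)
      refine ((hB _ hsy).2.2.2 _ hsz).trans_eq ?_
      rw [← smul_sub, norm_smul, Real.norm_of_nonneg hs]
    have e : s • Λ.comp (B' (s • y)) - s • Λ.comp (B' (s • z)) =
        s • Λ.comp (B' (s • y) - B' (s • z)) := by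
      rw [ContinuousLinearMap.comp_sub, smul_sub]
    rw [e, norm_smul, Real.norm_of_nonneg hs]
    have h2 := mul_le_mul_of_nonneg_left h1 hs
    have h3 : 0 ≤ c * s * ‖y - z‖ := by positivity
    have h4 : s * (c * s * ‖y - z‖) ≤ 1 * (c * s * ‖y - z‖) := by gcongr
    have h5 : 0 ≤ c * s * ρ * ‖y - z‖ := by positivity
    linarith

end Fields

/-! ### The rotation period and the passage to fast time -/

section ChargedParticle

theorem hat_ne_zero {b : E3} (hb : b ≠ 0) : hat b ≠ 0 := by
  intro h
  have hv : ∀ v, hat b v = 0 := fun v => by rw [h]; rfl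
  have h1 := hat_apply_coord b (EuclideanSpace.single 1 1)
  have h2 := hat_apply_coord b (EuclideanSpace.single 2 1)
  rw [hv] at h1 h2
  apply hb
  ext i
  fin_cases i
  · simpa using h2.2.1.symm
  · simpa using h2.1
  · simpa using h1.1.symm

theorem two_pi_mem_periods {b : E3} (hb : b ≠ 0) :
    Function.Periodic (fun t : ℝ => NormedSpace.exp (t • hat b)) (2 * Real.pi / ‖b‖) := by
  have hω : ‖b‖ ≠ 0 := norm_ne_zero_iff.2 hb
  intro t
  have e : ‖b‖ * (t + 2 * Real.pi / ‖b‖) = ‖b‖ * t + 2 * Real.pi := by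
    rw [mul_add, mul_div_cancel₀ _ hω]
  change NormedSpace.exp ((t + 2 * Real.pi / ‖b‖) • hat b) = NormedSpace.exp (t • hat b)
  rw [exp_smul_eq_of_cube hω (hat_pow_three b), exp_smul_eq_of_cube hω (hat_pow_three b), e,
    Real.sin_add_two_pi, Real.cos_add_two_pi]

/-- In Rodrigues' formula, applying `hat b` once more and pairing with `hat b v` removes the sine
term by skewness and leaves a nonzero multiple of `1 - cos`. -/
theorem cos_eq_one_of_exp_hat {b : E3} (hb : b ≠ 0) {t : ℝ}
    (h : NormedSpace.exp (t • hat b) = 1) : Real.cos (‖b‖ * t) = 1 := by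
  have hω : ‖b‖ ≠ 0 := norm_ne_zero_iff.2 hb
  obtain ⟨v, hv⟩ : ∃ v, hat b v ≠ 0 := by
    by_contra! hc
    exact hat_ne_zero hb (ContinuousLinearMap.ext hc)
  have h3 : hat b (hat b (hat b v)) = -(‖b‖ ^ 2) • hat b v :=
    DFunLike.congr_fun (hat_pow_three b) v
  have h1 : v + (Real.sin (‖b‖ * t) / ‖b‖) • hat b v +
      ((1 - Real.cos (‖b‖ * t)) / ‖b‖ ^ 2) • hat b (hat b v) = v :=
    DFunLike.congr_fun ((exp_smul_eq_of_cube hω (hat_pow_three b) t).symm.trans h) v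
  have h2 : ((1 - Real.cos (‖b‖ * t)) / ‖b‖ ^ 2) • hat b (hat b v) =
      -(Real.sin (‖b‖ * t) / ‖b‖) • hat b v := by
    rw [add_assoc, add_eq_left] at h1
    rw [neg_smul]
    exact eq_neg_of_add_eq_zero_right h1
  have h4 := congrArg (fun w => inner ℝ (hat b w) (hat b v)) h2
  simp only [map_smul, inner_smul_left, h3, inner_hat_self, mul_zero, real_inner_self_eq_norm_sq]
    at h4
  have hv2 : ‖hat b v‖ ^ 2 ≠ 0 := pow_ne_zero _ (norm_ne_zero_iff.2 hv)
  have h5 : (1 - Real.cos (‖b‖ * t)) * ‖hat b v‖ ^ 2 = 0 := by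
    have : (1 - Real.cos (‖b‖ * t)) / ‖b‖ ^ 2 * (-‖b‖ ^ 2 * ‖hat b v‖ ^ 2) = 0 := by
      simpa using h4
    field_simp at this
    linarith
  have := (mul_eq_zero.1 h5).resolve_right hv2
  linarith

/-- Periodicity makes `‖b‖ * P` a positive multiple of `2π`; minimality excludes every multiple but
the first. -/
theorem norm_mul_rotationPeriod {b : E3} (hb : b ≠ 0) {P : ℝ} (hP : IsRotationPeriod b P) :
    ‖b‖ * P = 2 * Real.pi := by
  have hω : 0 < ‖b‖ := norm_pos_iff.2 hb
  obtain ⟨⟨hP0, hper⟩, hmin⟩ := hP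
  have h1 : P ≤ 2 * Real.pi / ‖b‖ := hmin ⟨by positivity, two_pi_mem_periods hb⟩
  have h2 : NormedSpace.exp (P • hat b) = 1 := by
    have := hper 0
    simp only [zero_add] at this
    rw [this]
    exact (congrArg NormedSpace.exp (zero_smul ℝ (hat b))).trans NormedSpace.exp_zero
  obtain ⟨k, hk⟩ := (Real.cos_eq_one_iff _).1 (cos_eq_one_of_exp_hat hb h2)
  have hpos : 0 < (k : ℝ) * (2 * Real.pi) := by rw [hk]; positivity
  have hk1 : (1 : ℝ) ≤ k := by
    have : (0 : ℝ) < k := pos_of_mul_pos_left hpos (by positivity)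
    exact_mod_cast Int.cast_pos.1 this
  rw [le_div_iff₀ hω] at h1
  nlinarith [Real.pi_pos]

theorem mul_mem_Icc_of_mem_Icc_div {ε T t : ℝ} (hε : 0 < ε) (ht : t ∈ Set.Icc 0 (T / ε)) :
    ε * t ∈ Set.Icc 0 T :=
  ⟨mul_nonneg hε.le ht.1, by have := (le_div_iff₀ hε).1 ht.2; linarith⟩

/-- A solution of the charged-particle dynamics, in the fast time `t / ε`. -/
noncomputable def IsCPDSolution.fastOrbit {E B : E3 → E3} {ε q T : ℝ} {x₀ v₀ : E3} {x v : ℝ → E3}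
    (h : IsCPDSolution E B ε q T x₀ v₀ x v) {ρ K κ : ℝ} {E' : E3 → E3 →L[ℝ] E3}
    {D' : E3 → E3 →L[ℝ] E3 →L[ℝ] E3} (hK : 1 ≤ K) (hε : 0 < ε) (hε1 : ε ≤ 1) (hκ : 0 ≤ κ)
    (hκε : κ ≤ ε) (hT : T ≤ K) (hA : ‖B (ε ^ q • x₀)‖ ≤ K) (hA₀ : ‖B 0‖ ≤ K)
    (hsub : ‖B (ε ^ q • x₀) - B 0‖ ≤ K * κ) (hE : C11Ball E E' ρ K)
    (hD : C11Ball (fun y => hat (B (ε ^ q • y)) - hat (B (ε ^ q • x₀))) D' ρ (K * κ))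
    (hx : ∀ t ∈ Set.Icc 0 T, ‖x t‖ ≤ ρ) (hv : ∀ t ∈ Set.Icc 0 T, ‖v t‖ ≤ K) :
    FastOrbit (hat (B 0)) ρ K where
  ε := ε
  κ := κ
  L := T / ε
  A := hat (B (ε ^ q • x₀))
  E := E
  E' := E'
  D := fun y => hat (B (ε ^ q • y)) - hat (B (ε ^ q • x₀))
  D' := D'
  x := fun t => x (ε * t)
  u := fun t => v (ε * t)
  one_le := hK
  ε_pos := hε
  ε_le := hε1
  κ_nonneg := hκ
  κ_le := hκε
  εL_le := (mul_div_cancel₀ T hε.ne').trans_le hT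
  skew := inner_hat_self _
  norm_A := (norm_hat_le _).trans hA
  norm_A₀ := (norm_hat_le _).trans hA₀
  norm_A_sub := by rw [← hat_sub]; exact (norm_hat_le _).trans hsub
  hE := hE
  hD := hD
  norm_x := fun t ht => hx _ (mul_mem_Icc_of_mem_Icc_div hε ht)
  norm_u := fun t ht => hv _ (mul_mem_Icc_of_mem_Icc_div hε ht)
  deriv_x := fun t ht => by
    have h2 : HasDerivWithinAt (fun s : ℝ => ε * s) ε (Set.Icc 0 (T / ε)) t := by
      simpa using (hasDerivWithinAt_id t _).const_mul ε
    exact (h.deriv_x _ (mul_mem_Icc_of_mem_Icc_div hε ht)).scomp t h2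
      fun s hs => mul_mem_Icc_of_mem_Icc_div hε hs
  deriv_u := fun t ht => by
    have h2 : HasDerivWithinAt (fun s : ℝ => ε * s) ε (Set.Icc 0 (T / ε)) t := by
      simpa using (hasDerivWithinAt_id t _).const_mul ε
    refine ((h.deriv_v _ (mul_mem_Icc_of_mem_Icc_div hε ht)).scomp t h2
      fun s hs => mul_mem_Icc_of_mem_Icc_div hε hs).congr_deriv ?_
    rw [← hat_apply, hat_smul, smul_add]
    change ε • ε⁻¹ • hat (B (ε ^ q • x (ε * t))) (v (ε * t)) + _ = hat (B (ε ^ q • x₀)) (v (ε * t))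
      + (hat (B (ε ^ q • x (ε * t))) (v (ε * t)) - hat (B (ε ^ q • x₀)) (v (ε * t)) + _)
    rw [smul_inv_smul₀ hε.ne']
    abel

end ChargedParticle

/-! ### Parallel components -/

section ParallelComponent

theorem norm_unit_sub_le {β : ℝ} (hβ : 0 < β) {b c : E3} (hb : β ≤ ‖b‖) (hc : β ≤ ‖c‖) :
    ‖‖b‖⁻¹ • b - ‖c‖⁻¹ • c‖ ≤ 2 / β * ‖b - c‖ := by
  have hb0 : 0 < ‖b‖ := hβ.trans_le hb
  have hc0 : 0 < ‖c‖ := hβ.trans_le hc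
  have e : ‖b‖⁻¹ • b - ‖c‖⁻¹ • c = ‖b‖⁻¹ • (b - c) + (‖b‖⁻¹ - ‖c‖⁻¹) • c := by
    rw [smul_sub, sub_smul]; abel
  have h1 : ‖‖b‖⁻¹ • (b - c)‖ = ‖b‖⁻¹ * ‖b - c‖ := by
    rw [norm_smul, norm_inv, norm_norm]
  have h2 : ‖(‖b‖⁻¹ - ‖c‖⁻¹) • c‖ ≤ ‖b‖⁻¹ * ‖b - c‖ := by
    have e2 : (‖b‖⁻¹ - ‖c‖⁻¹) = ‖b‖⁻¹ * (‖c‖ - ‖b‖) * ‖c‖⁻¹ := by field_simp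
    rw [norm_smul, e2, norm_mul, norm_mul, norm_inv, norm_inv, norm_norm, norm_norm, mul_assoc,
      inv_mul_cancel₀ hc0.ne', mul_one, Real.norm_eq_abs]
    gcongr
    rw [norm_sub_rev]
    exact abs_norm_sub_norm_le _ _
  have h3 : ‖b‖⁻¹ * ‖b - c‖ ≤ β⁻¹ * ‖b - c‖ := by gcongr
  rw [e]
  calc _ ≤ β⁻¹ * ‖b - c‖ + β⁻¹ * ‖b - c‖ := norm_add_le_of_le (h1.trans_le h3) (h2.trans h3)
    _ = _ := by ring

theorem norm_unit {b : E3} (hb : 0 < ‖b‖) : ‖‖b‖⁻¹ • b‖ = 1 := by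
  rw [norm_smul, norm_inv, norm_norm, inv_mul_cancel₀ hb.ne']

theorem norm_parallelPart_sub_le {β : ℝ} (hβ : 0 < β) {b c : E3} (hb : β ≤ ‖b‖) (hc : β ≤ ‖c‖)
    (v : E3) : ‖parallelPart b v - parallelPart c v‖ ≤ 4 / β * ‖b - c‖ * ‖v‖ := by
  have h := norm_unit_sub_le hβ hb hc
  have hb1 := norm_unit (hβ.trans_le hb)
  have hc1 := norm_unit (hβ.trans_le hc)
  unfold parallelPart
  set p := ‖b‖⁻¹ • b
  set r := ‖c‖⁻¹ • c
  have e : inner ℝ p v • p - inner ℝ r v • r = inner ℝ (p - r) v • p + inner ℝ r v • (p - r) := by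
    rw [inner_sub_left, sub_smul, smul_sub]; abel
  have h1 : ‖inner ℝ (p - r) v • p‖ ≤ 2 / β * ‖b - c‖ * ‖v‖ := by
    rw [norm_smul, hb1, mul_one]
    exact (norm_inner_le_norm _ _).trans (by gcongr)
  have h2 : ‖inner ℝ r v • (p - r)‖ ≤ 2 / β * ‖b - c‖ * ‖v‖ := by
    rw [norm_smul]
    have := norm_inner_le_norm (𝕜 := ℝ) r v
    rw [hc1, one_mul] at this
    calc _ ≤ ‖v‖ * (2 / β * ‖b - c‖) := by gcongr
      _ = _ := by ring
  rw [e]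
  calc _ ≤ _ := norm_add_le_of_le h1 h2
    _ = _ := by ring

theorem parallelPart_sub (b v w : E3) :
    parallelPart b v - parallelPart b w = parallelPart b (v - w) := by
  rw [parallelPart, parallelPart, parallelPart, inner_sub_right, sub_smul]

theorem norm_parallelPart_le {β : ℝ} (hβ : 0 < β) {b : E3} (hb : β ≤ ‖b‖) (v : E3) :
    ‖parallelPart b v‖ ≤ β⁻¹ * |inner ℝ b v| := by
  rw [parallelPart, norm_smul, norm_unit (hβ.trans_le hb), mul_one, real_inner_smul_left, norm_mul,
    norm_inv, norm_norm, Real.norm_eq_abs]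
  gcongr

/-- Comparison of parallel components with respect to nearby fields. -/
theorem norm_parallelPart_sub_parallelPart_le {β : ℝ} (hβ : 0 < β) {a b c : E3} (ha : β ≤ ‖a‖)
    (hb : β ≤ ‖b‖) (hc : β ≤ ‖c‖) (v w : E3) :
    ‖parallelPart b v - parallelPart c w‖ ≤ β⁻¹ * |inner ℝ a (v - w)| +
      4 / β * ‖b - a‖ * ‖v - w‖ + 4 / β * ‖b - c‖ * ‖w‖ := by
  have e : parallelPart b v - parallelPart c w = parallelPart a (v - w) +
      (parallelPart b (v - w) - parallelPart a (v - w)) +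
      (parallelPart b w - parallelPart c w) := by
    rw [← parallelPart_sub b v w]; abel
  rw [e]
  exact norm_add_le_of_le (norm_add_le_of_le (norm_parallelPart_le hβ ha _)
    (norm_parallelPart_sub_le hβ hb ha _)) (norm_parallelPart_sub_le hβ hb hc _)

end ParallelComponent

/-! ### Convergence of the splitting scheme -/

section Convergence

/-- The scheme S2-new, in fast time, is the splitting scheme of the associated orbit. -/
theorem s2new_eq_seq {E B : E3 → E3} {ρ K q η : ℝ} {x₀ v₀ : E3} (S : FastOrbit (hat (B 0)) ρ K)
    (hE : S.E = E) (hA : S.A = hat (B (S.ε ^ q • x₀)))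
    (hD : ∀ y, S.D y = hat (B (S.ε ^ q • y)) - hat (B (S.ε ^ q • x₀))) (hx : S.x 0 = x₀)
    (hu : S.u 0 = v₀) (n : ℕ) : s2new E B S.ε q x₀ v₀ (η * S.ε) n = S.seq η n := by
  have hε := S.ε_pos.ne'
  have e1 : η * S.ε / 2 / S.ε = η / 2 := by field_simp
  have e2 : η * S.ε / S.ε = η := mul_div_cancel_right₀ _ hε
  have e3 : η * S.ε / 2 = S.ε * (η / 2) := by ring
  have hS : ∀ p, flowS B S.ε q x₀ (η * S.ε / 2) p =
      (p.1 + S.ε • flowInt S.A (η / 2) p.2, NormedSpace.exp ((η / 2) • S.A) p.2) := fun p => by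
    rw [flowS, e1, ← hA, e3, mul_smul]
    rfl
  have hT : ∀ p, flowT E B S.ε q x₀ (η * S.ε) p = (p.1, p.2 + S.kick η p.1 p.2) := fun p => by
    rw [flowT, e2, ← hD, ← hE, FastOrbit.kick, mul_comm η, add_sub_cancel]
    rfl
  induction n with
  | zero => rw [s2new, FastOrbit.seq, hx, hu]
  | succ n ih =>
    rw [s2new, ih, hS, hT, hS]
    rfl

/-- The error bounds for an orbit of the charged-particle dynamics in fast time. -/
theorem exists_parallel_error_le (a : E3) (ρ : ℝ) {K β ω : ℝ} (hK : 1 ≤ K) (hβ : 0 < β)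
    (hω : ω ≠ 0) (ha : hat a * (hat a * hat a) = -(ω ^ 2) • hat a) :
    ∃ C : ℝ, 0 ≤ C ∧ ∀ (S : FastOrbit (hat a) ρ K) (B : E3 → E3) (η s : ℝ) (N : ℕ) (x₀ : E3),
      0 ≤ η → 3 ≤ N → ω * (N * η) = 2 * Real.pi → N * η ≤ K → η * K ≤ 1 → C * η ^ 2 ≤ 1 →
      (∀ t ∈ Set.Icc 0 S.L, ‖S.x t‖ + 2 ≤ ρ) → S.A = hat (B (s • x₀)) →
      (∀ y, ‖y‖ ≤ ρ → β ≤ ‖B (s • y)‖) → ‖x₀‖ ≤ ρ → ‖B (s • x₀)‖ ≤ K →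
      (∀ y, ‖y‖ ≤ ρ → ‖B (s • y) - B (s • x₀)‖ ≤ K * S.κ) →
      (∀ y z, ‖y‖ ≤ ρ → ‖z‖ ≤ ρ → ‖B (s • y) - B (s • z)‖ ≤ K * S.κ * ‖y - z‖) →
      ∀ n : ℕ, n * η ≤ S.L →
      ‖(S.seq η n).1 - S.x (n * η)‖ ≤ C * (S.δ * η ^ 2) ∧
      ‖parallelPart (B (s • (S.seq η n).1)) (S.seq η n).2 -
        parallelPart (B (s • S.x (n * η))) (S.u (n * η))‖ ≤ C * (S.δ * η ^ 2) := by
  obtain ⟨C, hC, h⟩ := FastOrbit.exists_strong_bound (hat a) ρ hK hω ha hβ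
  have hK0 : 0 < K := one_pos.trans_le hK
  refine ⟨C + β⁻¹ * C + 4 / β * K * C + 4 / β * K * C * K, by positivity,
    fun S B η s N x₀ hη hN hper hNK hηK hsmall hρ hA hlow hx₀ hbK hB₀ hB₁ n hn => ?_⟩
  have hε := S.ε_pos
  have hε1 := S.ε_le
  have hδ0 := S.δ_nonneg
  have hκ0 := S.κ_nonneg
  have hκ1 : S.κ ≤ 1 := S.κ_le.trans hε1
  have p1 : 0 ≤ β⁻¹ * C := by positivity
  have p2 : 0 ≤ 4 / β * K * C := by positivity
  have p3 : 0 ≤ 4 / β * K * C * K := by positivity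
  have p4 : 0 ≤ S.δ * η ^ 2 := by positivity
  have hsmall' : C * η ^ 2 ≤ 1 := by
    refine le_trans ?_ hsmall
    gcongr
    linarith
  have hlowA : ∀ v, β * ‖v‖ ≤ ‖S.A v‖ + |inner ℝ (B (s • x₀)) v| := fun v => by
    rw [hA]
    refine le_trans ?_ (norm_mul_norm_le_hat_add_inner _ v)
    gcongr
    exact hlow x₀ hx₀
  obtain ⟨b1, b2, b3⟩ := h S η N (B (s • x₀)) hη hN hper hNK hηK hsmall' hρ hbK
    (fun v => by rw [hA]; exact inner_axis_hat _ v) hlowA n hn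
  have hmem : (n : ℝ) * η ∈ Set.Icc 0 S.L := ⟨by positivity, hn⟩
  have hη1 : η ≤ 1 := by nlinarith
  have hδη : S.δ * η ^ 2 ≤ 2 * η ^ 2 := by
    have := S.δ_le
    gcongr
    linarith
  have hxρ := hρ _ hmem
  have hX : ‖(S.seq η n).1‖ ≤ ρ := by
    have h1 := norm_add_le (S.x (n * η)) (S.errX η n)
    rw [FastOrbit.errX, add_sub_cancel] at h1
    have h2 : C * (S.δ * η ^ 2) ≤ C * (2 * η ^ 2) := by gcongr
    rw [FastOrbit.errX] at b1
    linarith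
  change ‖S.errX η n‖ ≤ _ ∧ _
  have hX1 : ‖S.x (n * η)‖ ≤ ρ := by linarith
  refine ⟨b1.trans ?_, ?_⟩
  · gcongr
    linarith
  have hmain := norm_parallelPart_sub_parallelPart_le hβ (hlow x₀ hx₀) (hlow _ hX) (hlow _ hX1)
    (S.seq η n).2 (S.u (n * η))
  refine hmain.trans ?_
  have c1 : β⁻¹ * |inner ℝ (B (s • x₀)) ((S.seq η n).2 - S.u (n * η))| ≤
      β⁻¹ * (C * (S.δ * η ^ 2)) := by
    gcongr
    exact b2
  -- The full velocity error is only `O(ε η²)`, but it is multiplied by the deviation `κ` of the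
  -- local field direction from the frozen one.
  have c2 : 4 / β * ‖B (s • (S.seq η n).1) - B (s • x₀)‖ * ‖(S.seq η n).2 - S.u (n * η)‖ ≤
      4 / β * K * C * (S.δ * η ^ 2) := by
    calc _ ≤ 4 / β * (K * S.κ) * (C * (S.ε * η ^ 2)) := by
          gcongr
          · exact hB₀ _ hX
          · exact b3
      _ ≤ 4 / β * (K * S.κ) * (C * (1 * η ^ 2)) := by gcongr
      _ = 4 / β * K * C * (S.κ * η ^ 2) := by ring
      _ ≤ _ := by gcongr; exact S.κ_le_δ
  have c3 : 4 / β * ‖B (s • (S.seq η n).1) - B (s • S.x (n * η))‖ * ‖S.u (n * η)‖ ≤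
      4 / β * K * C * K * (S.δ * η ^ 2) := by
    calc _ ≤ 4 / β * (K * S.κ * (C * (S.δ * η ^ 2))) * K := by
          gcongr
          · exact (hB₁ _ _ hX hX1).trans (by gcongr; exact b1)
          · exact S.norm_u _ hmem
      _ ≤ 4 / β * (K * 1 * (C * (S.δ * η ^ 2))) * K := by gcongr
      _ = _ := by ring
  have p5 := mul_nonneg hC p4
  linarith

end Convergence

/-! ### Uniform constants and the main theorem -/

section Main

theorem rpow_le_of_one_le {ε q : ℝ} (hε : 0 < ε) (hε1 : ε ≤ 1) (hq : 1 ≤ q) : ε ^ q ≤ ε :=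
  (Real.rpow_le_rpow_of_exponent_ge hε hε1 hq).trans_eq (Real.rpow_one ε)

theorem sq_le_rpow_of_le_two {ε q : ℝ} (hε : 0 < ε) (hε1 : ε ≤ 1) (hq : q ≤ 2) :
    ε ^ 2 ≤ ε ^ q := by
  rw [← Real.rpow_two]
  exact Real.rpow_le_rpow_of_exponent_ge hε hε1 hq

theorem rpow_sub_two_mul_sq {ε : ℝ} (hε : 0 < ε) (q η : ℝ) :
    ε ^ (q - 2) * (η * ε) ^ 2 = ε ^ q * η ^ 2 := by
  rw [Real.rpow_sub hε, Real.rpow_two]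
  field_simp

/-- The data of the charged-particle dynamics are uniformly bounded in fast time. -/
theorem exists_uniform_bounds (E B : E3 → E3) (hE : ContDiff ℝ 2 E) (hB : ContDiff ℝ 2 B)
    {ρ T T₀ : ℝ} (hρ : 0 ≤ ρ) (hT : 0 ≤ T) (hT₀ : 0 ≤ T₀) :
    ∃ K : ℝ, 1 ≤ K ∧ ρ ≤ K ∧ T ≤ K ∧ T₀ ≤ K ∧ C11Ball E (fderiv ℝ E) ρ K ∧
      (∀ y, ‖y‖ ≤ ρ → ‖B y‖ ≤ K) ∧
      (∀ s : ℝ, 0 ≤ s → s ≤ 1 → ∀ y z, ‖y‖ ≤ ρ → ‖z‖ ≤ ρ →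
        ‖B (s • y) - B (s • z)‖ ≤ K * s ∧ ‖B (s • y) - B (s • z)‖ ≤ K * s * ‖y - z‖) ∧
      (∀ s : ℝ, 0 ≤ s → s ≤ 1 → ∀ x₀, ‖x₀‖ ≤ ρ →
        C11Ball (fun y => hat (B (s • y)) - hat (B (s • x₀)))
          (fun y => s • hatL.comp (fderiv ℝ B (s • y))) ρ (K * s)) := by
  obtain ⟨c, hc, hEc⟩ := exists_C11Ball hE ρ
  obtain ⟨d, hd, hBd⟩ := exists_C11Ball hB ρ
  have hdρ : 0 ≤ d * ρ := mul_nonneg hd hρ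
  have hdK : d * (2 * ρ + 1) ≤ 1 + ρ + T + T₀ + c + d * (2 * ρ + 1) := by linarith
  refine ⟨1 + ρ + T + T₀ + c + d * (2 * ρ + 1), by linarith, by linarith, by linarith,
    by linarith, hEc.mono (by linarith), fun y hy => ?_, fun s hs hs1 y z hy hz => ?_,
    fun s hs hs1 x₀ hx₀ => ?_⟩
  · exact (hBd y (mem_closedBall_zero_iff.2 hy)).2.1.trans (by linarith)
  · have h := hBd.comp_smul_lipschitz hs hs1 hy hz
    have hyz : ‖y - z‖ ≤ 2 * ρ := (norm_sub_le _ _).trans (by linarith)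
    have hds : 0 ≤ d * s := mul_nonneg hd hs
    have h1 := mul_le_mul_of_nonneg_left hyz hds
    have h2 := mul_le_mul_of_nonneg_right hdK hs
    constructor
    · linarith
    · refine h.trans ?_
      rw [← mul_assoc]
      gcongr
      linarith
  · refine (hBd.clm_comp_smul_sub norm_hatL_le hd hs hs1 hx₀).mono ?_
    gcongr

theorem theorem2p1 (E B : E3 → E3) (hE : ContDiff ℝ 2 E) (hB : ContDiff ℝ 2 B)
    (hB0 : B 0 ≠ 0) (T₀ : ℝ) (hT₀ : IsRotationPeriod (B 0) T₀)
    (x₀ v₀ : E3) (T : ℝ) (hT : 0 < T) (q : ℝ) (hq1 : 1 ≤ q) (hq2 : q ≤ 2) (R : ℝ) :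
    ∃ N₀ : ℕ, 0 < N₀ ∧ ∃ C : ℝ, 0 < C ∧ ∃ ε₀ : ℝ, 0 < ε₀ ∧
      ∀ ε : ℝ, 0 < ε → ε ≤ 1 →
      ∀ x v : ℝ → E3, IsCPDSolution E B ε q T x₀ v₀ x v →
      (∀ t ∈ Set.Icc 0 T, ‖x t‖ ≤ R ∧ ‖v t‖ ≤ R) →
      ∀ N : ℕ, N₀ ≤ N → ∀ h : ℝ, h = T₀ / N * ε → ∀ n : ℕ, n * h ≤ T →
        ‖(s2new E B ε q x₀ v₀ h n).1 - x (n * h)‖ ≤ C * (ε ^ (q - 2) * h ^ 2) ∧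
        (ε ≤ ε₀ →
          ‖parallelPart (B (ε ^ q • (s2new E B ε q x₀ v₀ h n).1)) (s2new E B ε q x₀ v₀ h n).2
            - parallelPart (B (ε ^ q • x (n * h))) (v (n * h))‖
              ≤ C * (ε ^ (q - 2) * h ^ 2)) ∧
        ((∀ y, B y = B 0) →
          ‖(s2new E B ε q x₀ v₀ h n).1 - x (n * h)‖ ≤ C * h ^ 2 ∧
          ‖parallelPart (B (ε ^ q • (s2new E B ε q x₀ v₀ h n).1)) (s2new E B ε q x₀ v₀ h n).2
            - parallelPart (B (ε ^ q • x (n * h))) (v (n * h))‖ ≤ C * h ^ 2) := by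
  have hω : 0 < ‖B 0‖ := norm_pos_iff.2 hB0
  have hT₀0 : 0 < T₀ := hT₀.1.1
  have hper := norm_mul_rotationPeriod hB0 hT₀
  have hβ : 0 < ‖B 0‖ / 2 := by positivity
  -- The margin two leaves room for the numerical and intermediate positions.
  set ρ : ℝ := |R| + 2 with hρdef
  have hρ0 : 0 ≤ ρ := by positivity
  have hRρ : R + 2 ≤ ρ := by linarith [le_abs_self R]
  obtain ⟨K, hK, hρK, hTK, hT₀K, hEK, hBK, hBlip, hDK⟩ :=
    exists_uniform_bounds E B hE hB hρ0 hT.le hT₀0.le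
  have hK0 : 0 < K := one_pos.trans_le hK
  obtain ⟨Cw, hCw, hweak⟩ := FastOrbit.exists_weak_bound (hat (B 0)) ρ hK hω.ne' (hat_pow_three _)
  obtain ⟨Cs, hCs, hstrong⟩ := exists_parallel_error_le (B 0) ρ hK hβ hω.ne' (hat_pow_three _)
  -- Below this threshold `B (ε^q y)` stays within `‖B 0‖ / 2` of `B 0` on the ball, so neither the
  -- axis nor the field direction degenerates.
  set ε₀ : ℝ := ‖B 0‖ / 2 / K with hε₀def
  have hε₀ : 0 < ε₀ := by positivity
  obtain ⟨M, hM⟩ := exists_nat_ge (T₀ * (K + Cw + Cs))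
  -- `M` makes `η` small against all constants, and three cells per period are needed for exactness.
  -- In `C`, the term `Cw / ε₀` serves `ε ≥ ε₀`, `2 * Cs` serves small `ε`, and `1` ensures
  -- positivity.
  refine ⟨M + 3, by omega, 1 + Cw / ε₀ + 2 * Cs, by positivity, ε₀, hε₀, ?_⟩
  intro ε hε hε1 x v hsol hxv N hN h hh n hn
  have hs0 : 0 ≤ ε ^ q := (Real.rpow_pos_of_pos hε q).le
  have hsε := rpow_le_of_one_le hε hε1 hq1
  have hs1 : ε ^ q ≤ 1 := hsε.trans hε1
  have h2s := sq_le_rpow_of_le_two hε hε1 hq2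
  have hN3 : 3 ≤ N := by omega
  have hN0 : (0 : ℝ) < N := by exact_mod_cast (by omega : 0 < N)
  set η : ℝ := T₀ / N with hηdef
  have hη0 : 0 < η := by positivity
  have hNη : N * η = T₀ := mul_div_cancel₀ _ hN0.ne'
  have hηC : η * (K + Cw + Cs) ≤ 1 := by
    rw [hηdef, div_mul_eq_mul_div, div_le_one hN0]
    refine hM.trans ?_
    exact_mod_cast (by omega : M ≤ N)
  have hηK : η * K ≤ 1 := le_trans (by gcongr; linarith) hηC
  have hη1 : η ≤ 1 := by nlinarith
  have hsmallw : Cw * η ^ 2 ≤ 1 := by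
    have : η * Cw ≤ 1 := le_trans (by gcongr; linarith) hηC
    calc Cw * η ^ 2 = η * (η * Cw) := by ring
      _ ≤ 1 := mul_le_one₀ hη1 (by positivity) this
  have hsmalls : Cs * η ^ 2 ≤ 1 := by
    have : η * Cs ≤ 1 := le_trans (by gcongr; linarith) hηC
    calc Cs * η ^ 2 = η * (η * Cs) := by ring
      _ ≤ 1 := mul_le_one₀ hη1 (by positivity) this
  have hperN : ‖B 0‖ * (N * η) = 2 * Real.pi := by rw [hNη, hper]
  have hNK : N * η ≤ K := by rwa [hNη]
  have hx₀ : ‖x₀‖ ≤ ρ := by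
    have := (hxv 0 ⟨le_rfl, hT.le⟩).1
    rw [hsol.init_x] at this
    linarith
  have h0ρ : ‖(0 : E3)‖ ≤ ρ := by rwa [norm_zero]
  have hB0K : ‖B 0‖ ≤ K := hBK 0 h0ρ
  have hBx₀K : ‖B (ε ^ q • x₀)‖ ≤ K := hBK _ (norm_smul_le_of_le_one hs0 hs1 hx₀)
  have hxρ : ∀ t ∈ Set.Icc 0 T, ‖x t‖ ≤ ρ := fun t ht => by linarith [(hxv t ht).1]
  have hvK : ∀ t ∈ Set.Icc 0 T, ‖v t‖ ≤ K := fun t ht => by linarith [(hxv t ht).2]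
  have hBsub0 : ∀ y, ‖y‖ ≤ ρ → ‖B (ε ^ q • y) - B 0‖ ≤ K * ε ^ q := fun y hy => by
    have := (hBlip _ hs0 hs1 y 0 hy h0ρ).1
    rwa [smul_zero] at this
  have hnη : n * η ≤ T / ε := by
    rw [le_div_iff₀ hε, mul_assoc, ← hh]
    exact hn
  have hnh : n * h = ε * (n * η) := by rw [hh]; ring
  have hρ2 : ∀ t ∈ Set.Icc 0 (T / ε), ‖x (ε * t)‖ + 2 ≤ ρ := fun t ht => by
    linarith [(hxv _ (mul_mem_Icc_of_mem_Icc_div hε ht)).1]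
  -- Here `κ = ε^q`, which is at most `ε` because `q ≥ 1`; and `q ≤ 2` gives `δ ≤ 2 ε^q`.
  let S : FastOrbit (hat (B 0)) ρ K := hsol.fastOrbit hK hε hε1 hs0 hsε hTK hBx₀K hB0K
    (hBsub0 x₀ hx₀) hEK (hDK _ hs0 hs1 x₀ hx₀) hxρ hvK
  have hscheme : s2new E B ε q x₀ v₀ h n = S.seq η n := by
    rw [hh]
    exact s2new_eq_seq S rfl rfl (fun _ => rfl)
      ((congrArg x (mul_zero ε)).trans hsol.init_x) ((congrArg v (mul_zero ε)).trans hsol.init_v) n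
  have hCw0 : 0 ≤ Cw / ε₀ := by positivity
  have hp : 0 ≤ ε ^ q * η ^ 2 := by positivity
  have hstrongS : ε ≤ ε₀ → ‖(S.seq η n).1 - x (ε * (n * η))‖ ≤ Cs * (S.δ * η ^ 2) ∧
      ‖parallelPart (B (ε ^ q • (S.seq η n).1)) (S.seq η n).2 -
        parallelPart (B (ε ^ q • x (ε * (n * η)))) (v (ε * (n * η)))‖ ≤
        Cs * (S.δ * η ^ 2) := fun hεε₀ => by
    refine hstrong S B η (ε ^ q) N x₀ hη0.le hN3 hperN hNK hηK hsmalls hρ2 rfl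
      (fun y hy => ?_) hx₀ hBx₀K (fun y hy => (hBlip _ hs0 hs1 y x₀ hy hx₀).1)
      (fun y z hy hz => (hBlip _ hs0 hs1 y z hy hz).2) n hnη
    have h1 : K * ε ^ q ≤ ‖B 0‖ / 2 := by
      calc K * ε ^ q ≤ K * ε₀ := by gcongr; exact hsε.trans hεε₀
        _ = ‖B 0‖ / 2 := mul_div_cancel₀ _ hK0.ne'
    have h2 := norm_sub_norm_le (B 0) (B (ε ^ q • y))
    rw [norm_sub_rev] at h2
    linarith [hBsub0 y hy]
  have hδ : Cs * (S.δ * η ^ 2) ≤ (1 + Cw / ε₀ + 2 * Cs) * (ε ^ q * η ^ 2) := by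
    have h1 : S.δ * η ^ 2 ≤ 2 * ε ^ q * η ^ 2 := by
      gcongr
      change ε ^ 2 + ε ^ q ≤ _
      linarith
    have h2 := mul_le_mul_of_nonneg_left h1 hCs
    have h3 := mul_nonneg (add_nonneg zero_le_one hCw0) hp
    linarith
  rw [hnh, hscheme]
  refine ⟨?_, fun hεε₀ => ?_, fun hunif => ?_⟩
  · rw [hh, rpow_sub_two_mul_sq hε]
    rcases le_total ε ε₀ with hεε₀ | hεε₀
    · exact (hstrongS hεε₀).1.trans hδ
    · have h1 := hweak S η N hη0.le hN3 hperN hNK hηK hsmallw hρ2 n hnη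
      have h2 : ‖S.errX η n‖ ≤ Cw * (ε * η ^ 2) :=
        le_trans (le_add_of_nonneg_right (norm_nonneg _)) h1
      -- For `ε ≥ ε₀` the weak rate is enough, as `ε₀ ε ≤ ε² ≤ ε^q`.
      have h3 : ε * η ^ 2 ≤ ε₀⁻¹ * (ε ^ q * η ^ 2) := by
        rw [← mul_assoc]
        gcongr
        rw [← div_eq_inv_mul, le_div_iff₀ hε₀]
        nlinarith
      have h4 := mul_le_mul_of_nonneg_left h3 hCw
      have h5 := mul_nonneg hCs hp
      change ‖S.errX η n‖ ≤ _
      rw [div_eq_mul_inv]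
      linarith
  · rw [hh, rpow_sub_two_mul_sq hε]
    exact (hstrongS hεε₀).2.trans hδ
  · have hD : C11Ball (fun y => hat (B (ε ^ q • y)) - hat (B (ε ^ q • x₀)))
        (fun _ => (0 : E3 →L[ℝ] E3 →L[ℝ] E3)) ρ (K * 0) := by
      have e : (fun y => hat (B (ε ^ q • y)) - hat (B (ε ^ q • x₀))) = fun _ => 0 := by
        funext y
        rw [hunif, hunif (ε ^ q • x₀), sub_self]
      rw [e]
      intro y _
      refine ⟨hasFDerivAt_const _ _, ?_, ?_, fun z _ => ?_⟩ <;> simp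
    -- The same solution regarded as an orbit with `κ = 0`: now `δ = ε²`, so `δ η² = h²`. The field
    -- is bounded below for every `ε`, so no threshold is needed.
    let S₀ : FastOrbit (hat (B 0)) ρ K := hsol.fastOrbit hK hε hε1 le_rfl hε.le hTK hBx₀K hB0K
      (by rw [hunif (ε ^ q • x₀)]; simp) hEK hD hxρ hvK
    have hδ₀ : Cs * (S₀.δ * η ^ 2) ≤ (1 + Cw / ε₀ + 2 * Cs) * h ^ 2 := by
      have e : S₀.δ * η ^ 2 = h ^ 2 := by
        change (ε ^ 2 + 0) * η ^ 2 = h ^ 2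
        rw [hh]; ring
      rw [e]
      gcongr
      linarith
    have hB₀ : ∀ y z, B y - B z = 0 := fun y z => by rw [hunif y, hunif z, sub_self]
    have hmain := hstrong S₀ B η (ε ^ q) N x₀ hη0.le hN3 hperN hNK hηK hsmalls hρ2 rfl
      (fun y _ => by rw [hunif (ε ^ q • y)]; linarith) hx₀ hBx₀K
      (fun y _ => by
        rw [hB₀, norm_zero]; exact mul_nonneg hK0.le le_rfl)
      (fun y z _ _ => by
        rw [hB₀, norm_zero]; exact mul_nonneg (mul_nonneg hK0.le le_rfl) (norm_nonneg _)) n hnη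
    have hscheme₀ : S.seq η n = S₀.seq η n := by
      rw [← hscheme, hh]
      exact s2new_eq_seq S₀ rfl rfl (fun _ => rfl)
        ((congrArg x (mul_zero ε)).trans hsol.init_x)
        ((congrArg v (mul_zero ε)).trans hsol.init_v) n
    rw [hscheme₀]
    exact ⟨hmain.1.trans hδ₀, hmain.2.trans hδ₀⟩

end Main
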